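/- **Notation.** Let $R$ be the root system of type $A_n$ with positive roots $R^+$, half sum $\rho$ of the positive roots, dominant integral weights $P^+$ and real weight space $X\otimes\mathbb R$, and let $l\ge 1$ be an integer. Let $W_l$ be the affine Weyl group, generated by the reflections in the hyperplanes $H_{\alpha,k}=\{x\in X\otimes\mathbb R:\langle x+\rho,\alpha^\vee\rangle=kl\}$ ($\alpha\in R^+$, $k\in\mathbb Z$). Write $x<H_{\alpha,k}$ (resp. $x>H_{\alpha,k}$) if $\langle x+\rho,\alpha^\vee\rangle<kl$ (resp. $>kl$). A point $x\in X\otimes\mathbb R$ is called dominant if $\langle x+\rho,\alpha^\vee\rangle>0$ for all $\alpha\in R^+$; the integral dominant points are exactly the elements of $P^+$. Write $\kappa\le\lambda$ if $\lambda-\kappa$ is a nonnegative combination of positive roots. A pattern is a finite $\mathbb Z[q,q^{-1}]$-linear combination of weights. It is indecomposable with highest weight $\lambda$ if it has the form $\lambda+\sum_{\kappa<\lambda}P_\kappa(q)\,\kappa$ with $P_\kappa\in q\,\mathbb Z[q]$, the sum being over dominant $\kappa\in W_l\lambda$. For a $W_l$-orbit $\Pi$ and a point $\kappa$, let $\kappa_\Pi$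 be the element of $\Pi$ in the closure of the facet of $\kappa$ (if there is one), and let $u(\kappa,\Pi)$ and $o(\kappa,\Pi)$ be the numbers of hyperplanes $H\ni\kappa_\Pi$ with $\kappa<H$ and with $\kappa>H$, respectively. If $\tau$ and $\mu$ lie in the closure of a common alcove, $W_\tau\subseteq W_\mu$ are their stabilizers in $W_l$, and $\Pi=W_l\mu$, then the $\mathbb Z[q,q^{-1}]$-linear translation operators between $W_l\tau$ and $\Pi$ are given by $$\Theta_*\,\kappa=q^{-o(\kappa,\Pi)}\,\kappa_\Pi\quad(\kappa\in W_l\tau),\qquad \Theta^*\,y=\sum_{\kappa\in W_l\tau,\ \kappa_\Pi=y}q^{u(\kappa,\Pi)}\,\kappa\quad(y\in\Pi),$$ where all non-dominant weights are set equal to $0$. For dominant $\nu,\lambda$ in the closure of a common alcove, choose a weight $\tau$ such that $\nu,\lambda,\tau$ lie in the closure of a common alcove and the hyperplanes through $\tau$ are exactly those through both $\nu$ and $\lambda$ (so $W_\tau=W_\nu\cap W_\lambda$), and let $\Theta_{\nu,\lambda}$ be the composite $\Theta_*\circ\Theta^*$ from $W_l\nu$ through $W_l\tau$ to $W_l\lambda$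 (this is $\Theta_*$ if $\tau=\nu$ and $\Theta^*$ if $\tau=\lambda$). A path to $\lambda$ is a sequence of dominant weights $\mu^1,\dots,\mu^N=\lambda$ such that $\mu^1$ lies in the closure of the fundamental alcove ($0<\langle\mu^1+\rho,\alpha^\vee\rangle\le l$ for all $\alpha\in R^+$) and each step $\nu=\mu^i$, $\lambda'=\mu^{i+1}$ goes upwards between neighbours: $\nu$ and $\lambda'$ lie in the closure of a common alcove, $\lambda'$ is not below any hyperplane through $\nu$, and $\nu$ is not above any hyperplane through $\lambda'$. The singular combinatorics along a path starts with the pattern $P_{\mu^1}=\mu^1$. In each step from $\nu$ to $\lambda'$ it applies $\Theta_{\nu,\lambda'}$ to the pattern obtained for $\nu$, and then subtracts finitely many terms $\gamma_\kappa(q)P_\kappa$ so as to arrive at an indecomposable pattern with highest weight $\lambda'$; here $\kappa\in W_l\lambda'$, $\kappa<\lambda'$, $\gamma_\kappa(q)=\gamma_\kappa(q^{-1})\in\mathbb Z[q,q^{-1}]$, and $P_\kappa$ is a pattern obtained by the same procedure along some path to $\kappa$. **Theorem.** For root systems of type $A$ the singular combinatorics for tilting patterns is well defined, i.e. it does not depend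 on the path of weights. Precisely: for every $n\ge 0$ and $l\ge1$ there is a pattern $P_\lambda$ for each $\lambda\in X\otimes\mathbb R$ such that the following hold. 1. Every real dominant weight $\lambda$ is the end point of a path of real dominant weights. 2. For every path of real dominant weights, with end point $\lambda$ say, the singular combinatorics along the path can be carried out, and whatever choices are made (of intermediate weights $\tau$, of the subtracted terms, and of the paths by which the subtracted patterns were obtained), its result is $P_\lambda$. 3. The same holds, with the same $P_\lambda$, if all weights of the paths (including the paths used for the subtracted patterns) are required to lie in $P^+$; only the intermediate weights $\tau$ may then be non-integral. -/

import Mathlib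

namespace SingularTilting

/-! The standard realization of the root system of type `A_n`: the ambient space `X ⊗ ℝ` is the
space of vectors of `ℝ^(n+1)` with coordinate sum zero, and the positive roots are
`ε_i - ε_j` with `i < j`. -/

/-- The real weight space `X ⊗ ℝ` of type `A_n`. -/
def WeightSpace (n : ℕ) : Submodule ℝ (Fin (n + 1) → ℝ) where
  carrier := {x | ∑ i, x i = 0}
  add_mem' := by
    intro a b ha hb
    simp only [Set.mem_ofPred_eq, Pi.add_apply, Finset.sum_add_distrib] at *
    rw [ha, hb, add_zero]
  zero_mem' := by simp
  smul_mem' := by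
    intro c x hx
    simp only [Set.mem_ofPred_eq, Pi.smul_apply, smul_eq_mul, ← Finset.mul_sum] at *
    rw [hx, mul_zero]

/-- The positive roots of type `A_n`; the pair `(i, j)` with `i < j` stands for `ε_i - ε_j`. -/
abbrev PosRoot (n : ℕ) : Type := {p : Fin (n + 1) × Fin (n + 1) // p.1 < p.2}

/-- The root `ε_i - ε_j` as a vector. -/
def rootVec {n : ℕ} (α : PosRoot n) : WeightSpace n :=
  ⟨Pi.single α.1.1 1 - Pi.single α.1.2 1, by
    change ∑ i, (Pi.single α.1.1 (1 : ℝ) - Pi.single α.1.2 (1 : ℝ) : Fin (n + 1) → ℝ) i = 0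
    simp [Finset.sum_sub_distrib]⟩

/-- The pairing `⟨x, α^∨⟩` with the coroot of `α`. -/
def pairing {n : ℕ} (x : WeightSpace n) (α : PosRoot n) : ℝ := x.1 α.1.1 - x.1 α.1.2

/-- Half the sum of the positive roots. -/
noncomputable def rho (n : ℕ) : WeightSpace n := (1 / 2 : ℝ) • ∑ α : PosRoot n, rootVec α

/-- `⟨x + ρ, α^∨⟩`. -/
noncomputable def level {n : ℕ} (x : WeightSpace n) (α : PosRoot n) : ℝ := pairing (x + rho n) α

/-- The dominant integral weights `P^+`. -/
def PPlus (n : ℕ) : Set (WeightSpace n) := {x | ∀ α : PosRoot n, ∃ k : ℕ, pairing x α = k}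

/-- The real dominant weights: `x + ρ` lies in the open dominant Weyl chamber. The integral weights
among them are exactly those in `P^+`. -/
def realDominant (n : ℕ) : Set (WeightSpace n) := {x | ∀ α : PosRoot n, 0 < level x α}

/-- The usual order on weights: `lam - kap` is a nonnegative combination of positive roots. -/
def WeightLE {n : ℕ} (kap lam : WeightSpace n) : Prop :=
  ∃ c : PosRoot n → ℝ, (∀ α, 0 ≤ c α) ∧ lam - kap = ∑ α, c α • rootVec α

def WeightLT {n : ℕ} (kap lam : WeightSpace n) : Prop := WeightLE kap lam ∧ kap ≠ lam

/-! The affine Weyl group `W_l` with its dot action, and its alcove geometry. -/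

/-- The reflecting hyperplanes of `W_l`: the pair `(α, k)` stands for
`{x | ⟨x + ρ, α^∨⟩ = k l}`. -/
abbrev Hyperplane (n : ℕ) : Type := PosRoot n × ℤ

section Geometry

variable {n : ℕ} (l : ℕ)

/-- `x` lies on `H`. -/
def On (H : Hyperplane n) (x : WeightSpace n) : Prop := level x H.1 = H.2 * l

/-- `x < H`. -/
def Below (H : Hyperplane n) (x : WeightSpace n) : Prop := level x H.1 < H.2 * l

/-- `x > H`. -/
def Above (H : Hyperplane n) (x : WeightSpace n) : Prop := (H.2 * l : ℝ) < level x H.1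

/-- The underlying map of the reflection in `H`. -/
noncomputable def reflectFun (H : Hyperplane n) (x : WeightSpace n) : WeightSpace n :=
  x - (level x H.1 - H.2 * l) • rootVec H.1

theorem reflectFun_involutive (H : Hyperplane n) : Function.Involutive (reflectFun l H) := by
  intro x
  have hne : H.1.1.1 ≠ H.1.1.2 := ne_of_lt H.1.2
  have h : level (reflectFun l H x) H.1 = 2 * (H.2 * l) - level x H.1 := by
    simp only [reflectFun, level, pairing, rootVec, Submodule.coe_add, Submodule.coe_sub,
      Submodule.coe_smul, Pi.add_apply, Pi.sub_apply, Pi.smul_apply, smul_eq_mul,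
      Pi.single_eq_same, Pi.single_eq_of_ne hne, Pi.single_eq_of_ne hne.symm]
    ring
  have h2 : reflectFun l H (reflectFun l H x) =
      reflectFun l H x - (level (reflectFun l H x) H.1 - H.2 * l) • rootVec H.1 := rfl
  rw [h2, h, reflectFun]
  module

/-- The reflection in `H`. -/
noncomputable def reflect (H : Hyperplane n) : Equiv.Perm (WeightSpace n) :=
  (reflectFun_involutive l H).toPerm

/-- The affine Weyl group `W_l`. -/
def affineWeyl (n l : ℕ) : Subgroup (Equiv.Perm (WeightSpace n)) :=
  Subgroup.closure (Set.range (reflect l))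

/-- The orbit of `x` under `W_l`. -/
def orbit (x : WeightSpace n) : Set (WeightSpace n) := MulAction.orbit (affineWeyl n l) x

/-- `x` lies on no reflecting hyperplane. -/
def IsRegular (x : WeightSpace n) : Prop := ∀ H, ¬ On l H x

/-- The closure of the facet containing `x`; for regular `x` this is the closure of the alcove
containing `x`. -/
def facetClosure (x : WeightSpace n) : Set (WeightSpace n) :=
  {y | ∀ H, (On l H x → On l H y) ∧ (Below l H x → ¬ Above l H y) ∧ (Above l H x → ¬ Below l H y)}

/-- The real dominant weights in the closure of the fundamental alcove. -/
def fundamentalAlcove : Set (WeightSpace n) :=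
  {x | x ∈ realDominant n ∧ ∀ α : PosRoot n, level x α ≤ l}

/-- For `y = x_Π` in the closure of the facet of `x`: the number `u(x, Π)` of hyperplanes `H`
through `y` with `x < H`. -/
noncomputable def uNum (x y : WeightSpace n) : ℕ := {H : Hyperplane n | On l H y ∧ Below l H x}.ncard

/-- For `y = x_Π` in the closure of the facet of `x`: the number `o(x, Π)` of hyperplanes `H`
through `y` with `x > H`. -/
noncomputable def oNum (x y : WeightSpace n) : ℕ := {H : Hyperplane n | On l H y ∧ Above l H x}.ncard

/-- One may translate from `nu` upwards to `lam`: both lie in the closure of a common alcove, `lam`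
is not below any hyperplane through `nu`, and `nu` is not above any hyperplane through `lam`. -/
def IsStep (nu lam : WeightSpace n) : Prop :=
  (∃ x, IsRegular l x ∧ nu ∈ facetClosure l x ∧ lam ∈ facetClosure l x) ∧
    ∀ H, (On l H nu → ¬ Below l H lam) ∧ (On l H lam → ¬ Above l H nu)

/-- `tau` is an intermediate weight for the translation from `nu` to `lam`: the three weights lie in
the closure of a common alcove, and the hyperplanes through `tau` are those through both `nu` and
`lam`, that is, the stabilizers satisfy `W_tau = W_nu ∩ W_lam`. -/
def IsIntermediate (nu lam tau : WeightSpace n) : Prop :=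
  (∃ x, IsRegular l x ∧ nu ∈ facetClosure l x ∧ lam ∈ facetClosure l x ∧ tau ∈ facetClosure l x) ∧
    ∀ H, On l H tau ↔ On l H nu ∧ On l H lam

end Geometry

/-! Patterns and the graded translation functors. The shift `⟨1⟩` is multiplication by `q⁻¹`; the
Laurent monomial `q ^ k` is `LaurentPolynomial.T k`. -/

/-- Formal finite `ℤ[q, q⁻¹]`-linear combinations of weights. The graded Grothendieck group of an
orbit consists of the combinations of dominant weights of that orbit. -/
abbrev Pattern (n : ℕ) : Type := WeightSpace n →₀ LaurentPolynomial ℤ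

section Combinatorics

variable {n : ℕ} (l : ℕ)

/-- The operator `Θ_*` to the orbit `Π` of `mu`: a weight `kap` is sent to
`kap_Π ⟨o(kap, Π)⟩`, or to `0` if the weight `kap_Π` is not dominant. -/
noncomputable def thetaLower (mu : WeightSpace n) :
    Pattern n →ₗ[LaurentPolynomial ℤ] Pattern n :=
  Finsupp.linearCombination (LaurentPolynomial ℤ) fun kap =>
    ∑ᶠ y ∈ {y | y ∈ orbit l mu ∧ y ∈ realDominant n ∧ y ∈ facetClosure l kap},
      Finsupp.single y (LaurentPolynomial.T (-(oNum l kap y : ℤ)))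

/-- The operator `Θ^*` to the orbit of `tau`: a weight `y` of an orbit `Π` is sent to the sum of
`kap ⟨-u(kap, Π)⟩` over the dominant `kap` in the orbit of `tau` with `kap_Π = y`. -/
noncomputable def thetaUpper (tau : WeightSpace n) :
    Pattern n →ₗ[LaurentPolynomial ℤ] Pattern n :=
  Finsupp.linearCombination (LaurentPolynomial ℤ) fun y =>
    ∑ᶠ kap ∈ {kap | kap ∈ orbit l tau ∧ kap ∈ realDominant n ∧ y ∈ facetClosure l kap},
      Finsupp.single kap (LaurentPolynomial.T (uNum l kap y : ℤ))

/-- An indecomposable pattern with highest weight `lam`: the coefficient of `lam` is `1`, and every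
other weight that occurs is a dominant weight of the orbit of `lam`, is smaller than `lam`, and has
its coefficient in `q ℤ[q]`. -/
def IsIndecomposable (lam : WeightSpace n) (P : Pattern n) : Prop :=
  P lam = 1 ∧ ∀ kap ∈ P.support, kap ≠ lam →
    kap ∈ orbit l lam ∧ kap ∈ realDominant n ∧ WeightLT kap lam ∧
      ∃ f : Polynomial ℤ, P kap = Polynomial.toLaurent (Polynomial.X * f)

/-- Paths of weights in `S`, written in reverse: the head of the list is the end point. A path
starts in the fundamental alcove and goes upwards. -/
inductive IsPath (S : Set (WeightSpace n)) : List (WeightSpace n) → Prop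
  | start {nu : WeightSpace n} (hS : nu ∈ S) (hnu : nu ∈ fundamentalAlcove l) : IsPath S [nu]
  | step {nu lam : WeightSpace n} {p : List (WeightSpace n)} (hp : IsPath S (nu :: p))
      (hS : lam ∈ S) (hstep : IsStep l nu lam) : IsPath S (lam :: nu :: p)

/-- `Yields l S p P`: the singular combinatorics, carried out along the path `p` (written in
reverse), may end with the pattern `P`. In each step from `nu` to `lam` one applies
`Θ_* ∘ Θ^*`, through an intermediate weight `tau`, to the pattern obtained for `nu`
(if `tau = nu` this is `Θ_*`, if `tau = lam` it is `Θ^*`), and then one subtracts multiples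
`γ i • R i`, where `γ i` is invariant under `q ↦ q⁻¹` and `R i` is a pattern that the singular
combinatorics yields along some path to a smaller weight `kap i` of the orbit of `lam`, so as to
arrive at an indecomposable pattern with highest weight `lam`. -/
inductive Yields (S : Set (WeightSpace n)) : List (WeightSpace n) → Pattern n → Prop
  | start {nu : WeightSpace n} (hS : nu ∈ S) (hnu : nu ∈ fundamentalAlcove l) :
      Yields S [nu] (Finsupp.single nu 1)
  | step {nu lam tau : WeightSpace n} {p : List (WeightSpace n)} {P : Pattern n}
      (hP : Yields S (nu :: p) P) (hS : lam ∈ S) (hstep : IsStep l nu lam)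
      (htau : IsIntermediate l nu lam tau)
      {m : ℕ} (kap : Fin m → WeightSpace n) (path : Fin m → List (WeightSpace n))
      (R : Fin m → Pattern n) (γ : Fin m → LaurentPolynomial ℤ)
      (hR : ∀ i, Yields S (kap i :: path i) (R i))
      (hkap : ∀ i, kap i ∈ orbit l lam ∧ WeightLT (kap i) lam)
      (hγ : ∀ i, LaurentPolynomial.invert (γ i) = γ i)
      (hQ : IsIndecomposable l lam
        (thetaLower l lam (thetaUpper l tau P) - ∑ i, γ i • R i)) :
      Yields S (lam :: nu :: p) (thetaLower l lam (thetaUpper l tau P) - ∑ i, γ i • R i)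

end Combinatorics

end SingularTilting

/-! Every orbit is compared with the regular orbit of a point inside the fundamental alcove, whose
dominant members index a basis of the antispherical module of the affine Hecke algebra.
`liftPattern` translates a pattern to that orbit. A pattern is called self-dual if its lift is fixed
by the bar involution `bar` followed by the projection `antiProj` onto the antispherical module.

Self-duality is an invariant of the procedure. A single weight of the fundamental alcove is
self-dual (`selfDual_single`). Translation preserves self-duality: by `poincare_smul_liftPattern`,
the Poincaré polynomial of the stabilizer of the intermediate weight, times the lift of the
translated pattern, is obtained from the lift of the old pattern by `symm`, right multiplication by
a bar-invariant element of a parabolic subalgebra. That operator commutes with `bar` (`bar_symm`),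
and the polynomial is self-dual and nonzero, so it can be cancelled (`SelfDual.translate`).
Subtracting multiples with coefficients invariant under q ↦ q⁻¹ changes nothing.

Uniqueness follows: `bar` is unitriangular for the length (`barStd_triangular`), so a self-dual
combination with all coefficients in qℤ[q] vanishes. Two indecomposable self-dual patterns with the
same highest weight therefore agree (`IsIndecomposable.unique`), whatever choices led to them.

Existence of a result needs control of supports. The translated pattern has coefficient 1 at its top
weight and otherwise involves only weights that are smaller in the Bruhat order generated by
reflections towards the fundamental alcove (`Position.isBounded`, `Position.apply_top`). These
weights are finite in number, and by majorization they are also smaller in the usual order. Working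
from large to small height, self-dual multiples of their patterns correct all lower coefficients
(`exists_subtraction`). All these weights are end points of paths: along the ray from -ρ in the real
case, and by successive subtraction of fundamental weights in `P^+`. -/

namespace SingularTilting

/-! ### Shifted coordinates, reflections and separation by hyperplanes. -/

section Coordinates

variable {n : ℕ}

/-- The `i`-th coordinate of `x + ρ`. -/
noncomputable def coord (x : WeightSpace n) (i : Fin (n + 1)) : ℝ := (x + rho n).1 i

theorem level_eq (x : WeightSpace n) (α : PosRoot n) :
    level x α = coord x α.1.1 - coord x α.1.2 := rfl

theorem ext_coord {x y : WeightSpace n} (h : ∀ i, coord x i = coord y i) : x = y := by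
  have : x + rho n = y + rho n := Subtype.ext (funext h)
  exact add_right_cancel this

theorem sum_coord (x : WeightSpace n) : ∑ i, coord x i = 0 := (x + rho n).2

theorem coord_neg_rho (i : Fin (n + 1)) : coord (-rho n) i = 0 := by
  simp [coord]

theorem coord_sub_smul (x v : WeightSpace n) (c : ℝ) (i : Fin (n + 1)) :
    coord (x - c • v) i = coord x i - c * v.1 i := by
  simp only [coord, Submodule.coe_add, Submodule.coe_sub, Submodule.coe_smul, Pi.add_apply,
    Pi.sub_apply, Pi.smul_apply, smul_eq_mul]
  ring

theorem coord_reflect (l : ℕ) (H : Hyperplane n) (x : WeightSpace n) (a : Fin (n + 1)) :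
    coord (reflect l H x) a =
      if a = H.1.1.1 then coord x H.1.1.2 + H.2 * l
      else if a = H.1.1.2 then coord x H.1.1.1 - H.2 * l else coord x a := by
  change coord (reflectFun l H x) a = _
  have hne : H.1.1.1 ≠ H.1.1.2 := ne_of_lt H.1.2
  rw [reflectFun, coord_sub_smul, level_eq]
  simp only [rootVec, Pi.sub_apply, Pi.single_apply]
  split_ifs with h1 h2 h3
  · exact absurd (h1.symm.trans h2) hne
  · rw [h1]; ring
  · rw [h3]; ring
  · ring

/-- The affine functional vanishing on the hyperplane `H` and positive above it. -/
noncomputable def val (l : ℕ) (H : Hyperplane n) (x : WeightSpace n) : ℝ := level x H.1 - H.2 * l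

theorem on_iff (l : ℕ) (H : Hyperplane n) (x : WeightSpace n) : On l H x ↔ val l H x = 0 := by
  rw [On, val, sub_eq_zero]

theorem below_iff (l : ℕ) (H : Hyperplane n) (x : WeightSpace n) :
    Below l H x ↔ val l H x < 0 := by
  rw [Below, val, sub_neg]

theorem above_iff (l : ℕ) (H : Hyperplane n) (x : WeightSpace n) :
    Above l H x ↔ 0 < val l H x := by
  rw [Above, val, sub_pos]

theorem val_reflect (l : ℕ) (H K : Hyperplane n) (x : WeightSpace n) :
    val l K (reflect l H x) = val l K x - val l H x * pairing (rootVec H.1) K.1 := by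
  change val l K (x - (level x H.1 - H.2 * l) • rootVec H.1) = _
  simp only [val, level_eq, coord_sub_smul, pairing]
  ring

theorem pairing_rootVec_self (α : PosRoot n) : pairing (rootVec α) α = 2 := by
  have hne : α.1.1 ≠ α.1.2 := ne_of_lt α.2
  simp only [pairing, rootVec, Pi.sub_apply, Pi.single_eq_same, Pi.single_eq_of_ne hne,
    Pi.single_eq_of_ne hne.symm]
  norm_num

theorem val_reflect_self (l : ℕ) (H : Hyperplane n) (x : WeightSpace n) :
    val l H (reflect l H x) = - val l H x := by
  rw [val_reflect, pairing_rootVec_self]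
  ring

theorem reflect_reflect (l : ℕ) (H : Hyperplane n) (x : WeightSpace n) :
    reflect l H (reflect l H x) = x := reflectFun_involutive l H x

theorem reflect_eq_self (l : ℕ) {H : Hyperplane n} {x : WeightSpace n} (h : val l H x = 0) :
    reflect l H x = x := by
  change x - (val l H x) • rootVec H.1 = x
  rw [h, zero_smul, sub_zero]

/-- `H` strictly separates `x` and `y`. -/
def Sep (l : ℕ) (x y : WeightSpace n) (H : Hyperplane n) : Prop := val l H x * val l H y < 0

theorem Sep.symm {l : ℕ} {x y : WeightSpace n} {H : Hyperplane n} (h : Sep l x y H) :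
    Sep l y x H := by
  rw [Sep, mul_comm]; exact h

theorem sep_comm {l : ℕ} {x y : WeightSpace n} {H : Hyperplane n} :
    Sep l x y H ↔ Sep l y x H := ⟨Sep.symm, Sep.symm⟩

theorem val_add_smul_sub (l : ℕ) (H : Hyperplane n) (x y : WeightSpace n) (t : ℝ) :
    val l H (x + t • (y - x)) = (1 - t) * val l H x + t * val l H y := by
  simp only [val, level_eq, coord, Submodule.coe_add, Submodule.coe_sub,
    Submodule.coe_smul, Pi.add_apply, Pi.sub_apply, Pi.smul_apply, smul_eq_mul]
  ring

theorem sep_finite {l : ℕ} (hl : 0 < l) (x y : WeightSpace n) :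
    {H : Hyperplane n | Sep l x y H}.Finite := by
  have hl' : (0 : ℝ) < l := by exact_mod_cast hl
  have : {H : Hyperplane n | Sep l x y H} ⊆
      ⋃ α : PosRoot n, (fun k : ℤ => ((α, k) : Hyperplane n)) ''
        Set.Icc ⌊min (level x α) (level y α) / l⌋ ⌈max (level x α) (level y α) / l⌉ := by
    rintro ⟨α, k⟩ h
    simp only [Set.mem_iUnion, Set.mem_image]
    refine ⟨α, k, ?_, rfl⟩
    change (level x α - k * l) * (level y α - k * l) < 0 at h
    rw [Set.mem_Icc]
    have key : min (level x α) (level y α) ≤ k * l ∧ (k : ℝ) * l ≤ max (level x α) (level y α) := by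
      rcases mul_neg_iff.mp h with ⟨h1, h2⟩ | ⟨h1, h2⟩
      · exact ⟨(min_le_right _ _).trans (by linarith), le_trans (by linarith) (le_max_left _ _)⟩
      · exact ⟨(min_le_left _ _).trans (by linarith), le_trans (by linarith) (le_max_right _ _)⟩
    constructor
    · have : (⌊min (level x α) (level y α) / l⌋ : ℝ) ≤ k :=
        (Int.floor_le _).trans ((div_le_iff₀ hl').mpr key.1)
      exact_mod_cast this
    · have : (k : ℝ) ≤ ⌈max (level x α) (level y α) / l⌉ :=
        le_trans ((le_div_iff₀ hl').mpr key.2) (Int.le_ceil _)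
      exact_mod_cast this
  exact (Set.finite_iUnion fun α => (Set.finite_Icc _ _).image _).subset this

theorem on_finite {l : ℕ} (hl : 0 < l) (x : WeightSpace n) :
    {H : Hyperplane n | val l H x = 0}.Finite := by
  have hl' : (0 : ℝ) < l := by exact_mod_cast hl
  refine Set.Finite.of_injOn (f := Prod.fst) (t := Set.univ) (fun _ _ => Set.mem_univ _) ?_
    Set.finite_univ
  rintro ⟨α, k⟩ h ⟨β, m⟩ h' (rfl : α = β)
  have e : (k : ℝ) * l = m * l := by
    have h1 : level x α - k * l = 0 := h
    have h2 : level x α - m * l = 0 := h'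
    linarith
  have : (k : ℝ) = m := mul_right_cancel₀ hl'.ne' e
  rw [show k = m by exact_mod_cast this]

/-- A small displacement of `y` towards `z` does not cross any hyperplane. -/
theorem exists_small {l : ℕ} (hl : 0 < l) (y z : WeightSpace n) :
    ∃ t : ℝ, 0 < t ∧ ∀ H, val l H y ≠ 0 → 0 < val l H y * val l H (y + t • (z - y)) := by
  -- Only hyperplanes separating `y` from `z` can be crossed on the way, and there are finitely
  -- many; for each of them continuity at 0 suffices.
  have h1 : ∀ᶠ t : ℝ in nhdsWithin 0 (Set.Ioi 0),
      ∀ H ∈ {H : Hyperplane n | Sep l y z H},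
        0 < val l H y * ((1 - t) * val l H y + t * val l H z) := by
    rw [Filter.eventually_all_finite (sep_finite hl y z)]
    intro H hH
    have hy : val l H y ≠ 0 := by
      rintro h
      simp [Sep, h] at hH
    have hc : Continuous fun t : ℝ => val l H y * ((1 - t) * val l H y + t * val l H z) := by
      fun_prop
    have := (hc.tendsto 0).eventually (lt_mem_nhds (a := 0) (by simpa using hy))
    exact this.filter_mono nhdsWithin_le_nhds
  have h2 : ∀ᶠ t : ℝ in nhdsWithin 0 (Set.Ioi 0), 0 < t ∧ t < 1 := by
    filter_upwards [Ioo_mem_nhdsGT (zero_lt_one' ℝ)] with t ht using ht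
  obtain ⟨t, ht, ht0, ht1⟩ := (h1.and h2).exists
  refine ⟨t, ht0, fun H hy => ?_⟩
  rw [val_add_smul_sub]
  by_cases hs : Sep l y z H
  · exact ht H hs
  · have h3 : 0 ≤ val l H y * val l H z := not_lt.mp hs
    have h4 : 0 < val l H y * val l H y := mul_self_pos.mpr hy
    nlinarith [mul_pos (sub_pos.mpr ht1) h4, mul_nonneg ht0.le h3]

end Coordinates

/-! ### The affine Weyl group and its action on hyperplanes. -/

section AffineGroup

variable {n l : ℕ}

/-- The reflection in `H` as an element of the affine Weyl group. -/
noncomputable def refl (l : ℕ) (H : Hyperplane n) : affineWeyl n l :=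
  ⟨reflect l H, Subgroup.subset_closure ⟨H, rfl⟩⟩

theorem refl_smul (H : Hyperplane n) (x : WeightSpace n) : refl l H • x = reflect l H x := rfl

@[simp] theorem refl_mul_self (H : Hyperplane n) : refl l H * refl l H = 1 := by
  apply Subtype.ext
  ext1 x
  exact reflect_reflect l H x

@[simp] theorem refl_refl_mul (H : Hyperplane n) (g : affineWeyl n l) :
    refl l H * (refl l H * g) = g := by
  rw [← mul_assoc, refl_mul_self, one_mul]

@[simp] theorem refl_inv (H : Hyperplane n) : (refl l H)⁻¹ = refl l H :=
  inv_eq_of_mul_eq_one_right (refl_mul_self H)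

theorem ext_smul {g h : affineWeyl n l} (e : ∀ x : WeightSpace n, g • x = h • x) : g = h :=
  Subtype.ext (Equiv.ext e)

/-- Every element of the affine Weyl group permutes the coordinates and adds multiples of `l`. -/
theorem exists_coord_smul (g : affineWeyl n l) : ∃ (σ : Equiv.Perm (Fin (n + 1)))
    (m : Fin (n + 1) → ℤ), ∀ (x : WeightSpace n) i, coord (g • x) i = coord x (σ i) + l * m i := by
  obtain ⟨g, hg⟩ := g
  change ∃ (σ : Equiv.Perm (Fin (n + 1))) (m : Fin (n + 1) → ℤ),
    ∀ (x : WeightSpace n) i, coord (g x) i = coord x (σ i) + l * m i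
  induction hg using Subgroup.closure_induction with
  | mem g hg =>
    obtain ⟨H, rfl⟩ := hg
    refine ⟨Equiv.swap H.1.1.1 H.1.1.2,
      fun a => if a = H.1.1.1 then H.2 else if a = H.1.1.2 then - H.2 else 0, fun x a => ?_⟩
    rw [coord_reflect]
    dsimp only
    split_ifs with h1 h2
    · rw [h1, Equiv.swap_apply_left]; ring
    · rw [h2, Equiv.swap_apply_right]; push_cast; ring
    · rw [Equiv.swap_apply_of_ne_of_ne h1 h2]; simp
  | one => exact ⟨1, 0, fun x i => by simp⟩
  | mul g h _ _ ihg ihh =>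
    obtain ⟨σ, m, h1⟩ := ihg
    obtain ⟨τ, k, h2⟩ := ihh
    refine ⟨σ.trans τ, fun i => k (σ i) + m i, fun x i => ?_⟩
    rw [Equiv.Perm.mul_apply, h1, h2]
    simp only [Equiv.trans_apply]
    push_cast
    ring
  | inv g _ ih =>
    obtain ⟨σ, m, h1⟩ := ih
    refine ⟨σ.symm, fun i => - m (σ.symm i), fun x i => ?_⟩
    have := h1 (g⁻¹ x) (σ.symm i)
    rw [show g (g⁻¹ x) = x from g.apply_symm_apply x, Equiv.apply_symm_apply] at this
    push_cast
    linarith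

/-- Permuting coordinates and adding multiples of `l` turns the functional of `H` into that of
another hyperplane, up to a sign: `ε = -1` occurs when the permutation reverses the order of the two
indices of the root. The last clause is the conjugation formula for reflections. -/
theorem exists_pull (g : affineWeyl n l) (H : Hyperplane n) : ∃ (K : Hyperplane n) (ε : ℝ),
    ε * ε = 1 ∧ (∀ x, val l H (g • x) = ε * val l K x) ∧ refl l H * g = g * refl l K := by
  obtain ⟨σ, m, h⟩ := exists_coord_smul g
  obtain ⟨⟨⟨i, j⟩, hij⟩, k⟩ := H
  have hij' : i ≠ j := ne_of_lt hij
  have key : ∀ (K : Hyperplane n) (x : WeightSpace n),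
      (∀ a, coord (refl l K • x) (σ a) =
        if a = i then coord x (σ j) + (k - m i + m j) * l
        else if a = j then coord x (σ i) - (k - m i + m j) * l else coord x (σ a)) →
      reflect l (⟨⟨i, j⟩, hij⟩, k) (g • x) = g • reflect l K x := by
    intro K x hx
    apply ext_coord
    intro a
    rw [coord_reflect, ← refl_smul, h (refl l K • x), hx a, h, h, h]
    dsimp only
    split_ifs with h1 h2
    · rw [h1]; ring
    · rw [h2]; ring
    · ring
  rcases lt_or_gt_of_ne (σ.injective.ne hij') with hlt | hgt
  · refine ⟨(⟨(σ i, σ j), hlt⟩, k - m i + m j), 1, by norm_num, fun x => ?_, ext_smul fun x => ?_⟩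
    · simp only [val, level_eq, h]
      push_cast
      ring
    · refine key _ x fun a => ?_
      rw [refl_smul, coord_reflect]
      simp only [σ.injective.eq_iff]
      push_cast
      rfl
  · refine ⟨(⟨(σ j, σ i), hgt⟩, -(k - m i + m j)), -1, by norm_num, fun x => ?_,
      ext_smul fun x => ?_⟩
    · simp only [val, level_eq, h]
      push_cast
      ring
    · refine key _ x fun a => ?_
      rw [refl_smul, coord_reflect]
      simp only [σ.injective.eq_iff]
      push_cast
      split_ifs with h1 h2
      · exact absurd (h2.symm.trans h1) hij'
      · ring
      · ring
      · rfl

/-- The preimage of the hyperplane `H` under `g`. -/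
noncomputable def pull (g : affineWeyl n l) (H : Hyperplane n) : Hyperplane n :=
  (exists_pull g H).choose

theorem refl_mul_eq (g : affineWeyl n l) (H : Hyperplane n) :
    refl l H * g = g * refl l (pull g H) := (exists_pull g H).choose_spec.choose_spec.2.2

/-- In a product of two values the unknown sign cancels. For this reason relative position is
expressed by signs of products throughout. -/
theorem val_mul_val_smul (g : affineWeyl n l) (H : Hyperplane n) (x y : WeightSpace n) :
    val l H (g • x) * val l H (g • y) = val l (pull g H) x * val l (pull g H) y := by
  obtain ⟨h1, h2, -⟩ := (exists_pull g H).choose_spec.choose_spec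
  change _ = val l (exists_pull g H).choose x * val l (exists_pull g H).choose y
  rw [h2, h2]
  linear_combination
    (val l (exists_pull g H).choose x * val l (exists_pull g H).choose y) * h1

theorem val_smul_eq_zero (g : affineWeyl n l) (H : Hyperplane n) (x : WeightSpace n) :
    val l H (g • x) = 0 ↔ val l (pull g H) x = 0 := by
  have := val_mul_val_smul g H x x
  rw [← mul_self_eq_zero, this, mul_self_eq_zero]

theorem sep_smul (g : affineWeyl n l) (H : Hyperplane n) (x y : WeightSpace n) :
    Sep l (g • x) (g • y) H ↔ Sep l x y (pull g H) := by
  rw [Sep, val_mul_val_smul, Sep]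

end AffineGroup

/-! ### A regular base point, and hyperplanes determined by their reflections. -/

section BasePoint

variable {n l : ℕ}

/-- A point in the interior of the fundamental alcove. -/
noncomputable def basePt (n l : ℕ) : WeightSpace n :=
  -- Equally spaced coordinates with gap `l / (n + 1)`: every hyperplane functional takes an integer
  -- multiple of `l / (n + 1)` here, and the first and last coordinates differ by less than `l`.
  ⟨fun i => (l : ℝ) * (n / 2 - i) / (n + 1), by
    change ∑ i : Fin (n + 1), (l : ℝ) * (n / 2 - (i : ℕ)) / (n + 1) = 0
    rw [← Finset.sum_div, ← Finset.mul_sum, Finset.sum_sub_distrib, Fin.sum_univ_eq_sum_range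
      (fun i => (i : ℝ)) (n + 1)]
    have : ∑ i ∈ Finset.range (n + 1), (i : ℝ) = n * (n + 1) / 2 := by
      have h := Finset.sum_range_id_mul_two (n + 1)
      have h' : (∑ i ∈ Finset.range (n + 1), (i : ℝ)) * 2 = (n + 1) * n := by
        rw [Nat.add_sub_cancel] at h
        have h2 := congrArg (Nat.cast : ℕ → ℝ) h
        push_cast at h2
        exact h2
      linarith
    rw [this, Finset.sum_const, Finset.card_univ, Fintype.card_fin, nsmul_eq_mul]
    push_cast
    ring⟩ - rho n

theorem coord_basePt (i : Fin (n + 1)) :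
    coord (basePt n l) i = (l : ℝ) * (n / 2 - i) / (n + 1) := by
  simp [coord, basePt]

/-- Points in the orbit of the base point are encoded by integer labels `e`; questions of separation
become integer inequalities. -/
theorem val_of_coord {e : Fin (n + 1) → ℤ} {x : WeightSpace n}
    (hx : ∀ i, coord x i = (l : ℝ) * (n / 2 - e i) / (n + 1)) (H : Hyperplane n) :
    val l H x = l / (n + 1) * ((e H.1.1.2 - e H.1.1.1 - H.2 * (n + 1) : ℤ) : ℝ) := by
  have : (n : ℝ) + 1 ≠ 0 := by positivity
  rw [val, level_eq, hx, hx]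
  push_cast
  field_simp
  ring

theorem val_basePt (H : Hyperplane n) :
    val l H (basePt n l) =
      l / (n + 1) * (((H.1.1.2 : ℕ) - (H.1.1.1 : ℕ) - H.2 * (n + 1) : ℤ) : ℝ) :=
  val_of_coord (e := fun i => ((i : ℕ) : ℤ)) (fun i => by rw [coord_basePt]; simp) H

theorem scale_pos (hl : 0 < l) : (0 : ℝ) < l / (n + 1) := by
  have hl' : (0 : ℝ) < l := by exact_mod_cast hl
  positivity

theorem val_basePt_pos (hl : 0 < l) {H : Hyperplane n} (h : H.2 ≤ 0) :
    0 < val l H (basePt n l) := by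
  rw [val_basePt]
  refine mul_pos (scale_pos hl) ?_
  have h1 : (H.1.1.1 : ℕ) < (H.1.1.2 : ℕ) := H.1.2
  have : 0 < ((H.1.1.2 : ℕ) - (H.1.1.1 : ℕ) - H.2 * (n + 1) : ℤ) := by
    have : H.2 * ((n : ℤ) + 1) ≤ 0 := mul_nonpos_of_nonpos_of_nonneg h (by positivity)
    omega
  exact_mod_cast this

theorem val_basePt_neg (hl : 0 < l) {H : Hyperplane n} (h : 0 < H.2) :
    val l H (basePt n l) < 0 := by
  rw [val_basePt]
  refine mul_neg_of_pos_of_neg (scale_pos hl) ?_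
  have h1 : (H.1.1.1 : ℕ) < (H.1.1.2 : ℕ) := H.1.2
  have : ((H.1.1.2 : ℕ) - (H.1.1.1 : ℕ) - H.2 * (n + 1) : ℤ) < 0 := by
    have h3 : (n : ℤ) + 1 ≤ H.2 * (n + 1) := by nlinarith
    have h4 := H.1.1.2.isLt
    omega
  exact_mod_cast this

theorem val_basePt_ne (hl : 0 < l) (H : Hyperplane n) : val l H (basePt n l) ≠ 0 := by
  rcases le_or_gt H.2 0 with h | h
  · exact (val_basePt_pos hl h).ne'
  · exact (val_basePt_neg hl h).ne

/-- The two coordinates of the base point that the reflection moves recover the root, and the new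
value of one of them recovers the integer. -/
theorem refl_injective (hl : 0 < l) : Function.Injective (refl l : Hyperplane n → _) := by
  intro H K h
  have hl' : (l : ℝ) ≠ 0 := by exact_mod_cast hl.ne'
  have hx : reflect l H (basePt n l) = reflect l K (basePt n l) :=
    congrArg (fun g : affineWeyl n l => g • basePt n l) h
  have hH := val_basePt_ne hl H
  have hmove : ∀ a, coord (reflect l H (basePt n l)) a ≠ coord (basePt n l) a ↔
      a = H.1.1.1 ∨ a = H.1.1.2 := by
    intro a
    rw [coord_reflect]
    rw [val, level_eq] at hH
    split_ifs with h1 h2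
    · simp only [h1, true_or, iff_true]
      intro h; apply hH; linarith
    · simp only [h2, or_true, iff_true]
      intro h; apply hH; linarith
    · simp [h1, h2]
  have hK := val_basePt_ne hl K
  have hmove' : ∀ a, coord (reflect l K (basePt n l)) a ≠ coord (basePt n l) a ↔
      a = K.1.1.1 ∨ a = K.1.1.2 := by
    intro a
    rw [coord_reflect]
    rw [val, level_eq] at hK
    split_ifs with h1 h2
    · simp only [h1, true_or, iff_true]
      intro h; apply hK; linarith
    · simp only [h2, or_true, iff_true]
      intro h; apply hK; linarith
    · simp [h1, h2]
  rw [hx] at hmove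
  have e1 := (hmove H.1.1.1).symm.trans (hmove' H.1.1.1)
  have e2 := (hmove H.1.1.2).symm.trans (hmove' H.1.1.2)
  have e3 := (hmove K.1.1.1).symm.trans (hmove' K.1.1.1)
  have hα : H.1 = K.1 := by
    have l1 := H.1.2
    have l2 := K.1.2
    apply Subtype.ext
    apply Prod.ext <;> grind
  obtain ⟨α, k⟩ := H
  obtain ⟨β, m⟩ := K
  obtain rfl : α = β := hα
  have e := congrArg (fun y => coord y α.1.1) hx
  simp only [coord_reflect, if_true] at e
  have : (k : ℝ) = m := mul_right_cancel₀ hl' (by linarith)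
  rw [show k = m by exact_mod_cast this]

theorem pull_eq_of_refl (hl : 0 < l) {g : affineWeyl n l} {H K : Hyperplane n}
    (h : refl l H * g = g * refl l K) : pull g H = K :=
  refl_injective hl (mul_left_cancel ((refl_mul_eq g H).symm.trans h))

theorem pull_mul (hl : 0 < l) (g h : affineWeyl n l) (H : Hyperplane n) :
    pull (g * h) H = pull h (pull g H) := by
  apply pull_eq_of_refl hl
  rw [← mul_assoc, refl_mul_eq, mul_assoc, refl_mul_eq, mul_assoc]

theorem pull_one (hl : 0 < l) (H : Hyperplane n) : pull (1 : affineWeyl n l) H = H := by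
  apply pull_eq_of_refl hl
  rw [mul_one, one_mul]

theorem pull_refl_self (hl : 0 < l) (H : Hyperplane n) : pull (refl l H) H = H :=
  pull_eq_of_refl hl rfl

/-- Taking preimages under `g` permutes the hyperplanes. -/
noncomputable def pullEquiv (hl : 0 < l) (g : affineWeyl n l) : Equiv.Perm (Hyperplane n) where
  toFun := pull g
  invFun := pull g⁻¹
  left_inv H := by rw [← pull_mul hl, mul_inv_cancel, pull_one hl]
  right_inv H := by rw [← pull_mul hl, inv_mul_cancel, pull_one hl]

end BasePoint

/-! ### The walls of the fundamental alcove. -/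

section Walls

variable {n l : ℕ}

/-- `H` is a wall of the fundamental alcove: the reflection in `H` moves the base point across `H`
only. -/
def IsWall (l : ℕ) (H : Hyperplane n) : Prop :=
  ∀ K, Sep l (basePt n l) (reflect l H (basePt n l)) K → K = H

theorem sep_indices (hl : 0 < l) {e : Fin (n + 1) → ℤ} {x : WeightSpace n}
    (hx : ∀ i, coord x i = (l : ℝ) * (n / 2 - e i) / (n + 1)) {K : Hyperplane n}
    (h : Sep l (basePt n l) x K) :
    (((K.1.1.2 : ℕ) - (K.1.1.1 : ℕ) - K.2 * (n + 1) : ℤ)) *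
      (e K.1.1.2 - e K.1.1.1 - K.2 * (n + 1)) < 0 := by
  rw [Sep, val_basePt, val_of_coord hx] at h
  have hs := scale_pos (n := n) hl
  have h2 : ((((K.1.1.2 : ℕ) - (K.1.1.1 : ℕ) - K.2 * (n + 1) : ℤ)) : ℝ) *
      ((e K.1.1.2 - e K.1.1.1 - K.2 * (n + 1) : ℤ) : ℝ) < 0 := by
    by_contra hc
    rw [not_lt] at hc
    have := mul_nonneg (mul_pos hs hs).le hc
    linarith
  exact_mod_cast h2

/-- The labels 0, …, `n` of the base point get two neighbours exchanged, and this exchange reverses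
only one pair. -/
theorem isWall_simple (hl : 0 < l) (α : PosRoot n) (h : (α.1.2 : ℕ) = (α.1.1 : ℕ) + 1) :
    IsWall l ((α, 0) : Hyperplane n) := by
  intro K hK
  have hx : ∀ a, coord (reflect l (α, 0) (basePt n l)) a = (l : ℝ) * (n / 2 -
      ((if a = α.1.1 then (α.1.2 : ℕ) else if a = α.1.2 then (α.1.1 : ℕ) else (a : ℕ) : ℤ) : ℝ)) /
        (n + 1) := by
    intro a
    rw [coord_reflect]
    dsimp only
    split_ifs <;> simp [coord_basePt]
  have := sep_indices hl hx hK
  obtain ⟨⟨⟨a, b⟩, hab⟩, k⟩ := K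
  obtain ⟨⟨i, j⟩, hij⟩ := α
  dsimp only at this h hab ⊢
  have hab' : (a : ℕ) < b := hab
  generalize hX : k * ((n : ℤ) + 1) = X at this
  simp only [Fin.ext_iff] at this
  have key : (a : ℕ) = i ∧ (b : ℕ) = j ∧ X = 0 := by
    rcases mul_neg_iff.mp this with ⟨h1, h2⟩ | ⟨h1, h2⟩ <;> split_ifs at h2 <;> omega
  obtain ⟨h1, h2, h3⟩ := key
  obtain rfl := Fin.ext h1
  obtain rfl := Fin.ext h2
  have hk : k = 0 := by
    rcases mul_eq_zero.mp (hX.trans h3) with h | h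
    · exact h
    · omega
  rw [hk]

/-- The labels 0 and `n` become -1 and `n + 1`. Only their difference passes a multiple of `n + 1`,
namely `n + 1` itself. -/
theorem isWall_top (hl : 0 < l) (α : PosRoot n) (h0 : (α.1.1 : ℕ) = 0) (hn : (α.1.2 : ℕ) = n) :
    IsWall l ((α, 1) : Hyperplane n) := by
  intro K hK
  have hx : ∀ a, coord (reflect l (α, 1) (basePt n l)) a = (l : ℝ) * (n / 2 -
      ((if a = α.1.1 then -1 else if a = α.1.2 then (n : ℤ) + 1 else ((a : ℕ) : ℤ) : ℤ) : ℝ)) /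
        (n + 1) := by
    intro a
    have hn1 : (n : ℝ) + 1 ≠ 0 := by positivity
    rw [coord_reflect]
    dsimp only
    split_ifs
    · rw [coord_basePt, hn]; push_cast; field_simp; ring
    · rw [coord_basePt, h0]; push_cast; field_simp; ring
    · simp [coord_basePt]
  have := sep_indices hl hx hK
  obtain ⟨⟨⟨a, b⟩, hab⟩, k⟩ := K
  obtain ⟨⟨i, j⟩, hij⟩ := α
  dsimp only at this h0 hn hab ⊢
  have hab' : (a : ℕ) < b := hab
  have ha := a.isLt
  have hb := b.isLt
  simp only [Fin.ext_iff] at this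
  have key : (a : ℕ) = i ∧ (b : ℕ) = j ∧ k = 1 := by
    generalize hX : k * ((n : ℤ) + 1) = X at this
    have : (a : ℕ) = i ∧ (b : ℕ) = j ∧ X = (n : ℤ) + 1 := by
      rcases mul_neg_iff.mp this with ⟨h1, h2⟩ | ⟨h1, h2⟩ <;> split_ifs at h2 <;> omega
    refine ⟨this.1, this.2.1, ?_⟩
    have h2 := hX.trans this.2.2
    have h3 : ((n : ℤ) + 1) ≠ 0 := by omega
    exact mul_right_cancel₀ h3 (by rw [h2, one_mul])
  obtain ⟨h1, h2, rfl⟩ := key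
  obtain rfl := Fin.ext h1
  obtain rfl := Fin.ext h2
  rfl

theorem coord_antitone_of_simple {x : WeightSpace n}
    (h : ∀ α : PosRoot n, (α.1.2 : ℕ) = (α.1.1 : ℕ) + 1 → 0 ≤ level x α) :
    Antitone (coord x) := by
  apply Fin.antitone_iff_succ_le.mpr
  intro i
  have := h ⟨(i.castSucc, i.succ), Fin.castSucc_lt_succ⟩ (by simp)
  rw [level_eq] at this
  linarith

/-- If some hyperplane separates `x` from the fundamental alcove, then a wall does. -/
theorem exists_wall (hl : 0 < l) {x : WeightSpace n} {K : Hyperplane n}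
    (hK : Sep l (basePt n l) x K) : ∃ H, IsWall l H ∧ Sep l (basePt n l) x H := by
  by_contra! hc
  have hanti : Antitone (coord x) := coord_antitone_of_simple fun α hα => by
    have h1 := hc (α, 0) (isWall_simple hl α hα)
    have h2 := val_basePt_pos (n := n) hl (H := (α, 0)) le_rfl
    rw [Sep, not_lt] at h1
    have h3 := nonneg_of_mul_nonneg_right h1 h2
    simpa [val] using h3
  obtain ⟨⟨⟨a, b⟩, hab⟩, k⟩ := K
  have hab' : (a : ℕ) < b := hab
  have hb := b.isLt
  have hlast : (0 : Fin (n + 1)) < Fin.last n := Fin.lt_def.mpr (by simp; omega)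
  -- Decreasing coordinates whose extremes differ by at most `l` describe the closed alcove, so `K`
  -- cannot separate after all.
  have hlevel : coord x a - coord x b ≤ l := by
    have h1 := hc (⟨(0, Fin.last n), hlast⟩, 1)
      (isWall_top hl _ (by simp) (by simp))
    have h2 := val_basePt_neg (n := n) hl (H := (⟨(0, Fin.last n), hlast⟩, 1))
      one_pos
    rw [Sep, not_lt] at h1
    have h3 := nonpos_of_mul_nonneg_right h1 h2
    simp only [val, level_eq, Int.cast_one, one_mul] at h3
    linarith [hanti (Fin.zero_le a), hanti (Fin.le_last b)]
  have hnn : 0 ≤ coord x a - coord x b := sub_nonneg.mpr (hanti hab.le)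
  have hl' : (0 : ℝ) < l := by exact_mod_cast hl
  rcases le_or_gt k 0 with h | h
  · have h2 := val_basePt_pos (n := n) hl (H := (⟨(a, b), hab⟩, k)) h
    have h3 : (k : ℝ) ≤ 0 := by exact_mod_cast h
    have h4 : 0 ≤ val l (⟨(a, b), hab⟩, k) x := by
      simp only [val, level_eq]
      nlinarith
    exact absurd hK (not_lt.mpr (mul_nonneg h2.le h4))
  · have h2 := val_basePt_neg (n := n) hl (H := (⟨(a, b), hab⟩, k)) h
    have h3 : (1 : ℝ) ≤ k := by exact_mod_cast h
    have h4 : val l (⟨(a, b), hab⟩, k) x ≤ 0 := by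
      simp only [val, level_eq]
      nlinarith
    exact absurd hK (not_lt.mpr (mul_nonneg_of_nonpos_of_nonpos h2.le h4))

end Walls

/-! ### Length, reduced expressions and simple transitivity on alcoves. -/

section Length

variable {n l : ℕ}

/-- The number of hyperplanes with property `Q` that separate `x` from the fundamental alcove. -/
noncomputable def sepCount (l : ℕ) (Q : Hyperplane n → Prop) (x : WeightSpace n) : ℕ :=
  {H : Hyperplane n | Q H ∧ Sep l (basePt n l) x H}.ncard

theorem sepSet_finite (hl : 0 < l) (Q : Hyperplane n → Prop) (b x : WeightSpace n) :
    {H : Hyperplane n | Q H ∧ Sep l b x H}.Finite :=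
  (sep_finite hl b x).subset fun _ h => h.2

theorem IsWall.val_mul_pos (hl : 0 < l) {H K : Hyperplane n} (hH : IsWall l H) (hK : K ≠ H) :
    0 < val l K (basePt n l) * val l K (reflect l H (basePt n l)) := by
  rcases lt_trichotomy (val l K (basePt n l) * val l K (reflect l H (basePt n l))) 0 with h | h | h
  · exact absurd (hH K h) hK
  · exfalso
    rcases mul_eq_zero.mp h with h | h
    · exact val_basePt_ne hl K h
    · exact val_basePt_ne hl _ ((val_smul_eq_zero (refl l H) K _).mp h)
  · exact h

theorem sep_iff_of_pos {x y z : WeightSpace n} {H : Hyperplane n}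
    (h : 0 < val l H x * val l H y) : Sep l y z H ↔ Sep l x z H := by
  unfold Sep
  rcases mul_pos_iff.mp h with ⟨h1, h2⟩ | ⟨h1, h2⟩ <;>
    rw [mul_neg_iff, mul_neg_iff] <;> constructor <;> rintro (⟨h3, h4⟩ | ⟨h3, h4⟩) <;>
    first | (exfalso; linarith) | exact Or.inl ⟨‹_›, h4⟩ | exact Or.inr ⟨‹_›, h4⟩

/-- Reflecting the whole picture in the wall replaces the base point by its mirror image, which lies
on the same side of every hyperplane other than `H`. -/
theorem IsWall.sep_reflect_iff (hl : 0 < l) {H K : Hyperplane n} (hH : IsWall l H) (hK : K ≠ H)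
    (x : WeightSpace n) :
    Sep l (basePt n l) (reflect l H x) K ↔ Sep l (basePt n l) x (pull (refl l H) K) := by
  have h1 := sep_smul (refl l H) K (reflect l H (basePt n l)) x
  rw [refl_smul, refl_smul, reflect_reflect] at h1
  rw [h1]
  apply sep_iff_of_pos
  apply hH.val_mul_pos hl
  intro h
  apply hK
  rw [← pull_one hl K, ← refl_mul_self H, pull_mul hl, h, pull_refl_self hl]

theorem sep_reflect_self_iff {x : WeightSpace n} {H : Hyperplane n} :
    Sep l (basePt n l) (reflect l H x) H ↔ 0 < val l H (basePt n l) * val l H x := by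
  rw [Sep, val_reflect_self, mul_neg, neg_lt_zero]

theorem sepCount_reflect_of_not (hl : 0 < l) {H : Hyperplane n} (hH : IsWall l H)
    {Q Q' : Hyperplane n → Prop} (hQ : ∀ K, Q' K ↔ Q (pull (refl l H) K)) {x : WeightSpace n}
    (hx : ¬ Q H ∨ val l H x = 0) : sepCount l Q' (reflect l H x) = sepCount l Q x := by
  unfold sepCount
  refine Set.ncard_congr' ((pullEquiv hl (refl l H)).subtypeEquiv fun K => ?_)
  change Q' K ∧ _ ↔ Q (pull (refl l H) K) ∧ Sep l (basePt n l) x (pull (refl l H) K)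
  rw [hQ]
  by_cases hK : K = H
  · subst hK
    rw [pull_refl_self hl]
    rcases hx with h | h
    · simp [h]
    · simp [Sep, val_reflect_self, h]
  · exact and_congr_right fun _ => hH.sep_reflect_iff hl hK x

/-- The reflection permutes the separating hyperplanes other than `H`, and `H` itself is gained. The
property `Q` is carried along so that the same count serves the length, the finite length and the
hyperplanes through a given point. -/
theorem sepCount_reflect_up (hl : 0 < l) {H : Hyperplane n} (hH : IsWall l H)
    {Q Q' : Hyperplane n → Prop} (hQ : ∀ K, Q' K ↔ Q (pull (refl l H) K)) {x : WeightSpace n}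
    (hQH : Q H) (hx : 0 < val l H (basePt n l) * val l H x) :
    sepCount l Q' (reflect l H x) = sepCount l Q x + 1 := by
  have h1 : sepCount l Q' (reflect l H x) =
      (insert H {K | Q K ∧ Sep l (basePt n l) x K} : Set (Hyperplane n)).ncard := by
    refine Set.ncard_congr' ((pullEquiv hl (refl l H)).subtypeEquiv fun K => ?_)
    change Q' K ∧ _ ↔ pull (refl l H) K ∈ insert H {K | Q K ∧ Sep l (basePt n l) x K}
    by_cases hK : K = H
    · subst hK
      simp only [pull_refl_self hl, Set.mem_insert_iff, true_or, iff_true]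
      exact ⟨(hQ _).mpr (by rwa [pull_refl_self hl]), sep_reflect_self_iff.mpr hx⟩
    · have : pull (refl l H) K ≠ H := by
        intro h
        apply hK
        rw [← pull_one hl K, ← refl_mul_self H, pull_mul hl, h, pull_refl_self hl]
      simp only [Set.mem_insert_iff, this, false_or, Set.mem_ofPred_eq]
      rw [hQ]
      exact and_congr_right fun _ => hH.sep_reflect_iff hl hK x
  rw [h1, Set.ncard_insert_of_notMem _ (sepSet_finite hl Q _ x)]
  · rfl
  · rintro ⟨-, h⟩
    exact absurd h (not_lt.mpr hx.le)

/-- The length of an element of the affine Weyl group. -/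
noncomputable def len (g : affineWeyl n l) : ℕ := sepCount l (fun _ => True) (g • basePt n l)

theorem val_smul_basePt_ne (hl : 0 < l) (g : affineWeyl n l) (H : Hyperplane n) :
    val l H (g • basePt n l) ≠ 0 :=
  fun h => val_basePt_ne hl _ ((val_smul_eq_zero g H _).mp h)

theorem mul_pos_of_not_sep (hl : 0 < l) {g : affineWeyl n l} {H : Hyperplane n}
    (h : ¬ Sep l (basePt n l) (g • basePt n l) H) :
    0 < val l H (basePt n l) * val l H (g • basePt n l) :=
  lt_of_le_of_ne (not_lt.mp h)
    (mul_ne_zero (val_basePt_ne hl H) (val_smul_basePt_ne hl g H)).symm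

theorem not_sep_refl_mul {g : affineWeyl n l} {H : Hyperplane n}
    (h : Sep l (basePt n l) (g • basePt n l) H) :
    ¬ Sep l (basePt n l) ((refl l H * g) • basePt n l) H := by
  rw [mul_smul, refl_smul, sep_reflect_self_iff, not_lt]
  exact h.le

theorem sep_refl_mul (hl : 0 < l) {g : affineWeyl n l} {H : Hyperplane n}
    (h : ¬ Sep l (basePt n l) (g • basePt n l) H) :
    Sep l (basePt n l) ((refl l H * g) • basePt n l) H := by
  rw [mul_smul, refl_smul, sep_reflect_self_iff]
  exact mul_pos_of_not_sep hl h

theorem len_refl_mul (hl : 0 < l) {H : Hyperplane n} (hH : IsWall l H) {g : affineWeyl n l}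
    (h : ¬ Sep l (basePt n l) (g • basePt n l) H) : len (refl l H * g) = len g + 1 := by
  rw [len, mul_smul, refl_smul]
  exact sepCount_reflect_up hl hH (Q := fun _ => True) (fun _ => Iff.rfl) trivial
    (mul_pos_of_not_sep hl h)

theorem len_refl_mul_le (hl : 0 < l) {H : Hyperplane n} (hH : IsWall l H) (g : affineWeyl n l) :
    len (refl l H * g) ≤ len g + 1 := by
  by_cases h : Sep l (basePt n l) (g • basePt n l) H
  · have := len_refl_mul hl hH (not_sep_refl_mul h)
    rw [refl_refl_mul] at this
    omega
  · exact (len_refl_mul hl hH h).le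

theorem sum_range_shift (N : ℕ) (c : ℤ) (h : ∑ i ∈ Finset.range (N + 1), ((i : ℤ) + c) =
    ∑ i ∈ Finset.range (N + 1), (i : ℤ)) : c = 0 := by
  rw [Finset.sum_add_distrib, Finset.sum_const, Finset.card_range] at h
  have : (N + 1) • c = 0 := by linarith
  rcases smul_eq_zero.mp this with h | h
  · omega
  · exact h

/-- The affine Weyl group acts simply transitively on the alcoves. -/
theorem eq_one_of_not_sep (hl : 0 < l) {g : affineWeyl n l}
    (h : ∀ H, ¬ Sep l (basePt n l) (g • basePt n l) H) : g = 1 := by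
  obtain ⟨σ, m, hσ⟩ := exists_coord_smul g
  have hl' : (0 : ℝ) < l := by exact_mod_cast hl
  have hn1 : (n : ℝ) + 1 ≠ 0 := by positivity
  -- The labels of the image of the base point. Absence of separation makes them strictly increasing
  -- with total spread at most `n`, hence consecutive integers.
  set e : Fin (n + 1) → ℤ := fun i => (σ i : ℕ) - (n + 1) * m i with he
  have hx : ∀ i, coord (g • basePt n l) i = (l : ℝ) * (n / 2 - e i) / (n + 1) := by
    intro i
    rw [hσ, coord_basePt, he]
    push_cast
    field_simp
    ring
  have hval : ∀ H : Hyperplane n, 0 ≤ val l H (basePt n l) * val l H (g • basePt n l) :=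
    fun H => not_lt.mp (h H)
  have hmono : StrictMono e := by
    intro a b hab
    have h1 := mul_pos_of_not_sep hl (h (⟨(a, b), hab⟩, 0))
    have h2 := pos_of_mul_pos_right h1 (val_basePt_pos hl le_rfl).le
    rw [val_of_coord hx] at h2
    have h3 := pos_of_mul_pos_right h2 (scale_pos hl).le
    have h4 : 0 < e b - e a - 0 * (n + 1) := by exact_mod_cast h3
    linarith
  have hwin : ∀ a b : Fin (n + 1), e b - e a ≤ n := by
    intro a b
    rcases le_or_gt b a with hab | hab
    · have := hmono.monotone hab
      omega
    · have h1 := mul_pos_of_not_sep hl (h (⟨(a, b), hab⟩, 1))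
      have h2 := neg_of_mul_pos_right h1 (val_basePt_neg hl one_pos).le
      rw [val_of_coord hx] at h2
      have h3 := neg_of_mul_neg_right h2 (scale_pos hl).le
      have h4 : e b - e a - 1 * (n + 1) < 0 := by exact_mod_cast h3
      linarith
  have hge : ∀ k : ℕ, ∀ (a b : Fin (n + 1)), (b : ℕ) = a + k → e a + k ≤ e b := by
    intro k
    induction k with
    | zero => intro a b hab; obtain rfl : a = b := Fin.ext (by omega); simp
    | succ k ih =>
      intro a b hab
      have hb := b.isLt
      have h1 := ih a ⟨a + k, by omega⟩ rfl
      have h2 := hmono (a := ⟨a + k, by omega⟩) (b := b) (Fin.mk_lt_mk.mpr (by omega))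
      push_cast
      omega
  have heq : ∀ i : Fin (n + 1), e i = ((i : ℕ) : ℤ) + e 0 := by
    intro i
    have h1 := hge i 0 i (by simp)
    have h2 := hge (n - i) i (Fin.last n) (by simp; omega)
    have h3 := hwin 0 (Fin.last n)
    have h4 := i.isLt
    omega
  -- The coordinate sum is zero for both points, which excludes a common shift of the labels.
  have h0 : e 0 = 0 := by
    apply sum_range_shift n
    rw [← Fin.sum_univ_eq_sum_range (fun i => (i : ℤ) + e 0),
      ← Fin.sum_univ_eq_sum_range (fun i => (i : ℤ))]
    have h1 := sum_coord (g • basePt n l)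
    have h2 := sum_coord (basePt n l)
    simp only [hx, coord_basePt] at h1 h2
    have h3 : ∑ i, (l / (n + 1) * ((e i : ℝ) - (i : ℕ))) = 0 := by
      rw [← sub_eq_zero.mpr (h2.trans h1.symm), ← Finset.sum_sub_distrib]
      exact Finset.sum_congr rfl fun i _ => by field_simp; ring
    rw [← Finset.mul_sum, mul_eq_zero, or_iff_right (scale_pos hl).ne', Finset.sum_sub_distrib,
      sub_eq_zero] at h3
    have h4 : ∑ i, e i = ∑ i : Fin (n + 1), ((i : ℕ) : ℤ) := by exact_mod_cast h3
    rw [← h4]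
    exact Finset.sum_congr rfl fun i _ => (heq i).symm
  -- Both `i` and `σ i` lie between 0 and `n`, so their difference is a multiple of `n + 1` only if
  -- it vanishes.
  have hσm : ∀ i, σ i = i ∧ m i = 0 := by
    intro i
    have h1 : ((σ i : ℕ) : ℤ) - (n + 1) * m i = (i : ℕ) + 0 := h0 ▸ heq i
    have h2 := i.isLt
    have h3 := (σ i).isLt
    have hm : m i = 0 := by
      rcases lt_trichotomy (m i) 0 with h | h | h
      · have : (n + 1 : ℤ) * m i ≤ -(n + 1) := by nlinarith
        omega
      · exact h
      · have : (n + 1 : ℤ) * m i ≥ n + 1 := by nlinarith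
        omega
    rw [hm] at h1
    exact ⟨Fin.ext (by omega), hm⟩
  apply ext_smul
  intro x
  apply ext_coord
  intro i
  rw [hσ, (hσm i).1, (hσm i).2]
  simp

/-- Induction along reduced expressions. -/
theorem len_induction (hl : 0 < l) {P : affineWeyl n l → Prop} (one : P 1)
    (step : ∀ H g, IsWall l H → ¬ Sep l (basePt n l) (g • basePt n l) H → P g →
      P (refl l H * g)) (g : affineWeyl n l) : P g := by
  induction hk : len g using Nat.strong_induction_on generalizing g with
  | _ k ih =>
    by_cases h : ∀ H, ¬ Sep l (basePt n l) (g • basePt n l) H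
    · rw [eq_one_of_not_sep hl h]; exact one
    · push Not at h
      obtain ⟨K, hK⟩ := h
      obtain ⟨H, hH, hs⟩ := exists_wall hl hK
      have h1 := not_sep_refl_mul hs
      have h2 := len_refl_mul hl hH h1
      rw [refl_refl_mul] at h2
      have h3 := step H _ hH h1 (ih _ (by omega) _ rfl)
      rwa [refl_refl_mul] at h3

end Length

/-! ### The closed alcove as a strict fundamental domain; stabilizers. -/

section FundamentalDomain

variable {n l : ℕ}

/-- The closure of the fundamental alcove. -/
def closedAlcove (n l : ℕ) : Set (WeightSpace n) := {y | ∀ H, ¬ Sep l (basePt n l) y H}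

theorem closedAlcove_nonneg {y : WeightSpace n} (hy : y ∈ closedAlcove n l) (H : Hyperplane n) :
    0 ≤ val l H (basePt n l) * val l H y := not_lt.mp (hy H)

theorem basePt_mem_closedAlcove : basePt n l ∈ closedAlcove n l :=
  fun _ => not_lt.mpr (mul_self_nonneg _)

theorem smul_nonneg_of_mem {y : WeightSpace n} (hy : y ∈ closedAlcove n l) (g : affineWeyl n l)
    (H : Hyperplane n) : 0 ≤ val l H (g • basePt n l) * val l H (g • y) := by
  rw [val_mul_val_smul]
  exact closedAlcove_nonneg hy _

/-- A point of the closed alcove that a longer element keeps in the closed alcove lies on the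
wall crossed last. -/
theorem val_eq_zero_of_sep {y : WeightSpace n} {g : affineWeyl n l} {H : Hyperplane n}
    (hy : y ∈ closedAlcove n l) (hgy : g • y ∈ closedAlcove n l)
    (hs : Sep l (basePt n l) (g • basePt n l) H) : val l H (g • y) = 0 := by
  have h1 := closedAlcove_nonneg hgy H
  have h2 := smul_nonneg_of_mem hy g H
  have h3 : val l H (basePt n l) * val l H (g • basePt n l) < 0 := hs
  by_contra hc
  rcases mul_neg_iff.mp h3 with ⟨ha, hb⟩ | ⟨ha, hb⟩ <;> rcases lt_or_gt_of_ne hc with h | h <;>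
    nlinarith

/-- The closed alcove is a strict fundamental domain. -/
theorem smul_eq_self_of_mem (hl : 0 < l) (g : affineWeyl n l) : ∀ {y : WeightSpace n},
    y ∈ closedAlcove n l → g • y ∈ closedAlcove n l → g • y = y := by
  induction g using len_induction hl with
  | one => intro y _ _; rw [one_smul]
  | step H g hH hs ih =>
    intro y hy hgy
    have h1 := val_eq_zero_of_sep hy hgy (sep_refl_mul hl hs)
    have h2 : g • y = (refl l H * g) • y := by
      rw [← reflect_eq_self l h1, ← refl_smul, ← mul_smul, refl_refl_mul]
    rw [← h2] at hgy ⊢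
    exact ih hy hgy

/-- Reduced expressions of elements of the stabilizer use only walls through `y`, so the stabilizer
is a standard parabolic subgroup. -/
theorem stabilizer_induction (hl : 0 < l) {y : WeightSpace n} (hy : y ∈ closedAlcove n l)
    {P : affineWeyl n l → Prop} (one : P 1)
    (step : ∀ H g, IsWall l H → val l H y = 0 → g • y = y →
      ¬ Sep l (basePt n l) (g • basePt n l) H → P g → P (refl l H * g))
    (g : affineWeyl n l) (hg : g • y = y) : P g := by
  induction g using len_induction hl with
  | one => exact one
  | step H g hH hs ih =>
    have h1 := val_eq_zero_of_sep hy (by rwa [hg]) (sep_refl_mul hl hs)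
    rw [hg] at h1
    have h2 : g • y = y := by
      rw [← refl_refl_mul H g, mul_smul, hg, refl_smul, reflect_eq_self l h1]
    exact step H g hH h1 h2 hs (ih h2)

/-- A hyperplane `K` separating `b` from the mirror image of `y` is sent to itself if it also
separates `b` from `y`, and to its mirror image in `H` otherwise. This injects into the hyperplanes
separating `b` from `y` and misses `H`. -/
theorem sep_reflect_lt (hl : 0 < l) {b y : WeightSpace n} {H : Hyperplane n}
    (hs : Sep l b y H) {Q : Hyperplane n → Prop} (hQ : ∀ K, Q (pull (refl l H) K) ↔ Q K)
    (hQH : Q H) :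
    {K | Q K ∧ Sep l b (reflect l H y) K}.ncard < {K | Q K ∧ Sep l b y K}.ncard := by
  classical
  have hpp : ∀ K, pull (refl l H) (pull (refl l H) K) = K := fun K => by
    rw [← pull_mul hl, refl_mul_self, pull_one hl]
  have hsep : ∀ K u v, Sep l u v (pull (refl l H) K) ↔ Sep l (reflect l H u) (reflect l H v) K :=
    fun K u v => (sep_smul (refl l H) K u v).symm
  have hne : ∀ K, Sep l b (reflect l H y) K → K ≠ H := by
    rintro K hK rfl
    rw [Sep, val_reflect_self] at hK
    rw [Sep] at hs
    linarith
  have hfin := sepSet_finite hl Q b y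
  have hmem : H ∈ {K | Q K ∧ Sep l b y K} := ⟨hQH, hs⟩
  have hle : {K | Q K ∧ Sep l b (reflect l H y) K}.ncard ≤
      ({K | Q K ∧ Sep l b y K} \ {H}).ncard := by
    refine Set.ncard_le_ncard_of_injOn
      (fun K => if Sep l b y K then K else pull (refl l H) K) ?_ ?_ hfin.sdiff
    · rintro K ⟨hQK, hK⟩
      split_ifs with h
      · exact ⟨⟨hQK, h⟩, hne K hK⟩
      · refine ⟨⟨(hQ K).mpr hQK, ?_⟩, ?_⟩
        · rw [hsep]
          have e1 := val_reflect l H K b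
          have e2 := val_reflect l H K y
          have h' : 0 ≤ val l K b * val l K y := not_lt.mp h
          rw [Sep] at hK hs ⊢
          have hb : val l K b ≠ 0 := by rintro h0; simp [h0] at hK
          have h1 : 0 < val l K b * (val l H y * pairing (rootVec H.1) K.1) := by
            rw [e2] at hK; nlinarith
          have h2 : val l K b * (val l H b * pairing (rootVec H.1) K.1) < 0 := by
            by_contra hc
            rw [not_lt] at hc
            have := mul_nonneg h1.le hc
            have h3 : 0 < val l K b * pairing (rootVec H.1) K.1 *
                (val l K b * pairing (rootVec H.1) K.1) := by
              apply mul_self_pos.mpr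
              intro h0
              have : val l K b * (val l H y * pairing (rootVec H.1) K.1) = 0 := by
                linear_combination val l H y * h0
              linarith
            nlinarith
          have h3 : 0 < val l K b * val l K (reflect l H b) := by
            rw [e1]
            nlinarith [mul_self_pos.mpr hb]
          exact (sep_iff_of_pos h3).mpr hK
        · intro h0
          rw [Set.mem_singleton_iff] at h0
          apply hne K hK
          rw [← hpp K, h0, pull_refl_self hl]
    · rintro K ⟨-, hK⟩ K' ⟨-, hK'⟩ e
      dsimp only at e
      have aux : ∀ K K', Sep l b (reflect l H y) K → Sep l b (reflect l H y) K' → Sep l b y K →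
          ¬ Sep l b y K' → K ≠ pull (refl l H) K' := by
        rintro K K' hK hK' h h' rfl
        rw [hsep] at h hK
        rw [reflect_reflect] at hK
        rw [Sep] at *
        rcases mul_neg_iff.mp hK with ⟨h1, h2⟩ | ⟨h1, h2⟩ <;>
        rcases mul_neg_iff.mp h with ⟨h3, h4⟩ | ⟨h3, h4⟩ <;>
        rcases mul_neg_iff.mp hK' with ⟨h5, h6⟩ | ⟨h5, h6⟩ <;>
        first | linarith | (exact h' (by nlinarith))
      split_ifs at e with h1 h2 h2
      · exact e
      · exact absurd e (aux K K' hK hK' h1 h2)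
      · exact absurd e.symm (aux K' K hK' hK h2 h1)
      · rw [← hpp K, e, hpp]
  have h2 := Set.ncard_sdiff_singleton_lt_of_mem hmem hfin
  omega

/-- Reflecting a point towards the base point lowers the number of separating hyperplanes. -/
theorem sepCount_reflect_lt (hl : 0 < l) {y : WeightSpace n} {H : Hyperplane n}
    (hs : Sep l (basePt n l) y H) :
    sepCount l (fun _ => True) (reflect l H y) < sepCount l (fun _ => True) y :=
  sep_reflect_lt hl hs (fun _ => Iff.rfl) trivial

theorem exists_smul_mem_closedAlcove (hl : 0 < l) (y : WeightSpace n) :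
    ∃ g : affineWeyl n l, g • y ∈ closedAlcove n l := by
  induction hk : sepCount l (fun _ => True) y using Nat.strong_induction_on generalizing y with
  | _ k ih =>
    by_cases h : ∀ H, ¬ Sep l (basePt n l) y H
    · exact ⟨1, by rw [one_smul]; exact h⟩
    · push Not at h
      obtain ⟨H, hH⟩ := h
      obtain ⟨g, hg⟩ := ih _ (hk ▸ sepCount_reflect_lt hl hH) _ rfl
      exact ⟨g * refl l H, by rwa [mul_smul]⟩

/-- For a point of the closed alcove, an element of the stabilizer whose alcove is separated from
the fundamental alcove by all hyperplanes through the point. -/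
theorem exists_longest (hl : 0 < l) {y : WeightSpace n} (hy : y ∈ closedAlcove n l) :
    ∃ g : affineWeyl n l, g • y = y ∧
      ∀ H, val l H y = 0 → Sep l (basePt n l) (g • basePt n l) H := by
  -- The auxiliary point `z` is `y` pushed slightly away from the base point, hence on the far side
  -- of every hyperplane through `y`. An element moving `z` into the closed alcove also moves `y`
  -- there, so it fixes `y`; its inverse is the longest element.
  obtain ⟨t, ht, hsm⟩ := exists_small hl y (y + (y - basePt n l))
  set z := y + t • (y + (y - basePt n l) - y) with hz
  have hzval : ∀ H, val l H y = 0 → val l H z = - (t * val l H (basePt n l)) := by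
    intro H h
    have h1 := val_add_smul_sub l H y (basePt n l) (-t)
    have h2 : y + (-t) • (basePt n l - y) = z := by rw [hz]; module
    rw [h2, h] at h1
    linarith
  obtain ⟨g, hg⟩ := exists_smul_mem_closedAlcove hl z
  have hg' : ∀ H, 0 ≤ val l H (g⁻¹ • basePt n l) * val l H z := fun H => by
    have := smul_nonneg_of_mem hg g⁻¹ H
    rwa [inv_smul_smul] at this
  have hmem : g • y ∈ closedAlcove n l := by
    intro H hs
    have h1 := sep_smul g⁻¹ (pull g H) (basePt n l) (g • y)
    rw [← pull_mul hl, mul_inv_cancel, pull_one hl, inv_smul_smul] at h1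
    have h2 := h1.mpr hs
    have h3 := hg' (pull g H)
    have hne : val l (pull g H) y ≠ 0 := by
      rintro h0; simp [Sep, h0] at h2
    have h4 := hsm _ hne
    rw [Sep] at h2
    rcases mul_neg_iff.mp h2 with ⟨ha, hb⟩ | ⟨ha, hb⟩ <;> nlinarith
  have hgy := smul_eq_self_of_mem hl g hy hmem
  refine ⟨g⁻¹, by rw [inv_smul_eq_iff, hgy], fun H hH => ?_⟩
  have h1 := hg' H
  rw [hzval H hH] at h1
  have h2 := val_smul_basePt_ne hl g⁻¹ H
  have h3 := val_basePt_ne hl H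
  refine lt_of_le_of_ne ?_ (mul_ne_zero h3 h2)
  nlinarith

theorem nonneg_of_midpoint_pos {a b z : ℝ} (h : 0 < (1 / 2 * a + 1 / 2 * b) * z)
    (hab : 0 ≤ a * b) : 0 ≤ z * a := by
  by_contra! hc
  rcases mul_pos_iff.mp h with ⟨h1, h2⟩ | ⟨h1, h2⟩
  · have ha := neg_of_mul_neg_right hc h2.le
    have hb := nonpos_of_mul_nonneg_right hab ha
    linarith
  · have ha := pos_of_mul_neg_right hc h2.le
    have hb := nonneg_of_mul_nonneg_right hab ha
    linarith

/-- Two points that no hyperplane strictly separates lie in the closure of a common alcove. -/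
theorem exists_regular_of_not_sep (hl : 0 < l) {x y : WeightSpace n} (h : ∀ H, ¬ Sep l x y H) :
    ∃ z, (∀ H, val l H z ≠ 0) ∧ (∀ H, ¬ Sep l z x H) ∧ (∀ H, ¬ Sep l z y H) ∧
      (∀ H, ¬ Sep l z (x + (1 / 2 : ℝ) • (y - x)) H) ∧
      (∀ H, val l H (x + (1 / 2 : ℝ) • (y - x)) = 0 ↔ val l H x = 0 ∧ val l H y = 0) := by
  -- Without strict separation the midpoint lies on a hyperplane only if both end points do. A small
  -- displacement of it towards the base point is regular.
  set m := x + (1 / 2 : ℝ) • (y - x) with hm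
  have hmv : ∀ H, val l H m = 1 / 2 * val l H x + 1 / 2 * val l H y := fun H => by
    rw [hm, val_add_smul_sub]; norm_num
  have hzero : ∀ H, val l H m = 0 ↔ val l H x = 0 ∧ val l H y = 0 := by
    intro H
    constructor
    · intro h0
      have h1 : 0 ≤ val l H x * val l H y := not_lt.mp (h H)
      have h2 : val l H y = - val l H x := by linarith [hmv H]
      rw [h2] at h1 ⊢
      have : val l H x = 0 := by nlinarith
      simp [this]
    · rintro ⟨h1, h2⟩
      rw [hmv, h1, h2]; simp
  obtain ⟨t, ht, hsm⟩ := exists_small hl m (basePt n l)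
  refine ⟨m + t • (basePt n l - m), fun H => ?_, fun H => ?_, fun H => ?_, fun H => ?_, hzero⟩
  all_goals
    by_cases h0 : val l H m = 0
    · have h1 := val_add_smul_sub l H m (basePt n l) t
      rw [h0, mul_zero, zero_add] at h1
      obtain ⟨h2, h3⟩ := (hzero H).mp h0
      have h4 := mul_ne_zero ht.ne' (val_basePt_ne hl H)
      first | (rw [h1]; exact h4) | simp [Sep, h2, h3, h0]
    · have h1 := hsm H h0
      have h2 := hmv H
      have h3 : 0 ≤ val l H x * val l H y := not_lt.mp (h H)
      first
      | (rintro h4; simp [h4] at h1)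
      | (rw [Sep, not_lt]
         rw [h2] at h1
         first
         | exact nonneg_of_midpoint_pos h1 h3
         | exact nonneg_of_midpoint_pos (by rwa [add_comm] at h1) (by rwa [mul_comm] at h3)
         | (rw [h2]; nlinarith))

end FundamentalDomain

/-! ### The regular module of the affine Hecke algebra. -/

open LaurentPolynomial

/-- The coefficient `q⁻¹ - q` of the quadratic relation. -/
noncomputable def qdiff : LaurentPolynomial ℤ := T (-1) - T 1

theorem invert_qdiff : invert qdiff = -qdiff := by
  rw [qdiff, map_sub, invert_T, invert_T, neg_neg, neg_sub]

section HeckeModule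

variable {n l : ℕ}

/-- The right regular module of the affine Hecke algebra: the free module on the affine Weyl
group, whose elements stand for the alcoves. -/
abbrev HeckeModule (n l : ℕ) : Type := affineWeyl n l →₀ LaurentPolynomial ℤ

/-- The standard basis element of `w`. -/
noncomputable abbrev std (w : affineWeyl n l) : HeckeModule n l := Finsupp.single w 1

open Classical in
/-- Left multiplication by the standard generator of the wall `H`. -/
noncomputable def leftGen (l : ℕ) (H : Hyperplane n) :
    Module.End (LaurentPolynomial ℤ) (HeckeModule n l) :=
  Finsupp.linearCombination (LaurentPolynomial ℤ) fun w =>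
    std (refl l H * w) +
      (if Sep l (basePt n l) (w • basePt n l) H then qdiff else 0) •
        std w

open Classical in
/-- Right multiplication by the standard generator of the wall `H`. -/
noncomputable def rightGen (l : ℕ) (H : Hyperplane n) :
    Module.End (LaurentPolynomial ℤ) (HeckeModule n l) :=
  Finsupp.linearCombination (LaurentPolynomial ℤ) fun w =>
    std (w * refl l H) +
      (if Sep l (basePt n l) (w⁻¹ • basePt n l) H then qdiff else 0) • std w

theorem leftGen_std_up {H : Hyperplane n} {w : affineWeyl n l}
    (h : ¬ Sep l (basePt n l) (w • basePt n l) H) : leftGen l H (std w) = std (refl l H * w) := by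
  simp [leftGen, h]

theorem leftGen_std_down {H : Hyperplane n} {w : affineWeyl n l}
    (h : Sep l (basePt n l) (w • basePt n l) H) :
    leftGen l H (std w) =
      std (refl l H * w) + qdiff • std w := by
  simp only [leftGen, Finsupp.linearCombination_single, one_smul, h, if_true]

theorem rightGen_std_up {H : Hyperplane n} {w : affineWeyl n l}
    (h : ¬ Sep l (basePt n l) (w⁻¹ • basePt n l) H) :
    rightGen l H (std w) = std (w * refl l H) := by
  simp [rightGen, h]

theorem end_ext {f g : Module.End (LaurentPolynomial ℤ) (HeckeModule n l)}
    (h : ∀ w, f (std w) = g (std w)) : f = g :=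
  Finsupp.lhom_ext' fun w => LinearMap.ext_ring (h w)

theorem leftGen_mul_self (hl : 0 < l) (H : Hyperplane n) :
    leftGen l H * leftGen l H = 1 + qdiff • leftGen l H := by
  refine end_ext fun w => ?_
  simp only [Module.End.mul_apply, LinearMap.add_apply, Module.End.one_apply, LinearMap.smul_apply]
  by_cases h : Sep l (basePt n l) (w • basePt n l) H
  · rw [leftGen_std_down h, map_add, map_smul, leftGen_std_up (not_sep_refl_mul h),
      leftGen_std_down h, refl_refl_mul]
  · rw [leftGen_std_up h, leftGen_std_down (sep_refl_mul hl h), refl_refl_mul]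

/-- The generators are invertible. -/
noncomputable def leftUnit (hl : 0 < l) (H : Hyperplane n) :
    (Module.End (LaurentPolynomial ℤ) (HeckeModule n l))ˣ where
  val := leftGen l H
  inv := leftGen l H - qdiff • 1
  val_inv := by
    refine LinearMap.ext fun x => ?_
    have e := LinearMap.congr_fun (leftGen_mul_self hl H) x
    change leftGen l H (leftGen l H x) = x + qdiff • leftGen l H x at e
    change leftGen l H (leftGen l H x - qdiff • x) = x
    rw [map_sub, map_smul, e, add_sub_cancel_right]
  inv_val := by
    refine LinearMap.ext fun x => ?_
    have e := LinearMap.congr_fun (leftGen_mul_self hl H) x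
    change leftGen l H (leftGen l H x) = x + qdiff • leftGen l H x at e
    change leftGen l H (leftGen l H x) - qdiff • leftGen l H x = x
    rw [e, add_sub_cancel_right]

theorem sep_of_pull_eq {w : affineWeyl n l} {H K : Hyperplane n}
    (h : pull w H = K) : Sep l (basePt n l) (w • basePt n l) H ↔
      Sep l (basePt n l) (w⁻¹ • basePt n l) K := by
  have := sep_smul w H (w⁻¹ • basePt n l) (basePt n l)
  rw [smul_inv_smul, h] at this
  rw [this, sep_comm]

theorem sep_mul_refl_iff (hl : 0 < l) {w : affineWeyl n l} {H K : Hyperplane n} (hK : IsWall l K)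
    (h : pull w H ≠ K) : Sep l (basePt n l) ((w * refl l K) • basePt n l) H ↔
      Sep l (basePt n l) (w • basePt n l) H := by
  have h1 := hK.val_mul_pos hl h
  rw [← refl_smul, ← val_mul_val_smul, ← mul_smul] at h1
  rw [sep_comm, sep_iff_of_pos h1, sep_comm]

/-- The two operations interfere only if left reflection in `H` and right reflection in `K` agree on
`w`; then the left and right descent conditions coincide. Otherwise neither reflection affects the
descent condition of the other. This commutation does the work of the braid relations. -/
theorem leftGen_rightGen_comm (hl : 0 < l) {H K : Hyperplane n} (hH : IsWall l H)
    (hK : IsWall l K) : Commute (leftGen l H) (rightGen l K) := by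
  classical
  refine end_ext fun w => ?_
  simp only [Module.End.mul_apply]
  simp only [leftGen, rightGen, Finsupp.linearCombination_single, one_smul, map_add, map_smul]
  by_cases h : pull w H = K
  · have e1 : refl l H * w = w * refl l K := by rw [refl_mul_eq, h]
    have e2 : pull (w * refl l K) H = K := by rw [pull_mul hl, h, pull_refl_self hl]
    rw [sep_of_pull_eq h, sep_of_pull_eq e2, e1, ← mul_assoc, e1]
  · have h' : pull w⁻¹ K ≠ H := by
      rintro rfl
      apply h
      rw [← pull_mul hl, inv_mul_cancel, pull_one hl]
    have e := sep_mul_refl_iff hl hH h'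
    have e' : (refl l H * w)⁻¹ = w⁻¹ * refl l H := by rw [mul_inv_rev, refl_inv]
    rw [sep_mul_refl_iff hl hK h, e', e, mul_assoc]
    module

/-- `std 1` generates the module under the right action: build up `w⁻¹` along a reduced expression
of `w`. -/
theorem eq_top_of_rightGen (hl : 0 < l) {S : Submodule (LaurentPolynomial ℤ) (HeckeModule n l)}
    (h1 : std 1 ∈ S) (h : ∀ H, IsWall l H → ∀ x ∈ S, rightGen l H x ∈ S) (x : HeckeModule n l) :
    x ∈ S := by
  have key : ∀ w : affineWeyl n l, std w⁻¹ ∈ S := by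
    intro w
    induction w using len_induction hl with
    | one => rwa [inv_one]
    | step H g hH hs ih =>
      have := h H hH _ ih
      rw [rightGen_std_up (by rwa [inv_inv])] at this
      rwa [mul_inv_rev, refl_inv]
  induction x using Finsupp.induction_linear with
  | zero => exact S.zero_mem
  | add f g hf hg => exact S.add_mem hf hg
  | single w a =>
    have := S.smul_mem a (key w⁻¹)
    rwa [inv_inv, Finsupp.smul_single, smul_eq_mul, mul_one] at this

/-- An operator that commutes with the right action is determined by its value at `1`. -/
theorem eq_of_commute_rightGen (hl : 0 < l)
    {f g : Module.End (LaurentPolynomial ℤ) (HeckeModule n l)}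
    (hf : ∀ H, IsWall l H → Commute f (rightGen l H))
    (hg : ∀ H, IsWall l H → Commute g (rightGen l H)) (h : f (std 1) = g (std 1)) : f = g := by
  refine LinearMap.ext fun x => ?_
  refine eq_top_of_rightGen hl (S := LinearMap.eqLocus f g) h (fun H hH x hx => ?_) x
  have hx' : f x = g x := hx
  change f (rightGen l H x) = g (rightGen l H x)
  have e1 := LinearMap.congr_fun (hf H hH).eq x
  have e2 := LinearMap.congr_fun (hg H hH).eq x
  simp only [Module.End.mul_apply] at e1 e2
  rw [e1, e2, hx']

/-- The product of generators along a reduced expression. The choice of expression is immaterial,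
because an operator commuting with the right action is determined by its value at `std 1`. -/
theorem exists_leftMul (hl : 0 < l) (w : affineWeyl n l) :
    ∃ u : (Module.End (LaurentPolynomial ℤ) (HeckeModule n l))ˣ,
      (∀ H, IsWall l H → Commute u.1 (rightGen l H)) ∧ u.1 (std 1) = std w := by
  induction w using len_induction hl with
  | one => exact ⟨1, fun H _ => Commute.one_left _, rfl⟩
  | step H g hH hs ih =>
    obtain ⟨u, hu, h1⟩ := ih
    refine ⟨leftUnit hl H * u, fun K hK => (leftGen_rightGen_comm hl hH hK).mul_left (hu K hK), ?_⟩
    rw [Units.val_mul, Module.End.mul_apply, h1]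
    exact leftGen_std_up hs

/-- Left multiplication by the standard basis element of `w`. -/
noncomputable def leftMul (hl : 0 < l) (w : affineWeyl n l) :
    (Module.End (LaurentPolynomial ℤ) (HeckeModule n l))ˣ := (exists_leftMul hl w).choose

theorem leftMul_comm (hl : 0 < l) (w : affineWeyl n l) {H : Hyperplane n} (hH : IsWall l H) :
    Commute (leftMul hl w).1 (rightGen l H) := (exists_leftMul hl w).choose_spec.1 H hH

theorem leftMul_std_one (hl : 0 < l) (w : affineWeyl n l) :
    (leftMul hl w).1 (std 1) = std w := (exists_leftMul hl w).choose_spec.2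

theorem leftMul_one (hl : 0 < l) : leftMul hl (1 : affineWeyl n l) = 1 :=
  Units.ext (eq_of_commute_rightGen hl (fun _ hH => leftMul_comm hl 1 hH)
    (fun _ _ => Commute.one_left _) (leftMul_std_one hl 1))

/-- Both sides commute with the right action, so it suffices to compare them at `std 1`, where left
and right multiplication by the generator agree. -/
theorem leftMul_mul_refl (hl : 0 < l) {w : affineWeyl n l} {H : Hyperplane n} (hH : IsWall l H)
    (h : ¬ Sep l (basePt n l) (w⁻¹ • basePt n l) H) :
    leftMul hl (w * refl l H) = leftMul hl w * leftUnit hl H := by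
  refine Units.ext (eq_of_commute_rightGen hl (fun _ hK => leftMul_comm hl _ hK)
    (fun K hK => (leftMul_comm hl w hK).mul_left (leftGen_rightGen_comm hl hH hK)) ?_)
  have hns : ¬ Sep l (basePt n l) ((1 : affineWeyl n l) • basePt n l) H := by
    rw [one_smul]
    exact basePt_mem_closedAlcove H
  have hns' : ¬ Sep l (basePt n l) ((1 : affineWeyl n l)⁻¹ • basePt n l) H := by
    rwa [inv_one]
  rw [leftMul_std_one]
  change _ = (leftMul hl w).1 (leftGen l H (std 1))
  rw [leftGen_std_up hns, mul_one, ← one_mul (refl l H), ← rightGen_std_up hns']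
  have e := LinearMap.congr_fun (leftMul_comm hl w hH).eq (std 1)
  simp only [Module.End.mul_apply] at e
  rw [e, leftMul_std_one, rightGen_std_up h, one_mul]

end HeckeModule

/-! ### The bar involution and its unitriangularity. -/

section Bar

variable {n l : ℕ}

/-- The bar involution on a standard basis element. -/
noncomputable def barStd (hl : 0 < l) (w : affineWeyl n l) : HeckeModule n l :=
  -- The usual formula: the standard element of `w` goes to the inverse of the standard element of
  -- `w⁻¹`.
  (leftMul hl w⁻¹)⁻¹.1 (std 1)

/-- The bar involution. -/
noncomputable def bar (hl : 0 < l) : HeckeModule n l →+ HeckeModule n l :=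
  Finsupp.liftAddHom fun w =>
    ((LinearMap.toSpanSingleton (LaurentPolynomial ℤ) _ (barStd hl w)).toAddMonoidHom).comp
      (invert (R := ℤ)).toRingEquiv.toAddMonoidHom

theorem bar_single (hl : 0 < l) (w : affineWeyl n l) (a : LaurentPolynomial ℤ) :
    bar hl (Finsupp.single w a) = invert a • barStd hl w := by
  simp [bar]

theorem bar_std (hl : 0 < l) (w : affineWeyl n l) : bar hl (std w) = barStd hl w := by
  rw [std, bar_single, map_one, one_smul]

theorem bar_smul (hl : 0 < l) (a : LaurentPolynomial ℤ) (x : HeckeModule n l) :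
    bar hl (a • x) = invert a • bar hl x := by
  induction x using Finsupp.induction_linear with
  | zero => simp
  | add f g hf hg => rw [smul_add, map_add, hf, hg, map_add, smul_add]
  | single w b => rw [Finsupp.smul_single, bar_single, bar_single, smul_eq_mul, map_mul, mul_smul]

theorem barStd_one (hl : 0 < l) : barStd hl (1 : affineWeyl n l) = std 1 := by
  rw [barStd, inv_one, leftMul_one]
  rfl

theorem barStd_refl_mul (hl : 0 < l) {w : affineWeyl n l} {H : Hyperplane n} (hH : IsWall l H)
    (h : ¬ Sep l (basePt n l) (w • basePt n l) H) :
    barStd hl (refl l H * w) = (leftUnit hl H)⁻¹.1 (barStd hl w) := by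
  rw [barStd, mul_inv_rev, refl_inv, leftMul_mul_refl hl hH (by rwa [inv_inv]), mul_inv_rev]
  rfl

theorem leftUnit_inv_apply (hl : 0 < l) (H : Hyperplane n) (x : HeckeModule n l) :
    (leftUnit hl H)⁻¹.1 x = leftGen l H x - qdiff • x := rfl

/-- `bar` turns a generator into its inverse, which by the quadratic relation is the generator minus
`qdiff`. -/
theorem bar_leftGen (hl : 0 < l) {H : Hyperplane n} (hH : IsWall l H) (x : HeckeModule n l) :
    bar hl (leftGen l H x) =
      leftGen l H (bar hl x) - qdiff • bar hl x := by
  have key : ∀ w : affineWeyl n l, bar hl (leftGen l H (std w)) =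
      leftGen l H (barStd hl w) - qdiff • barStd hl w := by
    intro w
    by_cases h : Sep l (basePt n l) (w • basePt n l) H
    · have h' := not_sep_refl_mul h
      have e := barStd_refl_mul hl hH h'
      rw [refl_refl_mul, leftUnit_inv_apply] at e
      have e2 := LinearMap.congr_fun (leftGen_mul_self hl H) (barStd hl (refl l H * w))
      simp only [Module.End.mul_apply, LinearMap.add_apply, Module.End.one_apply,
        LinearMap.smul_apply] at e2
      rw [leftGen_std_down h, map_add, bar_smul, bar_std, bar_std, e, map_sub, map_smul, e2,
        invert_qdiff]
      module
    · rw [leftGen_std_up h, bar_std, barStd_refl_mul hl hH h, leftUnit_inv_apply]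
  induction x using Finsupp.induction_linear with
  | zero => simp
  | add f g hf hg =>
    rw [map_add, map_add, hf, hg, map_add, map_add, smul_add]
    abel
  | single w a =>
    have : Finsupp.single w a = a • std w := by simp
    rw [this, map_smul, bar_smul, key, bar_smul, map_smul, bar_std]
    module

theorem leftGen_apply_eq_zero {H : Hyperplane n} {x : HeckeModule n l} {v : affineWeyl n l}
    (h1 : x (refl l H * v) = 0) (h2 : x v = 0) : leftGen l H x v = 0 := by
  classical
  rw [leftGen, Finsupp.linearCombination_apply, Finsupp.sum, Finsupp.finsetSum_apply]
  refine Finset.sum_eq_zero fun w hw => ?_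
  have hv : w ≠ v := by rintro rfl; simp [h2] at hw
  have hv' : refl l H * w ≠ v := by
    rintro rfl
    rw [refl_refl_mul] at h1
    simp [h1] at hw
  split_ifs <;> simp [hv, hv']

theorem leftGen_apply_of_not_sep {H : Hyperplane n} (x : HeckeModule n l)
    {v : affineWeyl n l} (h : ¬ Sep l (basePt n l) (v • basePt n l) H) :
    leftGen l H x v = x (refl l H * v) := by
  classical
  induction x using Finsupp.induction_linear with
  | zero => simp
  | add f g hf hg => rw [map_add, Finsupp.add_apply, hf, hg, Finsupp.add_apply]
  | single w a =>
    simp only [leftGen, Finsupp.linearCombination_single, Finsupp.smul_apply, Finsupp.add_apply,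
      smul_eq_mul, Finsupp.single_apply]
    have e : refl l H * w = v ↔ w = refl l H * v := by
      constructor <;> rintro rfl <;> rw [refl_refl_mul]
    by_cases hwv : w = v
    · subst hwv
      simp [h, e]
    · simp [hwv, e]

/-- The bar involution is unitriangular with respect to the length. -/
theorem barStd_triangular (hl : 0 < l) (w : affineWeyl n l) :
    barStd hl w w = 1 ∧ ∀ v, v ≠ w → barStd hl w v ≠ 0 → len v < len w := by
  classical
  induction w using len_induction hl with
  | one =>
    rw [barStd_one]
    exact ⟨by simp, fun v hv h => absurd (Finsupp.single_eq_of_ne hv) h⟩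
  | step H w hH hs ih =>
    have hlen := len_refl_mul hl hH hs
    have hw : refl l H * w ≠ w := by
      intro h; rw [h] at hlen; omega
    have h0 : barStd hl w (refl l H * w) = 0 := by
      by_contra hc
      have := ih.2 _ hw hc
      omega
    rw [barStd_refl_mul hl hH hs, leftUnit_inv_apply]
    -- The leading term produces the new leading term. The rest has length below `len w`, and a
    -- generator raises lengths by at most one, so it stays below the new length.
    have hz : barStd hl w = std w + (barStd hl w - std w) := by abel
    have hlow : ∀ v, (barStd hl w - std w) v ≠ 0 → len v < len w := by
      intro v hv
      by_cases hvw : v = w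
      · subst hvw; simp [ih.1] at hv
      · apply ih.2 v hvw
        intro h; simp [h, Ne.symm hvw] at hv
    have h1 : leftGen l H (barStd hl w) =
        std (refl l H * w) + leftGen l H (barStd hl w - std w) := by
      conv_lhs => rw [hz, map_add, leftGen_std_up hs]
    have h2 : ∀ v, leftGen l H (barStd hl w - std w) v ≠ 0 → len v < len (refl l H * w) := by
      intro v hv
      by_contra hc
      apply hv
      apply leftGen_apply_eq_zero
      · by_contra hc'
        have h3 := hlow _ hc'
        have h4 := len_refl_mul_le hl hH (refl l H * v)
        rw [refl_refl_mul] at h4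
        omega
      · by_contra hc'
        have h3 := hlow _ hc'
        omega
    constructor
    · have h3 : leftGen l H (barStd hl w - std w) (refl l H * w) = 0 := by
        by_contra hc
        exact lt_irrefl _ (h2 _ hc)
      rw [Finsupp.sub_apply, h1, Finsupp.add_apply, h3, Finsupp.smul_apply, h0]
      simp
    · intro v hv hne
      by_contra hc
      apply hne
      have h3 : leftGen l H (barStd hl w - std w) v = 0 := by
        by_contra h; exact hc (h2 _ h)
      have h4 : barStd hl w v = 0 := by
        by_contra h
        by_cases hvw : v = w
        · subst hvw; omega
        · have := ih.2 v hvw h; omega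
      rw [Finsupp.sub_apply, h1, Finsupp.add_apply, h3, Finsupp.smul_apply, h4,
        Finsupp.single_eq_of_ne hv]
      simp

end Bar

/-! ### The antispherical module and the vanishing of positive self-dual elements. -/

section Antispherical

variable {n l : ℕ}

/-- The alcove of `w` is dominant. -/
def DomAlcove (w : affineWeyl n l) : Prop :=
  ∀ H : Hyperplane n, val l H (-rho n) = 0 → ¬ Sep l (basePt n l) (w • basePt n l) H

theorem val_neg_rho (H : Hyperplane n) : val l H (-rho n) = -(H.2 * l) := by
  simp [val, level_eq, coord_neg_rho]

theorem val_neg_rho_eq_zero (hl : 0 < l) {H : Hyperplane n} :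
    val l H (-rho n) = 0 ↔ H.2 = 0 := by
  have hl' : (l : ℝ) ≠ 0 := by exact_mod_cast hl.ne'
  rw [val_neg_rho, neg_eq_zero, mul_eq_zero, or_iff_left hl', Int.cast_eq_zero]

theorem neg_rho_mem_closedAlcove (hl : 0 < l) : -rho n ∈ closedAlcove n l := by
  intro H
  have hl' : (0 : ℝ) < l := by exact_mod_cast hl
  rw [Sep, not_lt, val_neg_rho]
  rcases le_or_gt H.2 0 with h | h
  · have h1 : (H.2 : ℝ) ≤ 0 := by exact_mod_cast h
    exact mul_nonneg (val_basePt_pos hl h).le (by nlinarith)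
  · have h1 : (0 : ℝ) < H.2 := by exact_mod_cast h
    exact mul_nonneg_of_nonpos_of_nonpos (val_basePt_neg hl h).le (by nlinarith)

/-- A point below some wall of the dominant chamber is below a simple one. -/
theorem exists_simple_wall (hl : 0 < l) {x : WeightSpace n} {K : Hyperplane n}
    (hK : val l K (-rho n) = 0) (h : Sep l (basePt n l) x K) :
    ∃ H, IsWall l H ∧ val l H (-rho n) = 0 ∧ Sep l (basePt n l) x H := by
  by_contra! hc
  have hanti : Antitone (coord x) := coord_antitone_of_simple fun α hα => by
    have h1 := hc (α, 0) (isWall_simple hl α hα) ((val_neg_rho_eq_zero hl).mpr rfl)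
    have h2 := val_basePt_pos (n := n) hl (H := (α, 0)) le_rfl
    rw [Sep, not_lt] at h1
    have h3 := nonneg_of_mul_nonneg_right h1 h2
    simpa [val] using h3
  obtain ⟨α, k⟩ := K
  obtain rfl : k = 0 := (val_neg_rho_eq_zero hl).mp hK
  have h2 := val_basePt_pos (n := n) hl (H := (α, 0)) le_rfl
  have h4 : 0 ≤ val l (α, 0) x := by
    simp only [val, level_eq]
    have := hanti α.2.le
    push_cast
    linarith
  exact absurd h (not_lt.mpr (mul_nonneg h2.le h4))

theorem refl_smul_neg_rho {H : Hyperplane n} (h : val l H (-rho n) = 0) :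
    refl l H • -rho n = -rho n := reflect_eq_self l h

/-- As long as the alcove is not dominant, a simple wall of the dominant chamber separates it from
the fundamental alcove, and reflecting in that wall shortens `w`. -/
theorem exists_domRep (hl : 0 < l) (w : affineWeyl n l) : ∃ x : affineWeyl n l,
    x • -rho n = -rho n ∧ DomAlcove (x * w) ∧ len (x * w) ≤ len w := by
  induction hk : len w using Nat.strong_induction_on generalizing w with
  | _ k ih =>
    by_cases h : DomAlcove w
    · exact ⟨1, one_smul _ _, by rwa [one_mul], by rw [one_mul, hk]⟩
    · unfold DomAlcove at h
      push Not at h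
      obtain ⟨K, hK, hs⟩ := h
      obtain ⟨H, hH, h0, hs⟩ := exists_simple_wall hl hK hs
      have h2 := len_refl_mul hl hH (not_sep_refl_mul hs)
      rw [refl_refl_mul] at h2
      obtain ⟨x, hx, hd, hlen⟩ := ih _ (by omega) (refl l H * w) rfl
      refine ⟨x * refl l H, ?_, by rwa [mul_assoc], ?_⟩
      · rw [mul_smul, refl_smul_neg_rho h0, hx]
      · rw [mul_assoc]; omega

/-- If `x` were not 1, a wall through `-ρ` would separate its alcove from the fundamental one; but
two dominant alcoves lie on the prescribed sides of that wall and of its preimage. -/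
theorem eq_one_of_domAlcove (hl : 0 < l) {x w : affineWeyl n l} (hx : x • -rho n = -rho n)
    (hw : DomAlcove w) (hxw : DomAlcove (x * w)) : x = 1 := by
  apply eq_one_of_not_sep hl
  intro K hK
  obtain ⟨H, hH, hs⟩ := exists_wall hl hK
  have hmem := neg_rho_mem_closedAlcove (n := n) hl
  have h0 := val_eq_zero_of_sep hmem (by rwa [hx]) hs
  have h1 := (val_smul_eq_zero x H _).mp h0
  rw [hx] at h0
  have h2 := mul_pos_of_not_sep hl (hxw H h0)
  have h3 := mul_pos_of_not_sep hl (hw (pull x H) h1)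
  rw [← val_mul_val_smul, ← mul_smul] at h3
  rw [Sep] at hs
  rcases mul_neg_iff.mp hs with ⟨ha, hb⟩ | ⟨ha, hb⟩ <;> nlinarith

/-- The dominant alcove in the orbit of `w` under the finite Weyl group. -/
noncomputable def domRep (hl : 0 < l) (w : affineWeyl n l) : affineWeyl n l :=
  (exists_domRep hl w).choose * w

theorem domRep_dom (hl : 0 < l) (w : affineWeyl n l) : DomAlcove (domRep hl w) :=
  (exists_domRep hl w).choose_spec.2.1

theorem len_domRep_le (hl : 0 < l) (w : affineWeyl n l) : len (domRep hl w) ≤ len w :=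
  (exists_domRep hl w).choose_spec.2.2

theorem domRep_eq (hl : 0 < l) {x w : affineWeyl n l} (hx : x • -rho n = -rho n)
    (hxw : DomAlcove (x * w)) : domRep hl w = x * w := by
  have h1 := (exists_domRep hl w).choose_spec.1
  set y := (exists_domRep hl w).choose with hy
  have h2 : DomAlcove (y * w) := domRep_dom hl w
  have h3 : (x * y⁻¹) • -rho n = -rho n := by
    rw [mul_smul, inv_smul_eq_iff.mpr h1.symm, hx]
  have h4 := eq_one_of_domAlcove hl h3 h2 (by rwa [mul_assoc, inv_mul_cancel_left])
  rw [mul_inv_eq_one.mp h4]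
  rfl

theorem domRep_of_dom (hl : 0 < l) {w : affineWeyl n l} (hw : DomAlcove w) : domRep hl w = w := by
  have := domRep_eq hl (x := 1) (w := w) (one_smul _ _) (by rwa [one_mul])
  rwa [one_mul] at this

theorem domRep_refl_mul (hl : 0 < l) {H : Hyperplane n} (h : val l H (-rho n) = 0)
    (w : affineWeyl n l) : domRep hl (refl l H * w) = domRep hl w := by
  have h1 := (exists_domRep hl w).choose_spec.1
  rw [domRep_eq hl (x := (exists_domRep hl w).choose * refl l H)]
  · rw [mul_assoc, refl_refl_mul]; rfl
  · rw [mul_smul, refl_smul_neg_rho h, h1]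
  · rw [mul_assoc, refl_refl_mul]; exact domRep_dom hl w

/-- The number of finite hyperplanes separating the alcove of `w` from the dominant chamber. -/
noncomputable def finLen (w : affineWeyl n l) : ℕ :=
  sepCount l (fun H => val l H (-rho n) = 0) (w • basePt n l)

theorem finLen_of_dom {w : affineWeyl n l} (hw : DomAlcove w) : finLen w = 0 := by
  rw [finLen, sepCount]
  convert Set.ncard_empty (Hyperplane n)
  ext H
  simp only [Set.mem_ofPred_eq, Set.mem_empty_iff_false, iff_false, not_and]
  exact hw H

theorem finLen_refl_mul (hl : 0 < l) {H : Hyperplane n} (hH : IsWall l H)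
    (h0 : val l H (-rho n) = 0) {w : affineWeyl n l}
    (h : ¬ Sep l (basePt n l) (w • basePt n l) H) : finLen (refl l H * w) = finLen w + 1 := by
  rw [finLen, mul_smul, refl_smul]
  refine sepCount_reflect_up hl hH (Q := fun K => val l K (-rho n) = 0) (fun K => ?_) h0
    (mul_pos_of_not_sep hl h)
  rw [← val_smul_eq_zero, refl_smul_neg_rho h0]

/-- The projection onto the antispherical module, realized as the span of the dominant alcoves. -/
noncomputable def antiProj (hl : 0 < l) :
    Module.End (LaurentPolynomial ℤ) (HeckeModule n l) :=
  Finsupp.linearCombination (LaurentPolynomial ℤ) fun w =>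
    (-T 1 : LaurentPolynomial ℤ) ^ finLen w • std (domRep hl w)

theorem antiProj_std (hl : 0 < l) (w : affineWeyl n l) :
    antiProj hl (std w) = (-T 1 : LaurentPolynomial ℤ) ^ finLen w • std (domRep hl w) := by
  rw [antiProj, Finsupp.linearCombination_single, one_smul]

theorem antiProj_of_dom (hl : 0 < l) {w : affineWeyl n l} (hw : DomAlcove w) :
    antiProj hl (std w) = std w := by
  rw [antiProj_std, finLen_of_dom hw, pow_zero, one_smul, domRep_of_dom hl hw]

theorem antiProj_of_supp (hl : 0 < l) {x : HeckeModule n l} (hx : ∀ w, x w ≠ 0 → DomAlcove w) :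
    antiProj hl x = x := by
  conv_lhs => rw [← Finsupp.sum_single x]
  conv_rhs => rw [← Finsupp.sum_single x]
  rw [Finsupp.sum, map_sum]
  refine Finset.sum_congr rfl fun w hw => ?_
  have : Finsupp.single w (x w) = x w • std w := by simp
  rw [this, map_smul, antiProj_of_dom hl (hx w (Finsupp.mem_support_iff.mp hw))]

theorem single_eq_smul_std (w : affineWeyl n l) (a : LaurentPolynomial ℤ) :
    (Finsupp.single w a : HeckeModule n l) = a • std w := by simp

/-- The sign weights in `antiProj` are made for this: the finite generators act through the
character with value -q, a root of the quadratic relation. -/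
theorem antiProj_leftGen (hl : 0 < l) {H : Hyperplane n} (hH : IsWall l H)
    (h0 : val l H (-rho n) = 0) (x : HeckeModule n l) :
    antiProj hl (leftGen l H x) = (-T 1 : LaurentPolynomial ℤ) • antiProj hl x := by
  have key : ∀ w : affineWeyl n l, antiProj hl (leftGen l H (std w)) =
      (-T 1 : LaurentPolynomial ℤ) • antiProj hl (std w) := by
    intro w
    by_cases h : Sep l (basePt n l) (w • basePt n l) H
    · have h1 := finLen_refl_mul hl hH h0 (not_sep_refl_mul h)
      rw [refl_refl_mul] at h1
      have e : (1 + qdiff * -T 1 : LaurentPolynomial ℤ) = -T 1 * -T 1 := by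
        have : (T (-1) * T 1 : LaurentPolynomial ℤ) = 1 := by rw [← T_add]; simp
        rw [qdiff]
        linear_combination -this
      rw [leftGen_std_down h, map_add, map_smul, antiProj_std, antiProj_std, h1,
        domRep_refl_mul hl h0, smul_smul, smul_smul, ← add_smul, pow_succ']
      congr 1
      linear_combination (-T 1 : LaurentPolynomial ℤ) ^ finLen (refl l H * w) * e
    · rw [leftGen_std_up h, antiProj_std, antiProj_std, finLen_refl_mul hl hH h0 h,
        domRep_refl_mul hl h0, smul_smul, pow_succ']
  induction x using Finsupp.induction_linear with
  | zero => simp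
  | add f g hf hg => rw [map_add, map_add, hf, hg, map_add, smul_add]
  | single w a =>
    rw [single_eq_smul_std, map_smul, map_smul, key, map_smul, smul_comm]

/-- Semilinear maps that preserve the kernel of the projection can be computed on the image. -/
theorem antiProj_comp (hl : 0 < l) {σ : LaurentPolynomial ℤ → LaurentPolynomial ℤ}
    (F : HeckeModule n l →+ HeckeModule n l) (hσ : ∀ a x, F (a • x) = σ a • F x)
    (hF : ∀ H, IsWall l H → val l H (-rho n) = 0 → ∀ x,
      antiProj hl (F (leftGen l H x + (T 1 : LaurentPolynomial ℤ) • x)) = 0)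
    (x : HeckeModule n l) : antiProj hl (F (antiProj hl x)) = antiProj hl (F x) := by
  have key : ∀ w : affineWeyl n l, antiProj hl (F (antiProj hl (std w))) =
      antiProj hl (F (std w)) := by
    intro w
    induction hk : len w using Nat.strong_induction_on generalizing w with
    | _ k ih =>
      by_cases h : DomAlcove w
      · rw [antiProj_of_dom hl h]
      · unfold DomAlcove at h
        push Not at h
        obtain ⟨K, hK, hs⟩ := h
        obtain ⟨H, hH, h0, hs⟩ := exists_simple_wall hl hK hs
        have hs' := not_sep_refl_mul hs
        have h2 := len_refl_mul hl hH hs'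
        have e := leftGen_std_up hs'
        rw [refl_refl_mul] at h2 e
        have h3 := ih _ (by omega) (refl l H * w) rfl
        have h4 := hF H hH h0 (std (refl l H * w))
        rw [e, map_add, map_add, hσ, map_smul] at h4
        have e2 : antiProj hl (std w) =
            -((T 1 : LaurentPolynomial ℤ) • antiProj hl (std (refl l H * w))) := by
          rw [← e, antiProj_leftGen hl hH h0, neg_smul]
        rw [e2, map_neg, map_neg, hσ, map_smul, h3]
        exact (eq_neg_of_add_eq_zero_left h4).symm
  induction x using Finsupp.induction_linear with
  | zero => simp
  | add f g hf hg => simp only [map_add, hf, hg]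
  | single w a =>
    rw [single_eq_smul_std, map_smul, hσ, hσ, map_smul, map_smul, key]

/-- `bar` descends to the quotient because it fixes the operator "generator plus q": the inverse
generator plus q⁻¹ is the generator plus q. -/
theorem antiProj_bar (hl : 0 < l) (x : HeckeModule n l) :
    antiProj hl (bar hl (antiProj hl x)) = antiProj hl (bar hl x) := by
  refine antiProj_comp hl (bar hl) (bar_smul hl) (fun H hH h0 x => ?_) x
  rw [map_add, bar_leftGen hl hH, bar_smul, invert_T, map_add, map_sub, antiProj_leftGen hl hH h0,
    map_smul, map_smul, qdiff]
  module

theorem antiProj_comm (hl : 0 < l) (R : Module.End (LaurentPolynomial ℤ) (HeckeModule n l))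
    (hR : ∀ H, IsWall l H → Commute (leftGen l H) R) (x : HeckeModule n l) :
    antiProj hl (R (antiProj hl x)) = antiProj hl (R x) := by
  refine antiProj_comp hl (σ := id) R.toAddMonoidHom (fun a x => R.map_smul a x)
    (fun H hH h0 x => ?_) x
  have e := LinearMap.congr_fun (hR H hH).eq x
  simp only [Module.End.mul_apply] at e
  change antiProj hl (R (leftGen l H x + (T 1 : LaurentPolynomial ℤ) • x)) = 0
  rw [map_add, ← e, map_add, antiProj_leftGen hl hH h0, map_smul, map_smul]
  module

/-- Laurent polynomials in `q ℤ[q]`. -/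
def IsPositive (a : LaurentPolynomial ℤ) : Prop :=
  ∃ f : Polynomial ℤ, a = Polynomial.toLaurent (Polynomial.X * f)

theorem IsPositive.coeff_eq_zero {a : LaurentPolynomial ℤ} (ha : IsPositive a) {k : ℤ}
    (hk : k ≤ 0) : a.coeff k = 0 := by
  obtain ⟨f, rfl⟩ := ha
  induction f using Polynomial.induction_on' with
  | add p q hp hq => rw [mul_add, map_add, AddMonoidAlgebra.coeff_add, Finsupp.add_apply, hp, hq,
      add_zero]
  | monomial m r =>
    rw [map_mul, Polynomial.toLaurent_X, Polynomial.toLaurent_C_mul_T, mul_left_comm, ← T_add,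
      ← single_eq_C_mul_T, AddMonoidAlgebra.coeff_single]
    exact Finsupp.single_eq_of_ne (by omega)

theorem IsPositive.zero : IsPositive 0 := ⟨0, by simp⟩

theorem IsPositive.add {a b : LaurentPolynomial ℤ} (ha : IsPositive a) (hb : IsPositive b) :
    IsPositive (a + b) := by
  obtain ⟨f, rfl⟩ := ha
  obtain ⟨g, rfl⟩ := hb
  exact ⟨f + g, by rw [mul_add, map_add]⟩

theorem IsPositive.neg {a : LaurentPolynomial ℤ} (ha : IsPositive a) : IsPositive (-a) := by
  obtain ⟨f, rfl⟩ := ha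
  exact ⟨-f, by rw [mul_neg, map_neg]⟩

theorem IsPositive.sub {a b : LaurentPolynomial ℤ} (ha : IsPositive a) (hb : IsPositive b) :
    IsPositive (a - b) := by
  rw [sub_eq_add_neg]; exact ha.add hb.neg

theorem IsPositive.T_mul {a : LaurentPolynomial ℤ} (ha : IsPositive a) (k : ℕ) :
    IsPositive (T (k : ℤ) * a) := by
  obtain ⟨f, rfl⟩ := ha
  refine ⟨Polynomial.X ^ k * f, ?_⟩
  rw [← Polynomial.toLaurent_X_pow, ← map_mul]
  congr 1
  ring

theorem IsPositive.eq_zero {a : LaurentPolynomial ℤ} (ha : IsPositive a) (h : invert a = a) :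
    a = 0 := by
  ext k
  rcases le_or_gt k 0 with hk | hk
  · rw [ha.coeff_eq_zero hk]; rfl
  · rw [← h, invert_apply, ha.coeff_eq_zero (by omega)]; rfl

/-- Self-dual elements of the antispherical module with coefficients in `q ℤ[q]` vanish. -/
theorem eq_zero_of_selfDual (hl : 0 < l) {x : HeckeModule n l} (hx : ∀ w, x w ≠ 0 → DomAlcove w)
    (hpos : ∀ w, IsPositive (x w)) (hbar : antiProj hl (bar hl x) = x) : x = 0 := by
  classical
  by_contra hne
  -- At an alcove of maximal length in the support, unitriangularity makes the coefficient invariant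
  -- under q ↦ q⁻¹, and an invariant element of qℤ[q] is zero.
  obtain ⟨w, hw, hmax⟩ := x.support.exists_max_image len (Finsupp.support_nonempty_iff.mpr hne)
  have hw' := Finsupp.mem_support_iff.mp hw
  apply hw'
  apply (hpos w).eq_zero
  have hstd : ∀ (v : affineWeyl n l) (y : HeckeModule n l), antiProj hl y v =
      ∑ u ∈ y.support, y u * antiProj hl (std u) v := by
    intro v y
    conv_lhs => rw [← Finsupp.sum_single y, Finsupp.sum, map_sum, Finsupp.finsetSum_apply]
    refine Finset.sum_congr rfl fun u _ => ?_
    rw [single_eq_smul_std, map_smul, Finsupp.smul_apply, smul_eq_mul]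
  -- The projection does not increase length, so `u` could contribute at `w` only with equal length;
  -- then `u` is dominant and is not moved.
  have hlow : ∀ u : affineWeyl n l, u ≠ w → len u ≤ len w → (len u = len w → DomAlcove u) →
      antiProj hl (std u) w = 0 := by
    intro u huw hu hd
    rw [antiProj_std, Finsupp.smul_apply, Finsupp.single_eq_of_ne, smul_zero]
    rintro rfl
    have h1 := len_domRep_le hl u
    exact huw (domRep_of_dom hl (hd (le_antisymm hu h1))).symm
  have hbw : ∀ v ∈ x.support, antiProj hl (barStd hl v) w = if v = w then 1 else 0 := by
    intro v hv
    have htri := barStd_triangular hl v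
    have hdv := hx v (Finsupp.mem_support_iff.mp hv)
    have hvle := hmax v hv
    rw [hstd]
    have h0 : ∀ u ∈ (barStd hl v).support, u ≠ v →
        barStd hl v u * antiProj hl (std u) w = 0 := by
      intro u hu huv
      have h1 := htri.2 u huv (Finsupp.mem_support_iff.mp hu)
      rw [hlow u (by rintro rfl; omega) (by omega) (by omega), mul_zero]
    rw [Finset.sum_eq_single v h0, htri.1, one_mul, antiProj_of_dom hl hdv, Finsupp.single_apply]
    intro hv'
    rw [Finsupp.notMem_support_iff.mp hv', zero_mul]
  have hsum : antiProj hl (bar hl x) w =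
      ∑ v ∈ x.support, invert (x v) * antiProj hl (barStd hl v) w := by
    conv_lhs => rw [← Finsupp.sum_single x, Finsupp.sum, map_sum, map_sum, Finsupp.finsetSum_apply]
    refine Finset.sum_congr rfl fun u _ => ?_
    rw [bar_single, map_smul, Finsupp.smul_apply, smul_eq_mul]
  rw [hbar, Finset.sum_congr rfl fun v hv => by rw [hbw v hv]] at hsum
  simpa [Finset.sum_ite_eq', hw', eq_comm] using hsum

end Antispherical

/-! ### The bar-invariant symmetrizer of a stabilizer and its Poincaré polynomial. -/

section Symmetrizer

variable {n l : ℕ}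

/-- An element is determined by the hyperplanes separating its alcove from the fundamental one; for
elements of the stabilizer these are among the finitely many through `y`. -/
theorem stabilizer_finite (hl : 0 < l) {y : WeightSpace n} (hy : y ∈ closedAlcove n l) :
    {g : affineWeyl n l | g • y = y}.Finite := by
  refine Set.Finite.of_injOn (f := fun g => {H | Sep l (basePt n l) (g • basePt n l) H})
    (t := {S | S ⊆ {H | val l H y = 0}}) ?_ ?_ (on_finite hl y).finite_subsets
  · intro g hg H hH
    have h1 : g • y = y := hg
    have := val_eq_zero_of_sep hy (by rwa [h1]) hH
    rwa [h1] at this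
  · intro g _ g' _ h
    have key : g⁻¹ * g' = 1 := by
      apply eq_one_of_not_sep hl
      intro H hs
      have h1 := sep_smul g (pull g⁻¹ H) (basePt n l) ((g⁻¹ * g') • basePt n l)
      rw [← pull_mul hl, inv_mul_cancel, pull_one hl, ← mul_smul, mul_inv_cancel_left] at h1
      have h2 := h1.mpr hs
      have h3 := Set.ext_iff.mp h (pull g⁻¹ H)
      simp only [Set.mem_ofPred_eq] at h3
      have h4 := val_smul_basePt_ne hl g (pull g⁻¹ H)
      have h5 := val_smul_basePt_ne hl g' (pull g⁻¹ H)
      have h6 := val_basePt_ne (n := n) hl (pull g⁻¹ H)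
      by_cases hs1 : Sep l (basePt n l) (g • basePt n l) (pull g⁻¹ H)
      · have hs2 := h3.mp hs1
        rw [Sep] at hs1 hs2 h2
        rcases mul_neg_iff.mp hs1 with ⟨ha, hb⟩ | ⟨ha, hb⟩ <;> nlinarith
      · have hs2 := mul_pos_of_not_sep hl (fun h => hs1 (h3.mpr h))
        replace hs1 := mul_pos_of_not_sep hl hs1
        rw [Sep] at h2
        rcases mul_pos_iff.mp hs1 with ⟨ha, hb⟩ | ⟨ha, hb⟩ <;> nlinarith
    rw [inv_mul_eq_one] at key
    exact key

/-- The stabilizer of a point of the closed alcove. -/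
noncomputable def stab (hl : 0 < l) {y : WeightSpace n} (hy : y ∈ closedAlcove n l) :
    Finset (affineWeyl n l) := (stabilizer_finite hl hy).toFinset

theorem mem_stab (hl : 0 < l) {y : WeightSpace n} (hy : y ∈ closedAlcove n l)
    {g : affineWeyl n l} : g ∈ stab hl hy ↔ g • y = y := by
  simp [stab]

theorem sum_stab_mul_left {M : Type*} [AddCommMonoid M] (hl : 0 < l) {y : WeightSpace n}
    (hy : y ∈ closedAlcove n l) {h : affineWeyl n l} (hh : h • y = y) (f : affineWeyl n l → M) :
    ∑ g ∈ stab hl hy, f (h * g) = ∑ g ∈ stab hl hy, f g := by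
  refine Finset.sum_nbij' (fun g => h * g) (fun g => h⁻¹ * g) ?_ ?_ ?_ ?_ ?_
  · intro g hg
    rw [mem_stab] at hg ⊢
    rw [mul_smul, hg, hh]
  · intro g hg
    rw [mem_stab] at hg ⊢
    rw [mul_smul, hg, inv_smul_eq_iff, hh]
  · intro g _; rw [inv_mul_cancel_left]
  · intro g _; rw [mul_inv_cancel_left]
  · intro g _; rfl

/-- The number of hyperplanes through `w • y` that separate the alcove of `w` from the fundamental
alcove. -/
noncomputable def oLen (y : WeightSpace n) (w : affineWeyl n l) : ℕ :=
  sepCount l (fun H => val l H (w • y) = 0) (w • basePt n l)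

theorem oLen_refl_mul_of_ne (hl : 0 < l) {y : WeightSpace n} {w : affineWeyl n l}
    {H : Hyperplane n} (hH : IsWall l H) (h : val l H (w • y) ≠ 0) :
    oLen y (refl l H * w) = oLen y w := by
  rw [oLen, mul_smul, mul_smul, refl_smul (x := w • basePt n l)]
  exact sepCount_reflect_of_not hl hH (Q := fun K => val l K (w • y) = 0)
    (fun K => val_smul_eq_zero _ _ _) (Or.inl h)

theorem oLen_refl_mul_up (hl : 0 < l) {y : WeightSpace n} {w : affineWeyl n l}
    {H : Hyperplane n} (hH : IsWall l H) (h : val l H (w • y) = 0)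
    (hs : ¬ Sep l (basePt n l) (w • basePt n l) H) :
    oLen y (refl l H * w) = oLen y w + 1 := by
  rw [oLen, mul_smul, mul_smul, refl_smul (x := w • basePt n l)]
  exact sepCount_reflect_up hl hH (Q := fun K => val l K (w • y) = 0)
    (fun K => val_smul_eq_zero _ _ _) h (mul_pos_of_not_sep hl hs)

theorem oLen_one (y : WeightSpace n) : oLen y (1 : affineWeyl n l) = 0 := by
  rw [oLen, sepCount]
  convert Set.ncard_empty (Hyperplane n)
  ext H
  simp only [Set.mem_ofPred_eq, Set.mem_empty_iff_false, iff_false, not_and, one_smul]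
  exact fun _ => basePt_mem_closedAlcove H

/-- The number of hyperplanes through `y`. -/
noncomputable def onNum (l : ℕ) (y : WeightSpace n) : ℕ := {H : Hyperplane n | val l H y = 0}.ncard

theorem len_le_onNum (hl : 0 < l) {y : WeightSpace n} (hy : y ∈ closedAlcove n l)
    {g : affineWeyl n l} (hg : g • y = y) : len g ≤ onNum l y := by
  refine Set.ncard_le_ncard (fun H hH => ?_) (on_finite hl y)
  have := val_eq_zero_of_sep hy (by rwa [hg]) hH.2
  rwa [hg] at this

/-- The weighted sum of the alcoves around `w • y`. -/
noncomputable def symStd (hl : 0 < l) {y : WeightSpace n} (hy : y ∈ closedAlcove n l)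
    (w : affineWeyl n l) : HeckeModule n l :=
  ∑ g ∈ stab hl hy, (T (-(oLen y (w * g) : ℤ)) : LaurentPolynomial ℤ) • std (w * g)

theorem symStd_mul (hl : 0 < l) {y : WeightSpace n} (hy : y ∈ closedAlcove n l)
    (w : affineWeyl n l) {h : affineWeyl n l} (hh : h • y = y) :
    symStd hl hy (w * h) = symStd hl hy w := by
  simp only [symStd, mul_assoc]
  exact sum_stab_mul_left hl hy hh
    fun g => (T (-(oLen y (w * g) : ℤ)) : LaurentPolynomial ℤ) • std (w * g)

theorem conj_refl_smul {y : WeightSpace n} {w : affineWeyl n l} {H : Hyperplane n}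
    (h : val l H (w • y) = 0) : (w⁻¹ * refl l H * w) • y = y := by
  rw [mul_smul, mul_smul, refl_smul, reflect_eq_self l h, inv_smul_smul]

/-- Both alcoves have `w • y` in their closure, so they lie on the same side of any hyperplane that
avoids this point. -/
theorem sep_mul_iff_of_ne (hl : 0 < l) {y : WeightSpace n} (hy : y ∈ closedAlcove n l)
    {w g : affineWeyl n l} {H : Hyperplane n} (h : val l H (w • y) ≠ 0) (hg : g • y = y) :
    Sep l (basePt n l) ((w * g) • basePt n l) H ↔ Sep l (basePt n l) (w • basePt n l) H := by
  have h1 := smul_nonneg_of_mem hy w H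
  have h2 := smul_nonneg_of_mem hy (w * g) H
  rw [mul_smul w g y, hg] at h2
  have h3 := val_smul_basePt_ne hl w H
  have h4 := val_smul_basePt_ne hl (w * g) H
  rw [sep_comm, sep_comm (x := basePt n l)]
  apply sep_iff_of_pos
  refine lt_of_le_of_ne ?_ (mul_ne_zero h3 h4).symm
  rcases lt_or_gt_of_ne h with h | h
  · exact mul_nonneg_of_nonpos_of_nonpos (nonpos_of_mul_nonneg_left h1 h)
      (nonpos_of_mul_nonneg_left h2 h)
  · exact mul_nonneg (nonneg_of_mul_nonneg_left h1 h) (nonneg_of_mul_nonneg_left h2 h)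

theorem leftGen_symStd_of_ne (hl : 0 < l) {y : WeightSpace n} (hy : y ∈ closedAlcove n l)
    {w : affineWeyl n l} {H : Hyperplane n} (hH : IsWall l H) (h : val l H (w • y) ≠ 0) :
    leftGen l H (symStd hl hy w) = symStd hl hy (refl l H * w) +
      (open Classical in if Sep l (basePt n l) (w • basePt n l) H then qdiff else 0) •
        symStd hl hy w := by
  classical
  simp only [symStd, map_sum, map_smul, Finset.smul_sum]
  rw [← Finset.sum_add_distrib]
  refine Finset.sum_congr rfl fun g hg => ?_
  rw [mem_stab] at hg
  have h' : val l H ((w * g) • y) ≠ 0 := by rwa [mul_smul, hg]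
  rw [mul_assoc, oLen_refl_mul_of_ne hl hH h']
  have e := sep_mul_iff_of_ne hl hy h hg
  by_cases hs : Sep l (basePt n l) (w • basePt n l) H
  · rw [leftGen_std_down (e.mpr hs), if_pos hs]
    module
  · rw [leftGen_std_up (mt e.mp hs), if_neg hs]
    module

/-- Reflection in `H` permutes the alcoves around `w • y` in pairs whose weights differ by the
factor q⁻¹, and each such pair is an eigenvector of the generator. -/
theorem leftGen_symStd_of_eq (hl : 0 < l) {y : WeightSpace n} (hy : y ∈ closedAlcove n l)
    {w : affineWeyl n l} {H : Hyperplane n} (hH : IsWall l H) (h : val l H (w • y) = 0) :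
    leftGen l H (symStd hl hy w) = (T (-1) : LaurentPolynomial ℤ) • symStd hl hy w := by
  classical
  have e1 : ∑ g ∈ stab hl hy,
      (T (-(oLen y (w * g) : ℤ)) : LaurentPolynomial ℤ) • std (refl l H * (w * g)) =
      ∑ g ∈ stab hl hy,
        (T (-(oLen y (refl l H * (w * g)) : ℤ)) : LaurentPolynomial ℤ) • std (w * g) := by
    rw [← sum_stab_mul_left hl hy (conj_refl_smul h)]
    refine Finset.sum_congr rfl fun g _ => ?_
    have : w * (w⁻¹ * refl l H * w * g) = refl l H * (w * g) := by group
    rw [this, refl_refl_mul]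
  have e2 : leftGen l H (symStd hl hy w) = ∑ g ∈ stab hl hy,
      ((T (-(oLen y (w * g) : ℤ)) : LaurentPolynomial ℤ) • std (refl l H * (w * g)) +
      ((if Sep l (basePt n l) ((w * g) • basePt n l) H then qdiff else 0) *
        T (-(oLen y (w * g) : ℤ))) • std (w * g)) := by
    simp only [symStd, map_sum, map_smul]
    refine Finset.sum_congr rfl fun g _ => ?_
    by_cases hs : Sep l (basePt n l) ((w * g) • basePt n l) H
    · rw [leftGen_std_down hs, if_pos hs]; module
    · rw [leftGen_std_up hs, if_neg hs]; module
  rw [e2, Finset.sum_add_distrib, e1, ← Finset.sum_add_distrib, symStd, Finset.smul_sum]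
  refine Finset.sum_congr rfl fun g hg => ?_
  rw [mem_stab] at hg
  have h' : val l H ((w * g) • y) = 0 := by rwa [mul_smul, hg]
  rw [← add_smul, smul_smul]
  congr 1
  by_cases hs : Sep l (basePt n l) ((w * g) • basePt n l) H
  · have h0 : val l H ((refl l H * (w * g)) • y) = 0 := by
      rw [mul_smul, refl_smul, val_reflect_self, h', neg_zero]
    have h1 := oLen_refl_mul_up hl hH h0 (not_sep_refl_mul hs)
    rw [refl_refl_mul] at h1
    rw [if_pos hs, h1, qdiff, sub_mul, ← T_add, ← T_add]
    push_cast
    ring_nf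
  · rw [if_neg hs, oLen_refl_mul_up hl hH h' hs, zero_mul, add_zero, ← T_add]
    push_cast
    ring_nf

/-- Right multiplication by the self-dual element of the stabilizer of `y`. On dominant alcoves
this is translation onto the orbit of `y` followed by translation out of it. -/
noncomputable def symm (hl : 0 < l) {y : WeightSpace n} (hy : y ∈ closedAlcove n l) :
    Module.End (LaurentPolynomial ℤ) (HeckeModule n l) :=
  Finsupp.linearCombination (LaurentPolynomial ℤ) fun w =>
    (T ((onNum l y : ℤ) - oLen y w) : LaurentPolynomial ℤ) • symStd hl hy w

theorem symm_std (hl : 0 < l) {y : WeightSpace n} (hy : y ∈ closedAlcove n l)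
    (w : affineWeyl n l) : symm hl hy (std w) =
      (T ((onNum l y : ℤ) - oLen y w) : LaurentPolynomial ℤ) • symStd hl hy w := by
  rw [symm, Finsupp.linearCombination_single, one_smul]

theorem leftGen_symm_of_eq (hl : 0 < l) {y : WeightSpace n} (hy : y ∈ closedAlcove n l)
    {w : affineWeyl n l} {H : Hyperplane n} (hH : IsWall l H) (h : val l H (w • y) = 0) :
    leftGen l H (symm hl hy (std w)) =
      (T (-1) : LaurentPolynomial ℤ) • symm hl hy (std w) := by
  rw [symm_std, map_smul, leftGen_symStd_of_eq hl hy hH h, smul_comm]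

/-- If `w • y` is off `H`, nothing counted by `oLen` changes. If it is on `H`, all terms are
multiples of the one eigenvector `symStd hl hy w`, and only powers of q have to be compared. -/
theorem leftGen_symm_comm (hl : 0 < l) {y : WeightSpace n} (hy : y ∈ closedAlcove n l)
    {H : Hyperplane n} (hH : IsWall l H) : Commute (leftGen l H) (symm hl hy) := by
  refine end_ext fun w => ?_
  simp only [Module.End.mul_apply]
  by_cases h : val l H (w • y) = 0
  · have e : symStd hl hy (refl l H * w) = symStd hl hy w := by
      have : refl l H * w = w * (w⁻¹ * refl l H * w) := by group
      rw [this, symStd_mul hl hy w (conj_refl_smul h)]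
    rw [leftGen_symm_of_eq hl hy hH h]
    by_cases hs : Sep l (basePt n l) (w • basePt n l) H
    · have h0 : val l H ((refl l H * w) • y) = 0 := by
        rw [mul_smul, refl_smul, val_reflect_self, h, neg_zero]
      have h1 := oLen_refl_mul_up hl hH h0 (not_sep_refl_mul hs)
      rw [refl_refl_mul] at h1
      rw [leftGen_std_down hs, map_add, map_smul, symm_std, symm_std, e, h1, smul_smul, smul_smul,
        ← add_smul, qdiff, sub_mul, ← T_add, ← T_add]
      congr 1
      push_cast
      ring_nf
    · rw [leftGen_std_up hs, symm_std, symm_std, e, oLen_refl_mul_up hl hH h hs, smul_smul,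
        ← T_add]
      congr 2
      push_cast
      ring_nf
  · rw [symm_std, map_smul, leftGen_symStd_of_ne hl hy hH h]
    by_cases hs : Sep l (basePt n l) (w • basePt n l) H
    · rw [leftGen_std_down hs, map_add, map_smul, symm_std, symm_std,
        oLen_refl_mul_of_ne hl hH h, if_pos hs]
      module
    · rw [leftGen_std_up hs, symm_std, oLen_refl_mul_of_ne hl hH h, if_neg hs]
      module

theorem symStd_apply (hl : 0 < l) {y : WeightSpace n} (hy : y ∈ closedAlcove n l)
    (w v : affineWeyl n l) : symStd hl hy w v =
      open Classical in if (w⁻¹ * v) • y = y then T (-(oLen y v : ℤ)) else 0 := by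
  classical
  rw [symStd, Finsupp.finsetSum_apply]
  split_ifs with h
  · rw [Finset.sum_eq_single (w⁻¹ * v)]
    · simp
    · intro g _ hg
      rw [Finsupp.smul_apply, Finsupp.single_eq_of_ne, smul_zero]
      rintro rfl
      simp at hg
    · intro h'
      exact absurd ((mem_stab hl hy).mpr h) h'
  · refine Finset.sum_eq_zero fun g hg => ?_
    rw [Finsupp.smul_apply, Finsupp.single_eq_of_ne, smul_zero]
    rintro rfl
    apply h
    rw [inv_mul_cancel_left]
    exact (mem_stab hl hy).mp hg

theorem leftGen_apply_support {y : WeightSpace n} {H : Hyperplane n} (h : val l H y = 0)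
    {x : HeckeModule n l} (hx : ∀ v : affineWeyl n l, x v ≠ 0 → v • y = y) :
    ∀ v : affineWeyl n l, leftGen l H x v ≠ 0 → v • y = y := by
  intro v hv
  by_contra hc
  apply hv
  apply leftGen_apply_eq_zero
  · by_contra hc'
    have h1 := hx _ hc'
    rw [mul_smul, ← eq_inv_smul_iff, refl_inv, refl_smul (x := y), reflect_eq_self l h] at h1
    exact hc h1
  · by_contra hc'
    exact hc (hx v hc')

/-- `bar` preserves the parabolic subalgebra of the stabilizer, since reduced expressions stay
inside the stabilizer. -/
theorem barStd_support (hl : 0 < l) {y : WeightSpace n} (hy : y ∈ closedAlcove n l)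
    {g : affineWeyl n l} (hg : g • y = y) :
    ∀ v : affineWeyl n l, barStd hl g v ≠ 0 → v • y = y := by
  refine stabilizer_induction hl hy
    (P := fun g => ∀ v : affineWeyl n l, barStd hl g v ≠ 0 → v • y = y) ?_ ?_ g hg
  · intro v hv
    rw [barStd_one] at hv
    by_cases h : v = 1
    · rw [h, one_smul]
    · exact absurd (Finsupp.single_eq_of_ne h) hv
  · intro H g hH h0 _ hs ih v hv
    rw [barStd_refl_mul hl hH hs, leftUnit_inv_apply, Finsupp.sub_apply, Finsupp.smul_apply] at hv
    by_cases h1 : barStd hl g v = 0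
    · rw [h1, smul_zero, sub_zero] at hv
      exact leftGen_apply_support h0 ih v hv
    · exact ih v h1

/-- A common eigenvector of the generators of the stabilizer is determined on the stabilizer by one
coefficient. -/
theorem apply_eq_of_leftGen (hl : 0 < l) {y : WeightSpace n} (hy : y ∈ closedAlcove n l)
    {x : HeckeModule n l}
    (hx : ∀ H, IsWall l H → val l H y = 0 → leftGen l H x = (T (-1) : LaurentPolynomial ℤ) • x)
    {g : affineWeyl n l} (hg : g • y = y) : x g = T (-(len g : ℤ)) * x 1 := by
  refine stabilizer_induction hl hy
    (P := fun g => x g = T (-(len g : ℤ)) * x 1) ?_ ?_ g hg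
  · have : len (1 : affineWeyl n l) = 0 := by
      rw [len, sepCount]
      convert Set.ncard_empty (Hyperplane n)
      ext H
      simp only [Set.mem_ofPred_eq, Set.mem_empty_iff_false, iff_false, not_and, one_smul]
      exact fun _ => basePt_mem_closedAlcove H
    simp [this]
  · intro H g hH h0 _ hs ih
    have h1 := leftGen_apply_of_not_sep (x := x) hs
    rw [hx H hH h0, Finsupp.smul_apply, smul_eq_mul, ih, ← mul_assoc, ← T_add] at h1
    rw [← h1, len_refl_mul hl hH hs]
    push_cast
    ring_nf

/-- The element and its image under `bar` are common eigenvectors with eigenvalue q⁻¹ in the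
parabolic subalgebra, hence determined by one coefficient. At the longest element both coefficients
are 1, by the normalization of `symm` and by unitriangularity. -/
theorem bar_symm_one (hl : 0 < l) {y : WeightSpace n} (hy : y ∈ closedAlcove n l) :
    bar hl (symm hl hy (std 1)) = symm hl hy (std 1) := by
  classical
  set c := symm hl hy (std 1) with hc
  have hcv : ∀ v, c v = if v • y = y then T ((onNum l y : ℤ) - oLen y v) else 0 := by
    intro v
    rw [hc, symm_std, Finsupp.smul_apply, symStd_apply, oLen_one, inv_one, one_mul]
    split_ifs
    · rw [smul_eq_mul, ← T_add]; congr 1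
    · rw [smul_zero]
  have hsupp : ∀ v, c v ≠ 0 → v • y = y := by
    intro v hv
    rw [hcv] at hv
    by_contra h
    simp [h] at hv
  have hcl : ∀ H, IsWall l H → val l H y = 0 →
      leftGen l H c = (T (-1) : LaurentPolynomial ℤ) • c := fun H hH h0 =>
    leftGen_symm_of_eq hl hy hH (by rwa [one_smul])
  have hbl : ∀ H, IsWall l H → val l H y = 0 →
      leftGen l H (bar hl c) = (T (-1) : LaurentPolynomial ℤ) • bar hl c := by
    intro H hH h0
    have h1 := bar_leftGen hl hH c
    rw [hcl H hH h0, bar_smul, invert_T, neg_neg, eq_sub_iff_add_eq, ← add_smul, qdiff] at h1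
    rw [← h1]
    congr 1
    ring
  have hbsum : ∀ v, bar hl c v = ∑ u ∈ c.support, invert (c u) * barStd hl u v := by
    intro v
    conv_lhs => rw [← Finsupp.sum_single c, Finsupp.sum, map_sum, Finsupp.finsetSum_apply]
    refine Finset.sum_congr rfl fun u _ => ?_
    rw [bar_single, Finsupp.smul_apply, smul_eq_mul]
  have hbs : ∀ v, bar hl c v ≠ 0 → v • y = y := by
    intro v hv
    rw [hbsum] at hv
    obtain ⟨u, hu, hne⟩ := Finset.exists_ne_zero_of_sum_ne_zero hv
    exact barStd_support hl hy (hsupp u (Finsupp.mem_support_iff.mp hu)) v (right_ne_zero_of_mul hne)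
  obtain ⟨g, hg, hlong⟩ := exists_longest hl hy
  have hlen : len g = onNum l y := by
    refine le_antisymm (len_le_onNum hl hy hg) ?_
    exact Set.ncard_le_ncard (fun H hH => ⟨trivial, hlong H hH⟩) (sepSet_finite hl _ _ _)
  have ho : oLen y g = onNum l y := by
    rw [oLen, sepCount, onNum, hg]
    congr 1
    ext H
    exact ⟨fun h => h.1, fun h => ⟨h, hlong H h⟩⟩
  have hcg : c g = 1 := by rw [hcv, if_pos hg, ho, sub_self, T_zero]
  have hbg : bar hl c g = 1 := by
    rw [hbsum, Finset.sum_eq_single g]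
    · rw [hcg, (barStd_triangular hl g).1, map_one, one_mul]
    · intro u hu hug
      by_contra hne
      have h1 := (barStd_triangular hl u).2 g hug.symm (right_ne_zero_of_mul hne)
      have h2 := len_le_onNum hl hy (hsupp u (Finsupp.mem_support_iff.mp hu))
      omega
    · intro h
      rw [Finsupp.notMem_support_iff.mp h] at hcg
      exact absurd hcg zero_ne_one
  have h1 : bar hl c 1 = c 1 := by
    have e1 := apply_eq_of_leftGen hl hy hbl hg
    have e2 := apply_eq_of_leftGen hl hy hcl hg
    rw [hbg] at e1
    rw [hcg, e1] at e2
    exact (isUnit_T _).mul_left_cancel e2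
  ext1 v
  by_cases hv : v • y = y
  · rw [apply_eq_of_leftGen hl hy hbl hv, apply_eq_of_leftGen hl hy hcl hv, h1]
  · rw [not_imp_comm.mp (hbs v) hv, not_imp_comm.mp (hsupp v) hv]

theorem bar_symm (hl : 0 < l) {y : WeightSpace n} (hy : y ∈ closedAlcove n l)
    (x : HeckeModule n l) : bar hl (symm hl hy x) = symm hl hy (bar hl x) := by
  have key : ∀ w : affineWeyl n l, bar hl (symm hl hy (std w)) = symm hl hy (bar hl (std w)) := by
    intro w
    induction w using len_induction hl with
    | one => rw [bar_symm_one, bar_std, barStd_one]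
    | step H w hH hs ih =>
      have e1 := LinearMap.congr_fun (leftGen_symm_comm hl hy hH).eq (std w)
      have e2 := LinearMap.congr_fun (leftGen_symm_comm hl hy hH).eq (bar hl (std w))
      simp only [Module.End.mul_apply] at e1 e2
      rw [← leftGen_std_up hs, ← e1, bar_leftGen hl hH, bar_leftGen hl hH, ih, map_sub, map_smul,
        e2]
  induction x using Finsupp.induction_linear with
  | zero => simp
  | add f g hf hg => simp only [map_add, hf, hg]
  | single w a => rw [single_eq_smul_std, map_smul, bar_smul, key, bar_smul, map_smul]

/-- The Poincaré polynomial of the stabilizer of `y`, normalized to be self-dual. -/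
noncomputable def poincare (hl : 0 < l) {y : WeightSpace n} (hy : y ∈ closedAlcove n l) :
    LaurentPolynomial ℤ :=
  ∑ g ∈ stab hl hy, T ((onNum l y : ℤ) - 2 * oLen y g)

/-- Crossing a wall through `w • y` permutes the alcoves around this point; crossing any other wall
leaves each exponent unchanged. -/
theorem sum_oLen_eq_poincare (hl : 0 < l) {y : WeightSpace n} (hy : y ∈ closedAlcove n l)
    (w : affineWeyl n l) :
    ∑ g ∈ stab hl hy, (T ((onNum l y : ℤ) - 2 * oLen y (w * g)) : LaurentPolynomial ℤ) =
      poincare hl hy := by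
  induction w using len_induction hl with
  | one => simp [poincare]
  | step H w hH _ ih =>
    rw [← ih]
    by_cases h : val l H (w • y) = 0
    · rw [← sum_stab_mul_left hl hy (conj_refl_smul h)]
      refine Finset.sum_congr rfl fun g _ => ?_
      have : w * (w⁻¹ * refl l H * w * g) = refl l H * w * g := by group
      have e : refl l H * w * (w⁻¹ * refl l H * w * g) = w * g := by
        rw [mul_assoc (refl l H), this, mul_assoc, refl_refl_mul]
      rw [e]
    · refine Finset.sum_congr rfl fun g hg => ?_
      rw [mem_stab] at hg
      rw [mul_assoc, oLen_refl_mul_of_ne hl hH (by rwa [mul_smul, hg])]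

end Symmetrizer

/-! ### Lifting patterns, and explicit formulas for the translation operators. -/

section Translation

variable {n l : ℕ}

theorem symm_symm (hl : 0 < l) {y : WeightSpace n} (hy : y ∈ closedAlcove n l)
    (w : affineWeyl n l) :
    symm hl hy (symm hl hy (std w)) = poincare hl hy • symm hl hy (std w) := by
  have : symm hl hy (symStd hl hy w) = poincare hl hy • symStd hl hy w := by
    rw [← sum_oLen_eq_poincare hl hy w, Finset.sum_smul]
    conv_lhs => rw [symStd, map_sum]
    refine Finset.sum_congr rfl fun g hg => ?_
    rw [map_smul, symm_std, symStd_mul hl hy w ((mem_stab hl hy).mp hg), smul_smul, ← T_add]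
    congr 2
    ring
  rw [symm_std, map_smul, this, smul_comm]

theorem symm_apply (hl : 0 < l) {y : WeightSpace n} (hy : y ∈ closedAlcove n l)
    (x : HeckeModule n l) (v : affineWeyl n l) : symm hl hy x v =
      T (-(oLen y v : ℤ)) *
        ∑ g ∈ stab hl hy, T ((onNum l y : ℤ) - oLen y (v * g)) * x (v * g) := by
  classical
  induction x using Finsupp.induction_linear with
  | zero => simp
  | add f g hf hg =>
    rw [map_add, Finsupp.add_apply, hf, hg, ← mul_add, ← Finset.sum_add_distrib]
    congr 1
    exact Finset.sum_congr rfl fun g _ => by rw [Finsupp.add_apply, mul_add]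
  | single w a =>
    rw [single_eq_smul_std, map_smul, symm_std, Finsupp.smul_apply, Finsupp.smul_apply,
      symStd_apply, smul_eq_mul, smul_eq_mul]
    have hiff : (w⁻¹ * v) • y = y ↔ v⁻¹ * w ∈ stab hl hy := by
      rw [mem_stab, mul_smul, mul_smul, inv_smul_eq_iff, inv_smul_eq_iff, eq_comm]
    split_ifs with h
    · rw [Finset.sum_eq_single (v⁻¹ * w)]
      · rw [mul_inv_cancel_left, Finsupp.smul_apply, Finsupp.single_eq_same, smul_eq_mul]
        ring
      · intro g _ hg
        rw [Finsupp.smul_apply, Finsupp.single_eq_of_ne, smul_zero, mul_zero]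
        rintro rfl
        simp at hg
      · intro h'
        exact absurd (hiff.mp h) h'
    · rw [Finset.sum_eq_zero, mul_zero, mul_zero, mul_zero]
      intro g hg
      rw [Finsupp.smul_apply, Finsupp.single_eq_of_ne, smul_zero, mul_zero]
      rintro rfl
      exact h (hiff.mpr (by rwa [inv_mul_cancel_left]))

theorem symm_one_apply_longest (hl : 0 < l) {y : WeightSpace n} (hy : y ∈ closedAlcove n l) :
    ∃ v, symm hl hy (std 1) v = 1 := by
  obtain ⟨g, hg, hlong⟩ := exists_longest hl hy
  have ho : oLen y g = onNum l y := by
    rw [oLen, sepCount, onNum, hg]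
    congr 1
    ext H
    exact ⟨fun h => h.1, fun h => ⟨h, hlong H h⟩⟩
  refine ⟨g, ?_⟩
  rw [symm_std, Finsupp.smul_apply, symStd_apply, oLen_one, inv_one, one_mul, if_pos hg, ho,
    smul_eq_mul, ← T_add]
  simp

/-- Apply `bar` to the relation `symm_symm` at the identity, and compare coefficients where the
self-dual element has coefficient 1. -/
theorem invert_poincare (hl : 0 < l) {y : WeightSpace n} (hy : y ∈ closedAlcove n l) :
    invert (poincare hl hy) = poincare hl hy := by
  have h := congrArg (bar hl) (symm_symm hl hy 1)
  rw [bar_symm, bar_symm_one, symm_symm, bar_smul, bar_symm_one] at h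
  obtain ⟨v, hv⟩ := symm_one_apply_longest hl hy
  have h2 := DFunLike.congr_fun h v
  rw [Finsupp.smul_apply, Finsupp.smul_apply, hv, smul_eq_mul, smul_eq_mul, mul_one, mul_one] at h2
  exact h2.symm

/-- All coefficients are nonnegative and the identity contributes a monomial, so nothing cancels. -/
theorem poincare_ne_zero (hl : 0 < l) {y : WeightSpace n} (hy : y ∈ closedAlcove n l) :
    poincare hl hy ≠ 0 := by
  classical
  intro h
  have h1 : (poincare hl hy).coeff (onNum l y) = 0 := by rw [h]; rfl
  rw [poincare, AddMonoidAlgebra.coeff_sum, Finsupp.finsetSum_apply] at h1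
  have h2 := (Finset.sum_eq_zero_iff_of_nonneg (fun g _ => ?_)).mp h1 1
    ((mem_stab hl hy).mpr (one_smul _ _))
  · rw [T_apply, oLen_one] at h2
    simp at h2
  · rw [T_apply]
    split_ifs <;> simp

theorem pos_level_iff {x : WeightSpace n} :
    x ∈ realDominant n ↔ ∀ α : PosRoot n, 0 < val l (α, 0) x := by
  simp [realDominant, val]

theorem pos_of_dominant (hl : 0 < l) {x : WeightSpace n} (hx : x ∈ realDominant n)
    {H : Hyperplane n} (h : val l H x = 0) : 0 < H.2 := by
  have h1 := hx H.1
  have hl' : (0 : ℝ) < l := by exact_mod_cast hl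
  have h2 : level x H.1 - H.2 * l = 0 := h
  have h3 : (0 : ℝ) < H.2 * l := by linarith
  exact_mod_cast pos_of_mul_pos_left h3 hl'.le

theorem domAlcove_of_dominant (hl : 0 < l) {y : WeightSpace n} (hy : y ∈ closedAlcove n l)
    {w : affineWeyl n l} (h : w • y ∈ realDominant n) : DomAlcove w := by
  rintro ⟨α, k⟩ hk
  obtain rfl : k = 0 := (val_neg_rho_eq_zero hl).mp hk
  have h1 := (pos_level_iff (l := l)).mp h α
  have h2 := smul_nonneg_of_mem hy w (α, 0)
  have h3 := val_basePt_pos (n := n) hl (H := (α, 0)) le_rfl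
  exact not_lt.mpr (mul_nonneg h3.le (nonneg_of_mul_nonneg_left h2 h1))

/-- Such a `w • y` lies on a simple wall through `-ρ`. The generator of that wall has eigenvalue q⁻¹
on the symmetrized element but acts as -q after projection, and q + q⁻¹ is not a zero divisor. This
accounts for the convention that non-dominant weights are 0. -/
theorem antiProj_symm_of_not_dominant (hl : 0 < l) {y : WeightSpace n}
    (hy : y ∈ closedAlcove n l) {w : affineWeyl n l} (hw : DomAlcove w)
    (h : w • y ∉ realDominant n) : antiProj hl (symm hl hy (std w)) = 0 := by
  have hnn : ∀ α : PosRoot n, 0 ≤ level (w • y) α := by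
    intro α
    have h1 := smul_nonneg_of_mem hy w (α, 0)
    have h2 := hw (α, 0) ((val_neg_rho_eq_zero hl).mpr rfl)
    have h3 := val_basePt_pos (n := n) hl (H := (α, 0)) le_rfl
    have h4 := pos_of_mul_pos_right (mul_pos_of_not_sep hl h2) h3.le
    have h5 := nonneg_of_mul_nonneg_right h1 h4
    simpa [val] using h5
  have hanti : Antitone (coord (w • y)) := coord_antitone_of_simple fun α _ => hnn α
  simp only [realDominant, Set.mem_ofPred_eq, not_forall, not_lt] at h
  obtain ⟨⟨⟨i, j⟩, hij⟩, hα⟩ := h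
  have hij' : (i : ℕ) < j := hij
  have hj := j.isLt
  rw [level_eq] at hα
  dsimp only at hα
  set i' : Fin (n + 1) := ⟨i + 1, by omega⟩ with hi'
  have hlt : i < i' := Fin.lt_def.mpr (by simp [hi'])
  have hle : i' ≤ j := Fin.le_def.mpr (by simp only [hi']; omega)
  have h0 : val l (⟨(i, i'), hlt⟩, 0) (w • y) = 0 := by
    have h1 := hanti hlt.le
    have h2 := hanti hle
    simp only [val, level_eq, Int.cast_zero, zero_mul, sub_zero]
    linarith
  have hwall : IsWall l ((⟨(i, i'), hlt⟩, 0) : Hyperplane n) := isWall_simple hl _ (by simp [hi'])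
  have e := leftGen_symm_of_eq hl hy hwall h0
  have e2 := congrArg (antiProj hl) e
  rw [antiProj_leftGen hl hwall ((val_neg_rho_eq_zero hl).mpr rfl), map_smul] at e2
  have e3 : (T (-1) + T 1 : LaurentPolynomial ℤ) • antiProj hl (symm hl hy (std w)) = 0 := by
    rw [add_smul, ← e2, neg_smul, neg_add_cancel]
  refine (smul_eq_zero.mp e3).resolve_left fun h => ?_
  have := congrArg (fun a : LaurentPolynomial ℤ => a.coeff 1) h
  simp only [AddMonoidAlgebra.coeff_add, Finsupp.add_apply, T_apply] at this
  norm_num at this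

theorem antiProj_symm_apply (hl : 0 < l) {y : WeightSpace n} (hy : y ∈ closedAlcove n l)
    {x : HeckeModule n l} (hx : ∀ w, x w ≠ 0 → DomAlcove w) (v : affineWeyl n l) :
    antiProj hl (symm hl hy x) v =
      open Classical in if v • y ∈ realDominant n then symm hl hy x v else 0 := by
  classical
  have key : ∀ w, DomAlcove w → antiProj hl (symm hl hy (std w)) v =
      if v • y ∈ realDominant n then symm hl hy (std w) v else 0 := by
    intro w hw
    have hv : symm hl hy (std w) v ≠ 0 → v • y = w • y := by
      intro h
      rw [symm_std, Finsupp.smul_apply, symStd_apply] at h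
      by_contra hc
      rw [if_neg, smul_zero] at h
      · exact h rfl
      · rwa [mul_smul, inv_smul_eq_iff]
    by_cases h : w • y ∈ realDominant n
    · have : antiProj hl (symm hl hy (std w)) = symm hl hy (std w) := by
        refine antiProj_of_supp hl fun u hu => ?_
        have hu' : u • y = w • y := by
          by_contra hc
          rw [symm_std, Finsupp.smul_apply, symStd_apply, if_neg, smul_zero] at hu
          · exact hu rfl
          · rwa [mul_smul, inv_smul_eq_iff]
        exact domAlcove_of_dominant hl hy (hu' ▸ h)
      rw [this]
      split_ifs with h2
      · rfl
      · by_contra hc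
        exact h2 (hv hc ▸ h)
    · rw [antiProj_symm_of_not_dominant hl hy hw h]
      split_ifs with h2
      · symm
        by_contra hc
        exact h (hv hc ▸ h2)
      · rfl
  have hsum : ∀ F : Module.End (LaurentPolynomial ℤ) (HeckeModule n l),
      F x v = ∑ w ∈ x.support, x w * F (std w) v := by
    intro F
    conv_lhs => rw [← Finsupp.sum_single x, Finsupp.sum, map_sum, Finsupp.finsetSum_apply]
    refine Finset.sum_congr rfl fun u _ => ?_
    rw [single_eq_smul_std, map_smul, Finsupp.smul_apply, smul_eq_mul]
  have h1 := hsum (antiProj hl * symm hl hy)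
  simp only [Module.End.mul_apply] at h1
  rw [h1, Finset.sum_congr rfl fun w hw => by
    rw [key w (hx w (Finsupp.mem_support_iff.mp hw))]]
  split_ifs
  · rw [hsum]
  · simp

/-- `P` is a combination of dominant weights in the orbit of `y`. -/
def Supported (l : ℕ) (y : WeightSpace n) (P : Pattern n) : Prop :=
  ∀ κ, P κ ≠ 0 → κ ∈ orbit l y ∧ κ ∈ realDominant n

theorem smul_fiber_finite (hl : 0 < l) {y : WeightSpace n} (hy : y ∈ closedAlcove n l)
    (κ : WeightSpace n) : {w : affineWeyl n l | w • y = κ}.Finite := by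
  by_cases h : ∃ w : affineWeyl n l, w • y = κ
  · obtain ⟨w, rfl⟩ := h
    refine ((stabilizer_finite hl hy).image (fun g => w * g)).subset fun v hv => ?_
    refine ⟨w⁻¹ * v, ?_, mul_inv_cancel_left _ _⟩
    have hv' : v • y = w • y := hv
    change (w⁻¹ * v) • y = y
    rw [mul_smul, hv', inv_smul_smul]
  · convert Set.finite_empty
    ext w
    simp only [Set.mem_ofPred_eq, Set.mem_empty_iff_false, iff_false]
    exact fun hw => h ⟨w, hw⟩

open Classical in
/-- Translation of a pattern on the orbit of `y` to the regular orbit of the base point. -/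
noncomputable def liftPattern (hl : 0 < l) {y : WeightSpace n} (hy : y ∈ closedAlcove n l)
    (P : Pattern n) : HeckeModule n l :=
  Finsupp.ofSupportFinite
    -- The exponent is `uLen y w`. At a dominant `w • y` this is the exponent of `Θ^*` from the
    -- orbit of `y` to the regular orbit.
    (fun w => if DomAlcove w then T ((onNum l y : ℤ) - oLen y w) * P (w • y) else 0) <| by
      refine (P.support.finite_toSet.biUnion fun κ _ => smul_fiber_finite hl hy κ).subset ?_
      intro w hw
      rw [Function.mem_support] at hw
      refine Set.mem_biUnion (x := w • y) ?_ rfl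
      rw [Finset.mem_coe, Finsupp.mem_support_iff]
      intro h
      simp [h] at hw

open Classical in
theorem liftPattern_apply (hl : 0 < l) {y : WeightSpace n} (hy : y ∈ closedAlcove n l)
    (P : Pattern n) (w : affineWeyl n l) : liftPattern hl hy P w =
      if DomAlcove w then T ((onNum l y : ℤ) - oLen y w) * P (w • y) else 0 := rfl

theorem domAlcove_of_liftPattern (hl : 0 < l) {y : WeightSpace n} (hy : y ∈ closedAlcove n l)
    (P : Pattern n) (w : affineWeyl n l) (h : liftPattern hl hy P w ≠ 0) : DomAlcove w := by
  by_contra hc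
  rw [liftPattern_apply, if_neg hc] at h
  exact h rfl

theorem facetClosure_iff {x y : WeightSpace n} : y ∈ facetClosure l x ↔
    ∀ H, (val l H x = 0 → val l H y = 0) ∧ (val l H x < 0 → val l H y ≤ 0) ∧
      (0 < val l H x → 0 ≤ val l H y) := by
  simp only [facetClosure, Set.mem_ofPred_eq, on_iff, below_iff, above_iff, not_lt]

/-- In group terms κ_Π is simply `w • y` when κ is `w • t`. Uniqueness is the strict fundamental
domain property, transported by `w`. -/
theorem smul_mem_facetClosure_iff (hl : 0 < l) {t y : WeightSpace n} (ht : t ∈ closedAlcove n l)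
    (hy : y ∈ closedAlcove n l) (hty : ∀ H, val l H t = 0 → val l H y = 0)
    {κ : WeightSpace n} (hκ : κ ∈ orbit l y) (w : affineWeyl n l) :
    κ ∈ facetClosure l (w • t) ↔ κ = w • y := by
  constructor
  · intro h
    obtain ⟨v, rfl⟩ := hκ
    change v • y ∈ _ at h
    change v • y = w • y
    have hmem : (w⁻¹ * v) • y ∈ closedAlcove n l := by
      intro H hs
      have h1 := sep_smul w (pull w⁻¹ H) (basePt n l) ((w⁻¹ * v) • y)
      rw [← pull_mul hl, inv_mul_cancel, pull_one hl, ← mul_smul, mul_inv_cancel_left] at h1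
      have h2 := h1.mpr hs
      have h3 := smul_nonneg_of_mem ht w (pull w⁻¹ H)
      have h4 := facetClosure_iff.mp h (pull w⁻¹ H)
      rw [Sep] at h2
      have hne : val l (pull w⁻¹ H) (v • y) ≠ 0 := right_ne_zero_of_mul h2.ne
      rcases lt_trichotomy (val l (pull w⁻¹ H) (w • t)) 0 with h5 | h5 | h5
      · have := h4.2.1 h5
        have := nonpos_of_mul_nonneg_left h3 h5
        nlinarith
      · exact hne (h4.1 h5)
      · have := h4.2.2 h5
        have := nonneg_of_mul_nonneg_left h3 h5
        nlinarith
    have h1 := smul_eq_self_of_mem hl _ hy hmem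
    rw [mul_smul, inv_smul_eq_iff] at h1
    exact h1
  · rintro rfl
    rw [facetClosure_iff]
    intro H
    have h1 := smul_nonneg_of_mem ht w H
    have h2 := smul_nonneg_of_mem hy w H
    refine ⟨fun h => ?_, fun h => ?_, fun h => ?_⟩
    · rw [val_smul_eq_zero] at h ⊢
      exact hty _ h
    · have h3 : val l H (w • basePt n l) < 0 :=
        lt_of_le_of_ne (nonpos_of_mul_nonneg_left h1 h) (val_smul_basePt_ne hl w H)
      exact nonpos_of_mul_nonneg_right h2 h3
    · have h3 : 0 < val l H (w • basePt n l) :=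
        lt_of_le_of_ne (nonneg_of_mul_nonneg_left h1 h) (val_smul_basePt_ne hl w H).symm
      exact nonneg_of_mul_nonneg_right h2 h3

theorem finsum_single_apply {S : Set (WeightSpace n)} (hS : S.Finite)
    (c : WeightSpace n → LaurentPolynomial ℤ) (k : WeightSpace n) :
    (∑ᶠ y ∈ S, Finsupp.single y (c y) : Pattern n) k =
      open Classical in if k ∈ S then c k else 0 := by
  classical
  rw [finsum_mem_eq_finite_toFinset_sum _ hS, Finsupp.finsetSum_apply]
  split_ifs with h
  · rw [Finset.sum_eq_single k]
    · simp
    · intro y _ hy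
      exact Finsupp.single_eq_of_ne hy.symm
    · intro h'
      exact absurd (hS.mem_toFinset.mpr h) h'
  · refine Finset.sum_eq_zero fun y hy => Finsupp.single_eq_of_ne ?_
    rintro rfl
    exact h (hS.mem_toFinset.mp hy)

theorem thetaUpper_apply (hl : 0 < l) {t y : WeightSpace n} (ht : t ∈ closedAlcove n l)
    (hy : y ∈ closedAlcove n l) (hty : ∀ H, val l H t = 0 → val l H y = 0) {P : Pattern n}
    (hP : Supported l y P) {w : affineWeyl n l} (hw : w • t ∈ realDominant n) :
    thetaUpper l t P (w • t) = T (uNum l (w • t) (w • y) : ℤ) * P (w • y) := by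
  classical
  have hfin : ∀ κ ∈ orbit l y,
      {k | k ∈ orbit l t ∧ k ∈ realDominant n ∧ κ ∈ facetClosure l k}.Finite := by
    intro κ hκ
    refine ((smul_fiber_finite hl hy κ).image (fun w => w • t)).subset ?_
    rintro _ ⟨⟨v, rfl⟩, -, h⟩
    exact ⟨v, ((smul_mem_facetClosure_iff hl ht hy hty hκ v).mp h).symm, rfl⟩
  rw [thetaUpper, Finsupp.linearCombination_apply, Finsupp.sum, Finsupp.finsetSum_apply,
    Finset.sum_congr rfl fun κ hκ => by
      rw [Finsupp.smul_apply, finsum_single_apply (hfin κ (hP κ (Finsupp.mem_support_iff.mp hκ)).1)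
        (fun k => T (uNum l k κ : ℤ))]]
  rw [Finset.sum_eq_single (w • y)]
  · rw [if_pos, smul_eq_mul, mul_comm]
    exact ⟨⟨w, rfl⟩, hw, (smul_mem_facetClosure_iff hl ht hy hty ⟨w, rfl⟩ w).mpr rfl⟩
  · intro κ hκ hne
    rw [if_neg, smul_zero]
    rintro ⟨-, -, h⟩
    exact hne ((smul_mem_facetClosure_iff hl ht hy hty
      (hP κ (Finsupp.mem_support_iff.mp hκ)).1 w).mp h)
  · intro h
    rw [Finsupp.notMem_support_iff.mp h, zero_smul]

theorem supported_thetaUpper (hl : 0 < l) {t y : WeightSpace n} (ht : t ∈ closedAlcove n l)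
    (hy : y ∈ closedAlcove n l) (hty : ∀ H, val l H t = 0 → val l H y = 0) {P : Pattern n}
    (hP : Supported l y P) : Supported l t (thetaUpper l t P) := by
  classical
  intro k hk
  rw [thetaUpper, Finsupp.linearCombination_apply, Finsupp.sum, Finsupp.finsetSum_apply] at hk
  obtain ⟨κ, hκ, hne⟩ := Finset.exists_ne_zero_of_sum_ne_zero hk
  have hκ' := (hP κ (Finsupp.mem_support_iff.mp hκ)).1
  have hfin : {k | k ∈ orbit l t ∧ k ∈ realDominant n ∧ κ ∈ facetClosure l k}.Finite := by
    refine ((smul_fiber_finite hl hy κ).image (fun w => w • t)).subset ?_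
    rintro _ ⟨⟨v, rfl⟩, -, h⟩
    exact ⟨v, ((smul_mem_facetClosure_iff hl ht hy hty hκ' v).mp h).symm, rfl⟩
  rw [Finsupp.smul_apply, finsum_single_apply hfin (fun k => T (uNum l k κ : ℤ))] at hne
  by_contra hc
  rw [if_neg, smul_zero] at hne
  · exact hne rfl
  · exact fun h => hc ⟨h.1, h.2.1⟩

theorem thetaLower_apply (hl : 0 < l) {t z : WeightSpace n} (ht : t ∈ closedAlcove n l)
    (hz : z ∈ closedAlcove n l) (htz : ∀ H, val l H t = 0 → val l H z = 0) {Q : Pattern n}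
    (hQ : Supported l t Q) (k : WeightSpace n) :
    thetaLower l z Q k = ∑ κ ∈ Q.support,
      Q κ * (open Classical in if k ∈ orbit l z ∧ k ∈ realDominant n ∧ k ∈ facetClosure l κ then
        T (-(oNum l κ k : ℤ)) else 0) := by
  classical
  have hfin : ∀ κ ∈ orbit l t,
      {k | k ∈ orbit l z ∧ k ∈ realDominant n ∧ k ∈ facetClosure l κ}.Finite := by
    rintro _ ⟨v, rfl⟩
    refine (Set.finite_singleton (v • z)).subset ?_
    rintro k ⟨h1, -, h⟩
    exact (smul_mem_facetClosure_iff hl ht hz htz h1 v).mp h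
  rw [thetaLower, Finsupp.linearCombination_apply, Finsupp.sum, Finsupp.finsetSum_apply]
  refine Finset.sum_congr rfl fun κ hκ => ?_
  rw [Finsupp.smul_apply, finsum_single_apply (hfin κ (hQ κ (Finsupp.mem_support_iff.mp hκ)).1)
    (fun k => T (-(oNum l κ k : ℤ))), smul_eq_mul]
  congr 1
  split_ifs with h1 h2 h2
  · rfl
  · exact absurd h1 h2
  · exact absurd h2 h1
  · rfl

theorem supported_thetaLower (hl : 0 < l) {t z : WeightSpace n} (ht : t ∈ closedAlcove n l)
    (hz : z ∈ closedAlcove n l) (htz : ∀ H, val l H t = 0 → val l H z = 0) {Q : Pattern n}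
    (hQ : Supported l t Q) : Supported l z (thetaLower l z Q) := by
  classical
  intro k hk
  rw [thetaLower_apply hl ht hz htz hQ] at hk
  obtain ⟨κ, _, hne⟩ := Finset.exists_ne_zero_of_sum_ne_zero hk
  by_contra hc
  rw [if_neg, mul_zero] at hne
  · exact hne rfl
  · exact fun h => hc ⟨h.1, h.2.1⟩

end Translation

/-! ### Translation preserves self-duality; positive self-dual patterns vanish. -/

section TranslationSelfDual

variable {n l : ℕ}

/-- The number of hyperplanes through `w • y` that do not separate the alcove of `w` from the
fundamental alcove. -/
noncomputable def uLen (y : WeightSpace n) (w : affineWeyl n l) : ℕ :=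
  {H : Hyperplane n | val l H (w • y) = 0 ∧ ¬ Sep l (basePt n l) (w • basePt n l) H}.ncard

theorem onNum_smul (hl : 0 < l) (y : WeightSpace n) (w : affineWeyl n l) :
    onNum l (w • y) = onNum l y :=
  Set.ncard_congr' ((pullEquiv hl w).subtypeEquiv fun K => val_smul_eq_zero w K y)

theorem oLen_add_uLen (hl : 0 < l) (y : WeightSpace n) (w : affineWeyl n l) :
    oLen y w + uLen y w = onNum l y := by
  rw [← onNum_smul hl y w]
  exact Set.ncard_inter_add_ncard_sdiff_eq_ncard {H | val l H (w • y) = 0}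
    {H | Sep l (basePt n l) (w • basePt n l) H} (on_finite hl _)

/-- A hyperplane through a dominant weight has positive integer, so the base point is below it, and
being separated from the base point means being above. This links `oLen` and `uLen` to the numbers o
and u. -/
theorem sep_iff_of_smul_dominant (hl : 0 < l) {t z : WeightSpace n} (ht : t ∈ closedAlcove n l)
    {w : affineWeyl n l} (hdom : w • z ∈ realDominant n) {H : Hyperplane n}
    (h0 : val l H (w • z) = 0) (hne : val l H (w • t) ≠ 0) :
    Sep l (basePt n l) (w • basePt n l) H ↔ 0 < val l H (w • t) := by
  have h1 := val_basePt_neg hl (pos_of_dominant hl hdom h0)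
  have h2 := smul_nonneg_of_mem ht w H
  have h3 := val_smul_basePt_ne hl w H
  rw [Sep]
  constructor
  · intro h
    have h4 := pos_of_mul_neg_right h h1.le
    exact lt_of_le_of_ne (nonneg_of_mul_nonneg_right h2 h4) hne.symm
  · intro h
    have h4 := lt_of_le_of_ne (nonneg_of_mul_nonneg_left h2 h) h3.symm
    exact mul_neg_of_neg_of_pos h1 h4

theorem val_smul_eq_zero_of_imp {t z : WeightSpace n}
    (htz : ∀ H, val l H t = 0 → val l H z = 0) {w : affineWeyl n l} {H : Hyperplane n}
    (h : val l H (w • t) = 0) : val l H (w • z) = 0 := by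
  rw [val_smul_eq_zero] at h ⊢
  exact htz _ h

/-- The hyperplanes through `w • z` are split into those through `w • t` and those not, the latter
being counted by o. -/
theorem oLen_eq_add (hl : 0 < l) {t z : WeightSpace n} (ht : t ∈ closedAlcove n l)
    (htz : ∀ H, val l H t = 0 → val l H z = 0) {w : affineWeyl n l}
    (hdom : w • z ∈ realDominant n) : oLen z w = oNum l (w • t) (w • z) + oLen t w := by
  have hfin := on_finite hl (w • z)
  have hdisj : Disjoint {H : Hyperplane n | On l H (w • z) ∧ Above l H (w • t)}
      {H | val l H (w • t) = 0 ∧ Sep l (basePt n l) (w • basePt n l) H} := by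
    rw [Set.disjoint_left]
    rintro H ⟨-, h⟩ ⟨h0, -⟩
    rw [above_iff, h0] at h
    exact lt_irrefl _ h
  rw [oLen, sepCount, oNum, oLen, sepCount, ← Set.ncard_union_eq hdisj
    (hfin.subset fun H h => (on_iff l H _).mp h.1)
    (hfin.subset fun H h => val_smul_eq_zero_of_imp htz h.1)]
  · congr 1
    ext H
    simp only [Set.mem_ofPred_eq, Set.mem_union, on_iff, above_iff]
    by_cases h : val l H (w • t) = 0
    · have := val_smul_eq_zero_of_imp htz h
      simp [h, this]
    · simp only [h, false_and, or_false]
      exact and_congr_right fun h0 => sep_iff_of_smul_dominant hl ht hdom h0 h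

theorem uLen_eq_add (hl : 0 < l) {t z : WeightSpace n} (ht : t ∈ closedAlcove n l)
    (htz : ∀ H, val l H t = 0 → val l H z = 0) {w : affineWeyl n l}
    (hdom : w • z ∈ realDominant n) : uLen z w = uNum l (w • t) (w • z) + uLen t w := by
  have hfin := on_finite hl (w • z)
  have hdisj : Disjoint {H : Hyperplane n | On l H (w • z) ∧ Below l H (w • t)}
      {H | val l H (w • t) = 0 ∧ ¬ Sep l (basePt n l) (w • basePt n l) H} := by
    rw [Set.disjoint_left]
    rintro H ⟨-, h⟩ ⟨h0, -⟩
    rw [below_iff, h0] at h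
    exact lt_irrefl _ h
  rw [uLen, uNum, uLen, ← Set.ncard_union_eq hdisj
    (hfin.subset fun H h => (on_iff l H _).mp h.1)
    (hfin.subset fun H h => val_smul_eq_zero_of_imp htz h.1)]
  · congr 1
    ext H
    simp only [Set.mem_ofPred_eq, Set.mem_union, on_iff, below_iff]
    by_cases h : val l H (w • t) = 0
    · have := val_smul_eq_zero_of_imp htz h
      simp [h, this]
    · simp only [h, false_and, or_false]
      refine and_congr_right fun h0 => ?_
      rw [sep_iff_of_smul_dominant hl ht hdom h0 h, not_lt]
      exact ⟨fun h1 => lt_of_le_of_ne h1 h, fun h1 => h1.le⟩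

theorem stabilizer_le (hl : 0 < l) {t z : WeightSpace n} (ht : t ∈ closedAlcove n l)
    (htz : ∀ H, val l H t = 0 → val l H z = 0) {g : affineWeyl n l} (hg : g • t = t) :
    g • z = z := by
  refine stabilizer_induction hl ht (P := fun g => g • z = z) (one_smul _ _) ?_ g hg
  intro H g _ h0 _ _ ih
  rw [mul_smul, ih, refl_smul, reflect_eq_self l (htz H h0)]

theorem dominant_of_smul (hl : 0 < l) {t z : WeightSpace n} (ht : t ∈ closedAlcove n l)
    (hz : z ∈ closedAlcove n l) (htz : ∀ H, val l H t = 0 → val l H z = 0) {w : affineWeyl n l}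
    (hdom : w • z ∈ realDominant n) : w • t ∈ realDominant n := by
  rw [pos_level_iff (l := l)] at hdom ⊢
  intro α
  have h := facetClosure_iff.mp
    ((smul_mem_facetClosure_iff hl ht hz htz ⟨w, rfl⟩ w).mpr rfl) (α, 0)
  have h1 := hdom α
  rcases lt_trichotomy (val l (α, 0) (w • t)) 0 with h2 | h2 | h2
  · exact absurd (h.2.1 h2) (not_le.mpr h1)
  · exact absurd (h.1 h2) h1.ne'
  · exact h2

/-- Translation from the orbit of `y` through the orbit of `t` to the orbit of `z`, expressed in
the antispherical module. -/
theorem poincare_smul_liftPattern (hl : 0 < l) {y t z : WeightSpace n} (hy : y ∈ closedAlcove n l)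
    (ht : t ∈ closedAlcove n l) (hz : z ∈ closedAlcove n l)
    (hty : ∀ H, val l H t = 0 → val l H y = 0) (htz : ∀ H, val l H t = 0 → val l H z = 0)
    {P : Pattern n} (hP : Supported l y P) :
    poincare hl ht • liftPattern hl hz (thetaLower l z (thetaUpper l t P)) =
      antiProj hl (symm hl hz (liftPattern hl hy P)) := by
  classical
  have hQ := supported_thetaUpper hl ht hy hty hP
  ext1 v
  rw [antiProj_symm_apply hl hz (domAlcove_of_liftPattern hl hy P), Finsupp.smul_apply,
    liftPattern_apply, smul_eq_mul]
  by_cases hv : v • z ∈ realDominant n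
  swap
  · have h0 : thetaLower l z (thetaUpper l t P) (v • z) = 0 := by
      by_contra hc
      exact hv (supported_thetaLower hl ht hz htz hQ _ hc).2
    rw [if_neg hv, h0, mul_zero, ite_self, mul_zero]
  rw [if_pos hv, if_pos (domAlcove_of_dominant hl hz hv), symm_apply]
  set Q := thetaUpper l t P with hQdef
  -- Once a power of q depending on the alcove `v` is split off, an identity for the weight `v • z`
  -- remains.
  have hmain : poincare hl ht * thetaLower l z Q (v • z) = ∑ g ∈ stab hl hz,
      T (-(oLen z (v * g) : ℤ)) * liftPattern hl hy P (v * g) := by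
    have hcond : ∀ w : affineWeyl n l, (v • z ∈ orbit l z ∧ v • z ∈ realDominant n ∧
        v • z ∈ facetClosure l (w • t)) ↔ w • z = v • z := by
      intro w
      have h1 := smul_mem_facetClosure_iff hl ht hz htz (κ := v • z) ⟨v, rfl⟩ w
      rw [h1]
      exact ⟨fun h => h.2.2.symm, fun h => ⟨⟨v, rfl⟩, hv, h.symm⟩⟩
    -- The weights of the orbit of `t` lying over `v • z` are the `(v * g) • t`. Different `g` may
    -- give the same weight, hence the image here and the sum over fibres below.
    have hsum : thetaLower l z Q (v • z) =
        ∑ κ ∈ (stab hl hz).image (fun g => (v * g) • t),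
          Q κ * T (-(oNum l κ (v • z) : ℤ)) := by
      rw [thetaLower_apply hl ht hz htz hQ]
      rw [← Finset.sum_filter_of_ne
        (p := fun κ => κ ∈ (stab hl hz).image (fun g => (v * g) • t))]
      · rw [Finset.filter_mem_eq_inter, Finset.inter_comm]
        refine (Finset.sum_subset Finset.inter_subset_left ?_).trans (Finset.sum_congr rfl ?_)
        · intro κ h1 h2
          have : κ ∉ Q.support := fun h3 => h2 (Finset.mem_inter.mpr ⟨h1, h3⟩)
          rw [Finsupp.notMem_support_iff.mp this, zero_mul]
        · intro κ hκ
          obtain ⟨g, hg, rfl⟩ := Finset.mem_image.mp hκ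
          rw [if_pos]
          rw [hcond, mul_smul, (mem_stab hl hz).mp hg]
      · intro κ hκ hne
        obtain ⟨w, rfl⟩ := (hQ κ (Finsupp.mem_support_iff.mp hκ)).1
        by_cases h : w • z = v • z
        · refine Finset.mem_image.mpr ⟨v⁻¹ * w, ?_, by rw [mul_inv_cancel_left]⟩
          rw [mem_stab, mul_smul, h, inv_smul_smul]
        · exfalso
          apply hne
          rw [if_neg, mul_zero]
          exact fun h2 => h ((hcond w).mp h2)
    rw [hsum, Finset.mul_sum]
    refine Finset.sum_image' _ fun g hg => ?_
    rw [mem_stab] at hg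
    have hgz : (v * g) • z = v • z := by rw [mul_smul, hg]
    have hdz : (v * g) • z ∈ realDominant n := by rwa [hgz]
    have hdt : (v * g) • t ∈ realDominant n := dominant_of_smul hl ht hz htz hdz
    -- A fibre is a coset of the stabilizer of `t`; summing over it produces the Poincaré
    -- polynomial.
    have hreindex : ∑ j ∈ (stab hl hz).filter (fun j => (v * j) • t = (v * g) • t),
        T (-(oLen z (v * j) : ℤ)) * liftPattern hl hy P (v * j) =
        ∑ k ∈ stab hl ht,
          T (-(oLen z (v * g * k) : ℤ)) * liftPattern hl hy P (v * g * k) := by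
      refine Finset.sum_nbij' (fun j => g⁻¹ * j) (fun k => g * k) ?_ ?_ ?_ ?_ ?_
      · intro j hj
        obtain ⟨-, h⟩ := Finset.mem_filter.mp hj
        rw [mul_smul, mul_smul] at h
        rw [mem_stab, mul_smul, inv_smul_eq_iff]
        exact smul_left_cancel v h
      · intro k hk
        rw [mem_stab] at hk
        rw [Finset.mem_filter, mem_stab, mul_smul, stabilizer_le hl ht htz hk, hg]
        exact ⟨rfl, by rw [← mul_assoc, mul_smul (v * g), hk]⟩
      · intro j _; rw [mul_inv_cancel_left]
      · intro k _; rw [inv_mul_cancel_left]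
      · intro j _; rw [mul_assoc v g, mul_inv_cancel_left]
    rw [hreindex, hQdef, thetaUpper_apply hl ht hy hty hP hdt, ← hgz]
    rw [← sum_oLen_eq_poincare hl ht (v * g), Finset.sum_mul]
    refine Finset.sum_congr rfl fun k hk => ?_
    rw [mem_stab] at hk
    have hkz : (v * g * k) • z = (v * g) • z := by
      rw [mul_smul _ k, stabilizer_le hl ht htz hk]
    have hky : (v * g * k) • y = (v * g) • y := by
      rw [mul_smul _ k, stabilizer_le hl ht hty hk]
    have hkt : (v * g * k) • t = (v * g) • t := by rw [mul_smul _ k, hk]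
    have hd1 : DomAlcove (v * g * k) := domAlcove_of_dominant hl hz (hkz ▸ hdz)
    rw [liftPattern_apply, if_pos hd1, hky]
    by_cases hPy : P ((v * g) • y) = 0
    · rw [hPy]; ring
    have hdy := (hP _ hPy).2
    have e1 := oLen_eq_add hl ht htz (w := v * g * k) (by rwa [hkz])
    have e2 := uLen_eq_add hl ht hty (w := v * g * k) (by rwa [hky])
    have e3 := oLen_add_uLen hl y (v * g * k)
    have e4 := oLen_add_uLen hl t (v * g * k)
    rw [hkt, hkz] at e1
    rw [hkt, hky] at e2
    -- The hyperplanes through `t` contribute the Poincaré exponent, and the others contribute u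
    -- upwards and o downwards.
    have e5 : ((onNum l t : ℤ) - 2 * oLen t (v * g * k)) + uNum l ((v * g) • t) ((v * g) • y) +
        -(oNum l ((v * g) • t) ((v * g) • z) : ℤ) =
        -(oLen z (v * g * k) : ℤ) + ((onNum l y : ℤ) - oLen y (v * g * k)) := by
      omega
    calc T ((onNum l t : ℤ) - 2 * oLen t (v * g * k)) *
          (T (uNum l ((v * g) • t) ((v * g) • y) : ℤ) * P ((v * g) • y) *
            T (-(oNum l ((v * g) • t) ((v * g) • z) : ℤ)))
        = T ((onNum l t : ℤ) - 2 * oLen t (v * g * k)) *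
          T (uNum l ((v * g) • t) ((v * g) • y) : ℤ) *
            T (-(oNum l ((v * g) • t) ((v * g) • z) : ℤ)) * P ((v * g) • y) := by ring
      _ = T (-(oLen z (v * g * k) : ℤ)) * T ((onNum l y : ℤ) - oLen y (v * g * k)) *
            P ((v * g) • y) := by rw [← T_add, ← T_add, e5, T_add]
      _ = _ := by ring
  rw [mul_left_comm, hmain, sub_eq_add_neg, T_add, mul_comm (T (onNum l z : ℤ)), mul_assoc]
  congr 1
  rw [Finset.mul_sum]
  refine Finset.sum_congr rfl fun g _ => ?_
  rw [← mul_assoc, ← T_add, sub_eq_add_neg]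

/-- The pattern `P` on the orbit of `y` is self-dual. -/
def SelfDual (hl : 0 < l) {y : WeightSpace n} (hy : y ∈ closedAlcove n l) (P : Pattern n) : Prop :=
  antiProj hl (bar hl (liftPattern hl hy P)) = liftPattern hl hy P

/-- The Poincaré multiple of the lift is self-dual because `symm` is compatible with both `bar` and
`antiProj`. The polynomial is self-dual and nonzero, and the module is torsion-free, so it cancels.
-/
theorem SelfDual.translate (hl : 0 < l) {y t z : WeightSpace n} (hy : y ∈ closedAlcove n l)
    (ht : t ∈ closedAlcove n l) (hz : z ∈ closedAlcove n l)
    (hty : ∀ H, val l H t = 0 → val l H y = 0) (htz : ∀ H, val l H t = 0 → val l H z = 0)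
    {P : Pattern n} (hP : Supported l y P) (hd : SelfDual hl hy P) :
    SelfDual hl hz (thetaLower l z (thetaUpper l t P)) := by
  have h1 := poincare_smul_liftPattern hl hy ht hz hty htz hP
  set x := liftPattern hl hz (thetaLower l z (thetaUpper l t P)) with hx
  have h2 : antiProj hl (bar hl (poincare hl ht • x)) = poincare hl ht • x := by
    rw [h1, antiProj_bar, bar_symm, ← antiProj_comm hl (symm hl hz)
      (fun H hH => leftGen_symm_comm hl hz hH), hd]
  rw [bar_smul, invert_poincare, map_smul] at h2
  have h3 : poincare hl ht • (antiProj hl (bar hl x) - x) = 0 := by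
    rw [smul_sub, h2, sub_self]
  exact sub_eq_zero.mp ((smul_eq_zero.mp h3).resolve_left (poincare_ne_zero hl ht))

theorem liftPattern_sub (hl : 0 < l) {y : WeightSpace n} (hy : y ∈ closedAlcove n l)
    (P Q : Pattern n) : liftPattern hl hy (P - Q) = liftPattern hl hy P - liftPattern hl hy Q := by
  ext1 w
  rw [Finsupp.sub_apply, liftPattern_apply, liftPattern_apply, liftPattern_apply,
    Finsupp.sub_apply]
  split_ifs
  · rw [mul_sub]
  · rw [sub_zero]

theorem liftPattern_smul (hl : 0 < l) {y : WeightSpace n} (hy : y ∈ closedAlcove n l)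
    (a : LaurentPolynomial ℤ) (P : Pattern n) :
    liftPattern hl hy (a • P) = a • liftPattern hl hy P := by
  ext1 w
  rw [Finsupp.smul_apply, liftPattern_apply, liftPattern_apply, Finsupp.smul_apply]
  split_ifs
  · rw [smul_eq_mul, smul_eq_mul, mul_left_comm]
  · rw [smul_zero]

theorem SelfDual.sub (hl : 0 < l) {y : WeightSpace n} (hy : y ∈ closedAlcove n l)
    {P Q : Pattern n} (hP : SelfDual hl hy P) (hQ : SelfDual hl hy Q) :
    SelfDual hl hy (P - Q) := by
  rw [SelfDual, liftPattern_sub, map_sub, map_sub, hP, hQ]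

theorem SelfDual.smul (hl : 0 < l) {y : WeightSpace n} (hy : y ∈ closedAlcove n l)
    {a : LaurentPolynomial ℤ} (ha : invert a = a) {P : Pattern n} (hP : SelfDual hl hy P) :
    SelfDual hl hy (a • P) := by
  rw [SelfDual, liftPattern_smul, bar_smul, map_smul, hP, ha]

theorem SelfDual.sub_sum (hl : 0 < l) {y : WeightSpace n} (hy : y ∈ closedAlcove n l)
    {ι : Type*} (s : Finset ι) {P : Pattern n} {R : ι → Pattern n} {γ : ι → LaurentPolynomial ℤ}
    (hP : SelfDual hl hy P) (hγ : ∀ i, invert (γ i) = γ i) (hR : ∀ i, SelfDual hl hy (R i)) :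
    SelfDual hl hy (P - ∑ i ∈ s, γ i • R i) := by
  classical
  induction s using Finset.induction_on with
  | empty => rwa [Finset.sum_empty, sub_zero]
  | insert a s ha ih =>
    rw [Finset.sum_insert ha, sub_add_eq_sub_sub_swap]
    exact ih.sub hl hy ((hR a).smul hl hy (hγ a))

/-- The lift of a dominant weight of the closed alcove is exactly the bar-invariant element `symm hl
hy (std 1)`. -/
theorem selfDual_single (hl : 0 < l) {y : WeightSpace n} (hy : y ∈ closedAlcove n l)
    (hdom : y ∈ realDominant n) : SelfDual hl hy (Finsupp.single y 1) := by
  classical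
  have h : liftPattern hl hy (Finsupp.single y 1) = symm hl hy (std 1) := by
    ext1 w
    rw [liftPattern_apply, symm_std, Finsupp.smul_apply, symStd_apply, oLen_one, inv_one, one_mul,
      smul_eq_mul]
    by_cases hw : w • y = y
    · rw [if_pos hw, if_pos (domAlcove_of_dominant hl hy (by rwa [hw])), hw,
        Finsupp.single_eq_same, mul_one, ← T_add]
      congr 1
    · rw [if_neg hw, Finsupp.single_eq_of_ne hw, mul_zero, mul_zero, ite_self]
  have hsupp : antiProj hl (liftPattern hl hy (Finsupp.single y 1)) =
      liftPattern hl hy (Finsupp.single y 1) :=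
    antiProj_of_supp hl fun w hw => domAlcove_of_liftPattern hl hy _ w hw
  rw [SelfDual]
  conv_rhs => rw [← hsupp]
  rw [h, bar_symm_one]

/-- Lifting multiplies coefficients by nonnegative powers of q, so positivity survives and the
regular case applies; lifting is injective on patterns of dominant weights. -/
theorem eq_zero_of_selfDual_pattern (hl : 0 < l) {y : WeightSpace n} (hy : y ∈ closedAlcove n l)
    {P : Pattern n} (hP : Supported l y P) (hd : SelfDual hl hy P)
    (hpos : ∀ κ, IsPositive (P κ)) : P = 0 := by
  have h0 : liftPattern hl hy P = 0 := by
    refine eq_zero_of_selfDual hl (domAlcove_of_liftPattern hl hy P) (fun w => ?_) hd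
    rw [liftPattern_apply]
    split_ifs
    · have e : (onNum l y : ℤ) - oLen y w = (uLen y w : ℕ) := by
        have := oLen_add_uLen hl y w
        omega
      rw [e]
      exact (hpos _).T_mul _
    · exact IsPositive.zero
  ext1 κ
  by_contra hc
  obtain ⟨⟨w, rfl⟩, hdom⟩ := hP κ hc
  change w • y ∈ _ at hdom
  have h1 := DFunLike.congr_fun h0 w
  rw [liftPattern_apply, if_pos (domAlcove_of_dominant hl hy hdom)] at h1
  exact hc (((isUnit_T _).mul_right_eq_zero).mp h1)

end TranslationSelfDual

/-! ### Majorization of coordinates and the order on weights. -/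

section Majorization

variable {n : ℕ}

/-- Each partial sum of shifted coordinates of `x` is at most one of `y` of the same size. -/
def Majorized (x y : WeightSpace n) : Prop :=
  ∀ J : Finset (Fin (n + 1)), ∃ J' : Finset (Fin (n + 1)),
    J'.card = J.card ∧ ∑ i ∈ J, coord x i ≤ ∑ i ∈ J', coord y i

theorem Majorized.refl (x : WeightSpace n) : Majorized x x := fun J => ⟨J, rfl, le_rfl⟩

theorem Majorized.trans {x y z : WeightSpace n} (h : Majorized x y) (h' : Majorized y z) :
    Majorized x z := by
  intro J
  obtain ⟨J', h1, h2⟩ := h J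
  obtain ⟨K, h3, h4⟩ := h' J'
  exact ⟨K, h3.trans h1, h2.trans h4⟩

/-- A transfer makes the coordinates at `a` and `b` less spread out. The only delicate index sets
contain `b` but not `a`; there `b` is exchanged for `a`. -/
theorem majorized_of_transfer {x y : WeightSpace n} {a b : Fin (n + 1)} (hab : a ≠ b)
    (hoff : ∀ i, i ≠ a → i ≠ b → coord x i = coord y i)
    (hsum : coord x a + coord x b = coord y a + coord y b)
    (ha : coord x a ≤ coord y a) (hb : coord x b ≤ coord y a) : Majorized x y := by
  intro J
  by_cases hbJ : b ∈ J
  · by_cases haJ : a ∈ J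
    · refine ⟨J, rfl, ?_⟩
      rw [← Finset.add_sum_erase J _ hbJ, ← Finset.add_sum_erase J (coord y) hbJ,
        ← Finset.add_sum_erase (J.erase b) _ (Finset.mem_erase.mpr ⟨hab, haJ⟩),
        ← Finset.add_sum_erase (J.erase b) (coord y) (Finset.mem_erase.mpr ⟨hab, haJ⟩)]
      have : ∑ i ∈ (J.erase b).erase a, coord x i = ∑ i ∈ (J.erase b).erase a, coord y i := by
        refine Finset.sum_congr rfl fun i hi => ?_
        rw [Finset.mem_erase, Finset.mem_erase] at hi
        exact hoff i hi.1 hi.2.1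
      linarith
    · refine ⟨J.map (Equiv.swap a b).toEmbedding, Finset.card_map _, ?_⟩
      rw [Finset.sum_map]
      refine Finset.sum_le_sum fun i hi => ?_
      change _ ≤ coord y (Equiv.swap a b i)
      by_cases hib : i = b
      · rw [hib, Equiv.swap_apply_right]
        exact hb
      · have hia : i ≠ a := fun h => haJ (h ▸ hi)
        rw [Equiv.swap_apply_of_ne_of_ne hia hib, hoff i hia hib]
  · refine ⟨J, rfl, Finset.sum_le_sum fun i hi => ?_⟩
    have hib : i ≠ b := fun h => hbJ (h ▸ hi)
    by_cases hia : i = a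
    · rw [hia]; exact ha
    · exact (hoff i hia hib).le

theorem sum_le_sum_initial {Z : Fin (n + 1) → ℝ} (hZ : Antitone Z) (m : Fin (n + 1))
    {J : Finset (Fin (n + 1))} (hJ : J.card = (Finset.Iio m).card) :
    ∑ i ∈ J, Z i ≤ ∑ i ∈ Finset.Iio m, Z i := by
  rw [← Finset.sum_inter_add_sum_sdiff J (Finset.Iio m),
    ← Finset.sum_inter_add_sum_sdiff (Finset.Iio m) J, Finset.inter_comm]
  have h1 : ∑ i ∈ J \ Finset.Iio m, Z i ≤ (J \ Finset.Iio m).card • Z m :=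
    Finset.sum_le_card_nsmul _ _ _ fun i hi => by
      rw [Finset.mem_sdiff, Finset.mem_Iio, not_lt] at hi
      exact hZ hi.2
  have h2 : (Finset.Iio m \ J).card • Z m ≤ ∑ i ∈ Finset.Iio m \ J, Z i :=
    Finset.card_nsmul_le_sum _ _ _ fun i hi => by
      rw [Finset.mem_sdiff, Finset.mem_Iio] at hi
      exact hZ hi.1.le
  rw [Finset.card_sdiff_comm hJ] at h1
  linarith

/-- The simple root `ε_m - ε_(m+1)`. -/
def simpleRoot (m : Fin n) : PosRoot n := ⟨(m.castSucc, m.succ), Fin.castSucc_lt_succ⟩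

/-- The differences of partial sums are the coefficients of `lam - κ` in the simple roots, by
summation by parts. -/
theorem weightLE_of_partialSums {κ lam : WeightSpace n}
    (h : ∀ m : Fin (n + 1), ∑ i ∈ Finset.Iio m, coord κ i ≤ ∑ i ∈ Finset.Iio m, coord lam i) :
    WeightLE κ lam := by
  classical
  set D : Fin (n + 1) → ℝ :=
    fun m => ∑ i ∈ Finset.Iio m, coord lam i - ∑ i ∈ Finset.Iio m, coord κ i with hD
  have hstep : ∀ m : Fin n, D m.succ - D m.castSucc = coord lam m.castSucc - coord κ m.castSucc := by
    intro m
    have e : Finset.Iio m.succ = insert m.castSucc (Finset.Iio m.castSucc) := by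
      ext i
      simp only [Finset.mem_Iio, Finset.mem_insert, Fin.lt_def, Fin.ext_iff, Fin.val_succ,
        Fin.val_castSucc]
      omega
    simp only [hD]
    rw [e, Finset.sum_insert (by simp), Finset.sum_insert (by simp)]
    ring
  have hzero : D 0 = 0 := by
    have : Finset.Iio (0 : Fin (n + 1)) = ∅ := by
      ext i
      simp
    simp only [hD]
    rw [this, Finset.sum_empty, Finset.sum_empty, sub_zero]
  have hlast : D (Fin.last n) = -(coord lam (Fin.last n) - coord κ (Fin.last n)) := by
    have e : Finset.univ = insert (Fin.last n) (Finset.Iio (Fin.last n)) := by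
      ext i
      simp only [Finset.mem_univ, Finset.mem_insert, Finset.mem_Iio, true_iff]
      exact (Fin.le_last i).eq_or_lt
    have h1 := sum_coord lam
    have h2 := sum_coord κ
    rw [e, Finset.sum_insert (by simp)] at h1 h2
    simp only [hD]
    linarith
  refine ⟨fun α => ∑ m : Fin n, if α = simpleRoot m then D m.succ else 0, fun α => ?_, ?_⟩
  · refine Finset.sum_nonneg fun m _ => ?_
    split_ifs
    · exact sub_nonneg.mpr (h _)
    · exact le_rfl
  · have e : ∑ α : PosRoot n, (∑ m : Fin n, if α = simpleRoot m then D m.succ else 0) • rootVec α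
        = ∑ m : Fin n, D m.succ • rootVec (simpleRoot m) := by
      simp only [Finset.sum_smul, ite_smul, zero_smul]
      rw [Finset.sum_comm]
      refine Finset.sum_congr rfl fun m _ => ?_
      rw [Finset.sum_ite_eq' Finset.univ (simpleRoot m), if_pos (Finset.mem_univ _)]
    rw [e]
    apply Subtype.ext
    funext i
    have hL : (lam - κ).1 i = coord lam i - coord κ i := by
      simp [coord]
    rw [hL]
    simp only [AddSubmonoidClass.coe_finsetSum, Submodule.coe_smul, Finset.sum_apply,
      Pi.smul_apply, rootVec, simpleRoot, Pi.sub_apply, Pi.single_apply, smul_eq_mul, mul_sub,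
      mul_ite, mul_one, mul_zero, Finset.sum_sub_distrib]
    have hsucc : ∑ m : Fin n, (if i = m.succ then D m.succ else 0) = D i := by
      induction i using Fin.cases with
      | zero => rw [hzero]; exact Finset.sum_eq_zero fun m _ => if_neg (Fin.succ_ne_zero m).symm
      | succ j =>
        simp only [Fin.succ_inj]
        rw [Finset.sum_ite_eq, if_pos (Finset.mem_univ _)]
    rw [hsucc]
    induction i using Fin.lastCases with
    | last =>
      rw [hlast, Finset.sum_eq_zero fun m _ => if_neg (Fin.castSucc_lt_last m).ne']
      ring
    | cast j =>
      simp only [Fin.castSucc_inj]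
      rw [Finset.sum_ite_eq, if_pos (Finset.mem_univ _), hstep]

theorem Majorized.weightLE {κ lam : WeightSpace n} (h : Majorized κ lam)
    (hlam : lam ∈ realDominant n) : WeightLE κ lam := by
  have hanti : Antitone (coord lam) := by
    intro i j hij
    rcases hij.eq_or_lt with rfl | hlt
    · exact le_rfl
    · have := hlam ⟨(i, j), hlt⟩
      rw [level_eq] at this
      linarith
  refine weightLE_of_partialSums fun m => ?_
  obtain ⟨J, h1, h2⟩ := h (Finset.Iio m)
  exact h2.trans (sum_le_sum_initial hanti m h1)

end Majorization

/-! ### The Bruhat order on weights and its lifting along translations. -/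

section Bruhat

variable {n l : ℕ}

/-- `y` is obtained from `x` by a reflection towards the fundamental alcove. -/
def Down (l : ℕ) (y x : WeightSpace n) : Prop :=
  ∃ H, y = reflect l H x ∧ Sep l (basePt n l) x H

/-- The Bruhat order on weights: chains of reflections towards the fundamental alcove. -/
def BruhatLE (l : ℕ) : WeightSpace n → WeightSpace n → Prop := Relation.ReflTransGen (Down l)

/-- The number of hyperplanes separating `x` from the fundamental alcove. -/
noncomputable def height (l : ℕ) (x : WeightSpace n) : ℕ := sepCount l (fun _ => True) x

theorem Down.height_lt (hl : 0 < l) {y x : WeightSpace n} (h : Down l y x) :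
    height l y < height l x := by
  obtain ⟨H, rfl, hs⟩ := h
  exact sepCount_reflect_lt hl hs

theorem BruhatLE.eq_or_height_lt (hl : 0 < l) {y x : WeightSpace n} (h : BruhatLE l y x) :
    y = x ∨ height l y < height l x := by
  induction h with
  | refl => exact Or.inl rfl
  | tail _ h ih =>
    right
    rcases ih with rfl | ih
    · exact h.height_lt hl
    · exact ih.trans (h.height_lt hl)

theorem BruhatLE.antisymm (hl : 0 < l) {y x : WeightSpace n} (h : BruhatLE l y x)
    (h' : BruhatLE l x y) : y = x := by
  rcases h.eq_or_height_lt hl with h1 | h1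
  · exact h1
  · rcases h'.eq_or_height_lt hl with h2 | h2
    · exact h2.symm
    · omega

theorem BruhatLE.mem_orbit {y x : WeightSpace n} (h : BruhatLE l y x) : y ∈ orbit l x := by
  induction h using Relation.ReflTransGen.head_induction_on with
  | refl => exact ⟨1, one_smul _ _⟩
  | head h _ ih =>
    obtain ⟨H, rfl, -⟩ := h
    obtain ⟨g, rfl⟩ := ih
    exact ⟨refl l H * g, mul_smul _ _ _⟩

theorem bruhatLE_finite (hl : 0 < l) (x : WeightSpace n) : {y | BruhatLE l y x}.Finite := by
  induction hk : height l x using Nat.strong_induction_on generalizing x with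
  | _ k ih =>
    have h : {y | BruhatLE l y x} ⊆
        {x} ∪ ⋃ H ∈ {H : Hyperplane n | Sep l (basePt n l) x H}, {y | BruhatLE l y (reflect l H x)} := by
      intro y hy
      rcases Relation.ReflTransGen.cases_tail hy with h | ⟨z, h1, H, rfl, hs⟩
      · exact Or.inl h.symm
      · exact Or.inr (Set.mem_biUnion hs h1)
    refine ((Set.finite_singleton x).union ((sep_finite hl _ _).biUnion fun H hs => ?_)).subset h
    exact ih _ (hk ▸ Down.height_lt hl ⟨H, rfl, hs⟩) _ rfl

/-- A reflection towards the fundamental alcove moves two coordinates while keeping their sum. The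
sign of the integer of the hyperplane decides which of the two coordinates of `x` dominates both new
ones. -/
theorem Down.majorized (hl : 0 < l) {y x : WeightSpace n} (h : Down l y x) : Majorized y x := by
  obtain ⟨⟨⟨⟨i, j⟩, hij⟩, k⟩, rfl, hs⟩ := h
  have hij' : i ≠ j := ne_of_lt hij
  have hl' : (0 : ℝ) < l := by exact_mod_cast hl
  have ei : coord (reflect l (⟨(i, j), hij⟩, k) x) i = coord x j + k * l := by
    rw [coord_reflect, if_pos rfl]
  have ej : coord (reflect l (⟨(i, j), hij⟩, k) x) j = coord x i - k * l := by
    rw [coord_reflect, if_neg hij'.symm, if_pos rfl]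
  have eoff : ∀ a, a ≠ i → a ≠ j → coord (reflect l (⟨(i, j), hij⟩, k) x) a = coord x a := by
    intro a h1 h2
    rw [coord_reflect, if_neg h1, if_neg h2]
  have hv : val l (⟨(i, j), hij⟩, k) x = coord x i - coord x j - k * l := by
    rw [val, level_eq]
  rw [Sep, hv] at hs
  rcases le_or_gt k 0 with hk | hk
  · have h1 := neg_of_mul_neg_right hs (val_basePt_pos hl (H := (⟨(i, j), hij⟩, k)) hk).le
    have h2 : (k : ℝ) ≤ 0 := by exact_mod_cast hk
    have h3 : (k : ℝ) * l ≤ 0 := mul_nonpos_of_nonpos_of_nonneg h2 hl'.le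
    refine majorized_of_transfer hij'.symm (fun a h1 h2 => eoff a h2 h1) ?_ ?_ ?_ <;>
      linarith
  · have h1 := pos_of_mul_neg_right hs (val_basePt_neg hl (H := (⟨(i, j), hij⟩, k)) hk).le
    have h2 : (0 : ℝ) < k := by exact_mod_cast hk
    have h3 : 0 < (k : ℝ) * l := mul_pos h2 hl'
    refine majorized_of_transfer hij' eoff ?_ ?_ ?_
    · rw [ei, ej]; ring
    · rw [ei]; linarith
    · rw [ej]; linarith

theorem BruhatLE.majorized (hl : 0 < l) {y x : WeightSpace n} (h : BruhatLE l y x) :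
    Majorized y x := by
  induction h with
  | refl => exact Majorized.refl _
  | tail _ h ih => exact ih.trans (h.majorized hl)

theorem BruhatLE.weightLE (hl : 0 < l) {y x : WeightSpace n} (h : BruhatLE l y x)
    (hx : x ∈ realDominant n) : WeightLE y x := (h.majorized hl).weightLE hx

theorem smul_mul_nonneg_of_mem (hl : 0 < l) {y z : WeightSpace n} (hy : y ∈ closedAlcove n l)
    (hz : z ∈ closedAlcove n l) (w : affineWeyl n l) (H : Hyperplane n) :
    0 ≤ val l H (w • y) * val l H (w • z) := by
  have h1 := smul_nonneg_of_mem hy w H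
  have h2 := smul_nonneg_of_mem hz w H
  rcases lt_or_gt_of_ne (val_smul_basePt_ne hl w H) with h | h
  · exact mul_nonneg_of_nonpos_of_nonpos (nonpos_of_mul_nonneg_right h1 h)
      (nonpos_of_mul_nonneg_right h2 h)
  · exact mul_nonneg (nonneg_of_mul_nonneg_right h1 h) (nonneg_of_mul_nonneg_right h2 h)

/-- Bruhat relations lift along translation to another point of the closed alcove. -/
theorem BruhatLE.lift (hl : 0 < l) {y z : WeightSpace n} (hy : y ∈ closedAlcove n l)
    (hz : z ∈ closedAlcove n l) {κ ν : WeightSpace n} (h : BruhatLE l κ ν) :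
    ∀ {w : affineWeyl n l}, w • y = κ →
      ∃ w' : affineWeyl n l, w' • y = ν ∧ BruhatLE l (w • z) (w' • z) := by
  induction h using Relation.ReflTransGen.head_induction_on with
  | refl => exact fun {w} hw => ⟨w, hw, Relation.ReflTransGen.refl⟩
  | head h hrest ih =>
    rename_i a c
    intro w hw
    obtain ⟨H, rfl, hs⟩ := h
    have h1 : (refl l H * w) • y = c := by
      rw [mul_smul, hw, refl_smul, reflect_reflect]
    obtain ⟨w', h2, h3⟩ := ih h1
    refine ⟨w', h2, Relation.ReflTransGen.trans ?_ h3⟩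
    have e : w • z = reflect l H ((refl l H * w) • z) := by
      rw [mul_smul, refl_smul, reflect_reflect]
    -- If the translate lies on the reflecting hyperplane, this link of the chain collapses to an
    -- equality.
    by_cases h0 : val l H ((refl l H * w) • z) = 0
    · rw [e, reflect_eq_self l h0]
    · refine Relation.ReflTransGen.single ⟨H, e, ?_⟩
      have h4 := smul_mul_nonneg_of_mem hl hy hz (refl l H * w) H
      rw [h1] at h4
      rw [Sep] at hs ⊢
      rcases mul_neg_iff.mp hs with ⟨ha, hb⟩ | ⟨ha, hb⟩
      · exact mul_neg_of_pos_of_neg ha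
          (lt_of_le_of_ne (nonpos_of_mul_nonneg_right h4 hb) h0)
      · exact mul_neg_of_neg_of_pos ha
          (lt_of_le_of_ne (nonneg_of_mul_nonneg_right h4 hb) (Ne.symm h0))

theorem smul_mem_closedAlcove_of_not_sep {g : affineWeyl n l} {z u : WeightSpace n}
    (hz : ∀ H, val l H z ≠ 0) (hg : g • z ∈ closedAlcove n l) (hu : ∀ H, ¬ Sep l z u H) :
    g • u ∈ closedAlcove n l := by
  intro H hs
  have h1 : ¬ Sep l (g • z) (g • u) H := by rw [sep_smul]; exact hu _
  have h2 := closedAlcove_nonneg hg H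
  have h3 : val l H (g • z) ≠ 0 := by rw [Ne, val_smul_eq_zero]; exact hz _
  rw [Sep] at h1 hs
  rcases mul_neg_iff.mp hs with ⟨ha, hb⟩ | ⟨ha, hb⟩ <;>
    rcases lt_or_gt_of_ne h3 with h4 | h4 <;> nlinarith

theorem eq_of_mem_closedAlcove (hl : 0 < l) {x y : WeightSpace n} (hx : x ∈ closedAlcove n l)
    (hy : y ∈ closedAlcove n l) (hxy : y ∈ orbit l x) : y = x := by
  obtain ⟨g, rfl⟩ := hxy
  exact smul_eq_self_of_mem hl g hx hy

/-- Two points of one orbit in the closure of a common alcove are equal. -/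
theorem eq_of_not_sep (hl : 0 < l) {x y : WeightSpace n} (hxy : y ∈ orbit l x)
    (h : ∀ H, ¬ Sep l x y H) : y = x := by
  obtain ⟨z, hz, hzx, hzy, -, -⟩ := exists_regular_of_not_sep hl h
  obtain ⟨g, hg⟩ := exists_smul_mem_closedAlcove hl z
  refine smul_left_cancel g (eq_of_mem_closedAlcove hl
    (smul_mem_closedAlcove_of_not_sep hz hg hzx) (smul_mem_closedAlcove_of_not_sep hz hg hzy) ?_)
  obtain ⟨v, rfl⟩ := hxy
  refine ⟨g * v * g⁻¹, ?_⟩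
  change (g * v * g⁻¹) • g • x = g • v • x
  rw [mul_smul, inv_smul_smul, mul_smul]

/-- Among the translates of a dominant weight, the one that is not below any hyperplane through it
is the largest. -/
theorem bruhatLE_of_step (hl : 0 < l) {y z ν lam : WeightSpace n} (hy : y ∈ closedAlcove n l)
    (hz : z ∈ closedAlcove n l) (hν : ν ∈ realDominant n) {g : affineWeyl n l} (hgy : g • y = ν)
    (hgz : g • z = lam) (hup : ∀ H, val l H ν = 0 → 0 ≤ val l H lam) {w : affineWeyl n l}
    (hw : w • y = ν) : BruhatLE l (w • z) lam := by
  -- Among hyperplanes through `ν`, one separating `lam` from `w • z` has `w • z` below it;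
  -- reflecting in it goes up in the Bruhat order and lowers the count. When none is left, the two
  -- points share an alcove closure and coincide.
  induction hk : {H | val l H ν = 0 ∧ Sep l lam (w • z) H}.ncard using Nat.strong_induction_on
    generalizing w with
  | _ k ih =>
    by_cases h : ∃ H, val l H ν = 0 ∧ Sep l lam (w • z) H
    · obtain ⟨H, h0, hs⟩ := h
      have h1 : val l H (w • z) < 0 := by
        rw [Sep] at hs
        exact neg_of_mul_neg_right hs (hup H h0)
      have h2 : (refl l H * w) • y = ν := by
        rw [mul_smul, hw, refl_smul, reflect_eq_self l h0]
      refine Relation.ReflTransGen.head (b := (refl l H * w) • z) ⟨H, ?_, ?_⟩ (ih _ ?_ h2 rfl)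
      · rw [mul_smul, refl_smul, reflect_reflect]
      · rw [Sep, mul_smul, refl_smul, val_reflect_self]
        exact mul_neg_of_neg_of_pos (val_basePt_neg hl (pos_of_dominant hl hν h0)) (neg_pos.mpr h1)
      · rw [← hk, mul_smul, refl_smul]
        refine sep_reflect_lt hl hs (Q := fun K => val l K ν = 0) (fun K => ?_) h0
        rw [← val_smul_eq_zero, refl_smul, reflect_eq_self l h0]
    · push Not at h
      have h1 : w • z = lam := by
        refine eq_of_not_sep hl ⟨w * g⁻¹, ?_⟩ fun H => ?_
        · change (w * g⁻¹) • lam = _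
          rw [← hgz, mul_smul, inv_smul_smul]
        · by_cases h0 : val l H ν = 0
          · exact h H h0
          · have h2 := smul_mul_nonneg_of_mem hl hy hz g H
            have h3 := smul_mul_nonneg_of_mem hl hy hz w H
            rw [hgy, hgz] at h2
            rw [hw] at h3
            rw [Sep, not_lt]
            rcases lt_or_gt_of_ne h0 with h4 | h4
            · exact mul_nonneg_of_nonpos_of_nonpos (nonpos_of_mul_nonneg_right h2 h4)
                (nonpos_of_mul_nonneg_right h3 h4)
            · exact mul_nonneg (nonneg_of_mul_nonneg_right h2 h4)
                (nonneg_of_mul_nonneg_right h3 h4)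
      rw [h1]
      exact Relation.ReflTransGen.refl

end Bruhat

/-! ### Upward steps: bounded support and top coefficient of translated patterns. -/

section Translation

variable {n l : ℕ}

theorem not_sep_of_mem_facetClosure {x u : WeightSpace n} (h : u ∈ facetClosure l x)
    (H : Hyperplane n) : ¬ Sep l x u H := by
  intro hs
  have h1 := facetClosure_iff.mp h H
  rcases mul_neg_iff.mp hs with ⟨ha, hb⟩ | ⟨ha, hb⟩
  · exact absurd (h1.2.2 ha) (not_le.mpr hb)
  · exact absurd (h1.2.1 ha) (not_le.mpr hb)

theorem mem_facetClosure_of_not_sep {x u : WeightSpace n} (hx : ∀ H, val l H x ≠ 0)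
    (h : ∀ H, ¬ Sep l x u H) : u ∈ facetClosure l x := by
  rw [facetClosure_iff]
  intro H
  have h1 : 0 ≤ val l H x * val l H u := not_lt.mp (h H)
  exact ⟨fun h0 => absurd h0 (hx H), fun h2 => nonpos_of_mul_nonneg_right h1 h2,
    fun h2 => nonneg_of_mul_nonneg_right h1 h2⟩

theorem not_sep_of_common {x u v : WeightSpace n} (hx : IsRegular l x) (hu : u ∈ facetClosure l x)
    (hv : v ∈ facetClosure l x) (H : Hyperplane n) : ¬ Sep l u v H := by
  have hx' : val l H x ≠ 0 := fun h => hx H ((on_iff l H x).mpr h)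
  have h1 := facetClosure_iff.mp hu H
  have h2 := facetClosure_iff.mp hv H
  rw [Sep, not_lt]
  rcases lt_or_gt_of_ne hx' with h | h
  · exact mul_nonneg_of_nonpos_of_nonpos (h1.2.1 h) (h2.2.1 h)
  · exact mul_nonneg (h1.2.2 h) (h2.2.2 h)

theorem IsStep.not_sep {ν lam : WeightSpace n} (h : IsStep l ν lam) (H : Hyperplane n) :
    ¬ Sep l ν lam H := by
  obtain ⟨⟨x, hx, hu, hv⟩, -⟩ := h
  exact not_sep_of_common hx hu hv H

theorem IsStep.nonneg {ν lam : WeightSpace n} (h : IsStep l ν lam) {H : Hyperplane n}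
    (h0 : val l H ν = 0) : 0 ≤ val l H lam := by
  have := (h.2 H).1 ((on_iff l H ν).mpr h0)
  rwa [below_iff, not_lt] at this

theorem IsStep.nonpos {ν lam : WeightSpace n} (h : IsStep l ν lam) {H : Hyperplane n}
    (h0 : val l H lam = 0) : val l H ν ≤ 0 := by
  have := (h.2 H).2 ((on_iff l H lam).mpr h0)
  rwa [above_iff, not_lt] at this

/-- The midpoint of the two weights serves as the intermediate weight; it need not be integral. -/
theorem IsStep.exists_intermediate (hl : 0 < l) {ν lam : WeightSpace n} (h : IsStep l ν lam) :
    ∃ τ, IsIntermediate l ν lam τ := by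
  obtain ⟨z, hz, h1, h2, h3, h4⟩ := exists_regular_of_not_sep hl h.not_sep
  refine ⟨_, ⟨z, fun H => by rw [on_iff]; exact hz H, mem_facetClosure_of_not_sep hz h1,
    mem_facetClosure_of_not_sep hz h2, mem_facetClosure_of_not_sep hz h3⟩, fun H => ?_⟩
  rw [on_iff, on_iff, on_iff]
  exact h4 H

/-- A hyperplane separating the dominant `ν` from the fundamental alcove has `ν` above it, and an
upward step neither crosses it nor lands on it. -/
theorem IsStep.height_le (hl : 0 < l) {ν lam : WeightSpace n} (h : IsStep l ν lam)
    (hν : ν ∈ realDominant n) : height l ν ≤ height l lam := by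
  refine Set.ncard_le_ncard ?_ (sepSet_finite hl _ _ _)
  rintro H ⟨-, hs⟩
  refine ⟨trivial, ?_⟩
  have hk : 0 < H.2 := by
    by_contra! hk
    rw [Sep] at hs
    have h1 := neg_of_mul_neg_right hs (val_basePt_pos hl hk).le
    have h2 := hν H.1
    have h3 : (H.2 : ℝ) ≤ 0 := by exact_mod_cast hk
    have h4 : (H.2 : ℝ) * l ≤ 0 := mul_nonpos_of_nonpos_of_nonneg h3 (Nat.cast_nonneg l)
    rw [val] at h1
    linarith
  have h1 := val_basePt_neg hl hk
  have h2 := pos_of_mul_neg_right hs h1.le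
  refine mul_neg_of_neg_of_pos h1 (lt_of_le_of_ne ?_ fun h0 => ?_)
  · exact nonneg_of_mul_nonneg_right (not_lt.mp (h.not_sep H)) h2
  · exact absurd (h.nonpos h0.symm) (not_le.mpr h2)

/-- The weights of a translation in standard position: `ν`, `lam` and the intermediate weight are
the translates by `g` of the points `y`, `z` and `t` of the fundamental alcove. -/
structure Position (g : affineWeyl n l) (ν lam y z t : WeightSpace n) : Prop where
  y_mem : y ∈ closedAlcove n l
  z_mem : z ∈ closedAlcove n l
  t_mem : t ∈ closedAlcove n l
  smul_y : g • y = ν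
  smul_z : g • z = lam
  zero_iff : ∀ H, val l H t = 0 ↔ val l H y = 0 ∧ val l H z = 0

theorem IsIntermediate.exists_position (hl : 0 < l) {ν lam τ : WeightSpace n}
    (h : IsIntermediate l ν lam τ) :
    ∃ g y z t, Position (l := l) g ν lam y z t ∧ g • t = τ := by
  obtain ⟨⟨x, hx, h1, h2, h3⟩, h4⟩ := h
  have hx' : ∀ H, val l H x ≠ 0 := fun H h => hx H ((on_iff l H x).mpr h)
  obtain ⟨g, hg⟩ := exists_smul_mem_closedAlcove hl x
  have key : ∀ u, u ∈ facetClosure l x → g • u ∈ closedAlcove n l := fun u hu =>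
    smul_mem_closedAlcove_of_not_sep hx' hg (not_sep_of_mem_facetClosure hu)
  refine ⟨g⁻¹, g • ν, g • lam, g • τ, ⟨key _ h1, key _ h2, key _ h3, inv_smul_smul _ _,
    inv_smul_smul _ _, fun H => ?_⟩, inv_smul_smul _ _⟩
  rw [val_smul_eq_zero, val_smul_eq_zero, val_smul_eq_zero, ← on_iff, ← on_iff, ← on_iff]
  exact h4 _

theorem orbit_smul (g : affineWeyl n l) (x : WeightSpace n) : orbit l (g • x) = orbit l x :=
  MulAction.orbit_smul g x

theorem thetaLower_smul (g : affineWeyl n l) (x : WeightSpace n) :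
    thetaLower l (g • x) = thetaLower l x := by
  rw [thetaLower, orbit_smul, thetaLower]

theorem thetaUpper_smul (g : affineWeyl n l) (x : WeightSpace n) :
    thetaUpper l (g • x) = thetaUpper l x := by
  rw [thetaUpper, orbit_smul, thetaUpper]

/-- All weights that occur in `P` are dominant and at most `lam` in the Bruhat order. -/
def IsBounded (l : ℕ) (lam : WeightSpace n) (P : Pattern n) : Prop :=
  ∀ κ, P κ ≠ 0 → κ ∈ realDominant n ∧ BruhatLE l κ lam

theorem IsBounded.mono {κ lam : WeightSpace n} {P : Pattern n} (h : IsBounded l κ P)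
    (hκ : BruhatLE l κ lam) : IsBounded l lam P :=
  fun μ hμ => ⟨(h μ hμ).1, (h μ hμ).2.trans hκ⟩

theorem IsBounded.sub {lam : WeightSpace n} {P Q : Pattern n} (hP : IsBounded l lam P)
    (hQ : IsBounded l lam Q) : IsBounded l lam (P - Q) := by
  intro μ hμ
  by_cases h : P μ = 0
  · exact hQ μ fun h' => hμ (by rw [Finsupp.sub_apply, h, h', sub_zero])
  · exact hP μ h

theorem IsBounded.smul {lam : WeightSpace n} {P : Pattern n} (hP : IsBounded l lam P)
    (a : LaurentPolynomial ℤ) : IsBounded l lam (a • P) :=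
  fun μ hμ => hP μ fun h => hμ (by rw [Finsupp.smul_apply, h, smul_zero])

theorem IsBounded.sum {lam : WeightSpace n} {ι : Type*} {s : Finset ι} {R : ι → Pattern n}
    (hR : ∀ i ∈ s, IsBounded l lam (R i)) : IsBounded l lam (∑ i ∈ s, R i) := by
  intro μ hμ
  rw [Finsupp.finsetSum_apply] at hμ
  obtain ⟨i, hi, h⟩ := Finset.exists_ne_zero_of_sum_ne_zero hμ
  exact hR i hi μ h

theorem IsBounded.supported {g : affineWeyl n l} {ν y : WeightSpace n} {P : Pattern n}
    (h : IsBounded l ν P) (hg : g • y = ν) : Supported l y P := by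
  intro κ hκ
  refine ⟨?_, (h κ hκ).1⟩
  rw [← orbit_smul g, hg]
  exact (h κ hκ).2.mem_orbit

namespace Position

variable {g : affineWeyl n l} {ν lam y z t : WeightSpace n} {P : Pattern n}

theorem imp_y (h : Position g ν lam y z t) (H : Hyperplane n) (h0 : val l H t = 0) :
    val l H y = 0 := ((h.zero_iff H).mp h0).1

theorem imp_z (h : Position g ν lam y z t) (H : Hyperplane n) (h0 : val l H t = 0) :
    val l H z = 0 := ((h.zero_iff H).mp h0).2

theorem exists_of_ne_zero (hl : 0 < l) (h : Position g ν lam y z t) (hP : Supported l y P)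
    {w : affineWeyl n l} (hne : thetaUpper l t P (w • t) ≠ 0) : P (w • y) ≠ 0 := by
  have h1 := (supported_thetaUpper hl h.t_mem h.y_mem h.imp_y hP _ hne).2
  rw [thetaUpper_apply hl h.t_mem h.y_mem h.imp_y hP h1] at hne
  exact right_ne_zero_of_mul hne

/-- A Bruhat chain from `w • y` up to `ν` lifts to a chain on the orbit of `z` that ends at some
translate of `ν`; by `bruhatLE_of_step` all these translates are at most `lam`. -/
theorem isBounded (hl : 0 < l) (h : Position g ν lam y z t) (hstep : IsStep l ν lam)
    (hν : ν ∈ realDominant n) (hP : IsBounded l ν P) :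
    IsBounded l lam (thetaLower l z (thetaUpper l t P)) := by
  intro κ hκ
  have hs := hP.supported h.smul_y
  have hQ := supported_thetaUpper hl h.t_mem h.y_mem h.imp_y hs
  obtain ⟨h1, h2⟩ := supported_thetaLower hl h.t_mem h.z_mem h.imp_z hQ κ hκ
  refine ⟨h2, ?_⟩
  rw [thetaLower_apply hl h.t_mem h.z_mem h.imp_z hQ] at hκ
  obtain ⟨μ, hμ, hne⟩ := Finset.exists_ne_zero_of_sum_ne_zero hκ
  rw [Finsupp.mem_support_iff] at hμ
  obtain ⟨w, rfl⟩ := (hQ μ hμ).1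
  change thetaUpper l t P (w • t) ≠ 0 at hμ
  have h3 : κ ∈ facetClosure l (w • t) := by
    by_contra hc
    exact right_ne_zero_of_mul hne (if_neg fun h => hc h.2.2)
  rw [smul_mem_facetClosure_iff hl h.t_mem h.z_mem h.imp_z h1] at h3
  obtain ⟨-, h4⟩ := hP _ (h.exists_of_ne_zero hl hs hμ)
  obtain ⟨w', h5, h6⟩ := h4.lift hl h.y_mem h.z_mem rfl
  rw [h3]
  exact h6.trans (bruhatLE_of_step hl h.y_mem h.z_mem hν h.smul_y h.smul_z
    (fun H h0 => hstep.nonneg h0) h5)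

/-- Only the top weight contributes to the top weight of a translated pattern. -/
theorem smul_y_eq (hl : 0 < l) (h : Position g ν lam y z t) (hstep : IsStep l ν lam)
    (hν : ν ∈ realDominant n) (hlam : lam ∈ realDominant n) {w : affineWeyl n l}
    (hw : w • z = lam) (hle : BruhatLE l (w • y) ν) : w • y = ν := by
  rcases Relation.ReflTransGen.cases_tail hle with h0 | ⟨κ, h1, H, rfl, hs⟩
  · exact h0.symm
  exfalso
  obtain ⟨w', h2, h3⟩ := BruhatLE.lift hl h.y_mem h.z_mem h1 rfl
  obtain ⟨w'', h4, h5⟩ := BruhatLE.lift hl h.y_mem h.z_mem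
    (Relation.ReflTransGen.single ⟨H, rfl, hs⟩) h2
  have h6 : BruhatLE l (w' • z) lam := h5.trans (bruhatLE_of_step hl h.y_mem h.z_mem hν h.smul_y
    h.smul_z (fun H h0 => hstep.nonneg h0) h4)
  rw [hw] at h3
  have h7 := h6.antisymm hl h3
  -- Both `ν` and its mirror image in `H` share an alcove closure with `lam`, so `lam` lies on `H`.
  -- But `ν` is above `H`, against the upward step.
  have h8 : val l H lam = 0 := by
    have e1 := smul_mul_nonneg_of_mem hl h.y_mem h.z_mem w' H
    have e2 := smul_mul_nonneg_of_mem hl h.y_mem h.z_mem g H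
    rw [h2, h7, val_reflect_self] at e1
    rw [h.smul_y, h.smul_z] at e2
    have e3 : val l H ν * val l H lam = 0 := by linarith
    exact (mul_eq_zero.mp e3).resolve_left (right_ne_zero_of_mul (ne_of_lt hs))
  have h9 := pos_of_mul_neg_right hs (val_basePt_neg hl (pos_of_dominant hl hlam h8)).le
  exact absurd (hstep.nonpos h8) (not_le.mpr h9)

/-- The element `g⁻¹ * w` fixes `y` and `z`, hence their midpoint. The hyperplanes through the
midpoint are those through `t`, so `t` is fixed as well. -/
theorem smul_t_eq (hl : 0 < l) (h : Position g ν lam y z t) {w : affineWeyl n l}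
    (hy : w • y = ν) (hz : w • z = lam) : w • t = g • t := by
  have h1 : (g⁻¹ * w) • y = y := by rw [mul_smul, hy, inv_smul_eq_iff, h.smul_y]
  have h2 : (g⁻¹ * w) • z = z := by rw [mul_smul, hz, inv_smul_eq_iff, h.smul_z]
  have hm : y + (1 / 2 : ℝ) • (z - y) ∈ closedAlcove n l := by
    intro H
    have e1 := closedAlcove_nonneg h.y_mem H
    have e2 := closedAlcove_nonneg h.z_mem H
    rw [Sep, val_add_smul_sub, not_lt]
    nlinarith
  have hfix : (g⁻¹ * w) • (y + (1 / 2 : ℝ) • (z - y)) = y + (1 / 2 : ℝ) • (z - y) := by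
    obtain ⟨σ, m, hσ⟩ := exists_coord_smul (g⁻¹ * w)
    have hmid : ∀ i, coord (y + (1 / 2 : ℝ) • (z - y)) i = 1 / 2 * coord y i + 1 / 2 * coord z i := by
      intro i
      simp only [coord, Submodule.coe_add, Submodule.coe_sub, Submodule.coe_smul, Pi.add_apply,
        Pi.sub_apply, Pi.smul_apply, smul_eq_mul]
      ring
    refine ext_coord fun i => ?_
    have e1 := hσ y i
    have e2 := hσ z i
    rw [h1] at e1
    rw [h2] at e2
    rw [hσ, hmid, hmid, e1, e2]
    ring
  have h3 := stabilizer_le hl hm (z := t) (fun H h0 => ?_) hfix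
  · rw [mul_smul, inv_smul_eq_iff] at h3
    exact h3
  · rw [h.zero_iff]
    rw [val_add_smul_sub] at h0
    have e1 := not_lt.mp (fun hs => (h.y_mem H) hs)
    have e2 := not_lt.mp (fun hs => (h.z_mem H) hs)
    have e3 := val_basePt_ne hl H
    rcases lt_or_gt_of_ne e3 with e | e
    · have f1 := nonpos_of_mul_nonneg_right e1 e
      have f2 := nonpos_of_mul_nonneg_right e2 e
      constructor <;> linarith
    · have f1 := nonneg_of_mul_nonneg_right e1 e
      have f2 := nonneg_of_mul_nonneg_right e2 e
      constructor <;> linarith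

/-- For the intermediate weight `g • t` both exponents u and o vanish: the step conditions force any
hyperplane that would be counted to contain `ν` and `lam`, hence `g • t`. All other weights are
excluded by `smul_y_eq` and `smul_t_eq`. -/
theorem apply_top (hl : 0 < l) (h : Position g ν lam y z t) (hstep : IsStep l ν lam)
    (hν : ν ∈ realDominant n) (hlam : lam ∈ realDominant n) (hP : IsBounded l ν P)
    (h1 : P ν = 1) : thetaLower l z (thetaUpper l t P) lam = 1 := by
  classical
  have hs := hP.supported h.smul_y
  have hQ := supported_thetaUpper hl h.t_mem h.y_mem h.imp_y hs
  have hdt : g • t ∈ realDominant n :=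
    dominant_of_smul hl h.t_mem h.z_mem h.imp_z (by rwa [h.smul_z])
  have hyt := smul_mul_nonneg_of_mem hl h.y_mem h.t_mem g
  have hzt := smul_mul_nonneg_of_mem hl h.z_mem h.t_mem g
  have hzero : ∀ H, val l H (g • t) = 0 ↔ val l H ν = 0 ∧ val l H lam = 0 := by
    intro H
    rw [← h.smul_y, ← h.smul_z, val_smul_eq_zero, val_smul_eq_zero, val_smul_eq_zero]
    exact h.zero_iff _
  rw [h.smul_y] at hyt
  rw [h.smul_z] at hzt
  have hu : uNum l (g • t) ν = 0 := by
    rw [uNum, Set.ncard_eq_zero ((on_finite hl ν).subset fun H h => (on_iff l H _).mp h.1),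
      Set.eq_empty_iff_forall_notMem]
    rintro H ⟨h2, h3⟩
    rw [on_iff] at h2
    rw [below_iff] at h3
    have h4 := nonpos_of_mul_nonneg_left (hzt H) h3
    exact h3.ne ((hzero H).mpr ⟨h2, le_antisymm h4 (hstep.nonneg h2)⟩)
  have ho : oNum l (g • t) lam = 0 := by
    rw [oNum, Set.ncard_eq_zero ((on_finite hl lam).subset fun H h => (on_iff l H _).mp h.1),
      Set.eq_empty_iff_forall_notMem]
    rintro H ⟨h2, h3⟩
    rw [on_iff] at h2
    rw [above_iff] at h3
    have h4 := nonneg_of_mul_nonneg_left (hyt H) h3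
    exact h3.ne' ((hzero H).mpr ⟨le_antisymm (hstep.nonpos h2) h4, h2⟩)
  have hτ : thetaUpper l t P (g • t) = 1 := by
    rw [thetaUpper_apply hl h.t_mem h.y_mem h.imp_y hs hdt, h.smul_y, h1, hu]
    simp
  rw [thetaLower_apply hl h.t_mem h.z_mem h.imp_z hQ, Finset.sum_eq_single (g • t)]
  · rw [hτ, if_pos, ho]
    · simp
    · refine ⟨⟨g, h.smul_z⟩, hlam, ?_⟩
      rw [smul_mem_facetClosure_iff hl h.t_mem h.z_mem h.imp_z ⟨g, h.smul_z⟩, h.smul_z]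
  · intro μ hμ hne
    rw [Finsupp.mem_support_iff] at hμ
    rw [if_neg, mul_zero]
    rintro ⟨hc1, -, hc⟩
    obtain ⟨w, rfl⟩ := (hQ μ hμ).1
    change thetaUpper l t P (w • t) ≠ 0 at hμ
    change lam ∈ facetClosure l (w • t) at hc
    rw [smul_mem_facetClosure_iff hl h.t_mem h.z_mem h.imp_z hc1] at hc
    have h5 := h.smul_y_eq hl hstep hν hlam hc.symm
      (hP _ (h.exists_of_ne_zero hl hs hμ)).2
    exact hne (h.smul_t_eq hl h5 hc.symm)
  · intro hc
    rw [Finsupp.notMem_support_iff.mp hc, zero_mul]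

end Position

end Translation

/-! ### Subtracting self-dual multiples of lower patterns. -/

section Subtraction

variable {n l : ℕ}

/-- Keep the constant term and complete each term of negative degree by its mirror image under q ↦
q⁻¹. -/
theorem exists_selfDual_part (a : LaurentPolynomial ℤ) :
    ∃ γ : LaurentPolynomial ℤ, invert γ = γ ∧ IsPositive (a - γ) := by
  induction a using LaurentPolynomial.induction_on' with
  | add p q hp hq =>
    obtain ⟨γ, h1, h2⟩ := hp
    obtain ⟨δ, h3, h4⟩ := hq
    exact ⟨γ + δ, by rw [map_add, h1, h3], by rw [add_sub_add_comm]; exact h2.add h4⟩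
  | C_mul_T k a =>
    have key : ∀ (b : ℤ) (m : ℕ), IsPositive (C b * T ((m + 1 : ℕ) : ℤ)) := fun b m =>
      ⟨Polynomial.C b * Polynomial.X ^ m, by
        rw [← Polynomial.toLaurent_C_mul_X_pow]
        congr 1
        ring⟩
    rcases lt_trichotomy k 0 with hk | rfl | hk
    · refine ⟨C a * (T k + T (-k)), ?_, ?_⟩
      · rw [map_mul, map_add, invert_C, invert_T, invert_T, neg_neg, add_comm]
      · obtain ⟨m, hm⟩ : ∃ m : ℕ, -k = (m + 1 : ℕ) := ⟨(-k - 1).toNat, by omega⟩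
        have e : C a * T k - C a * (T k + T (-k)) = -(C a * T ((m + 1 : ℕ) : ℤ)) := by
          rw [← hm]; ring
        rw [e]
        exact (key a m).neg
    · exact ⟨C a * T 0, by rw [map_mul, invert_C, invert_T, neg_zero], by
        rw [sub_self]; exact IsPositive.zero⟩
    · obtain ⟨m, rfl⟩ : ∃ m : ℕ, k = (m + 1 : ℕ) := ⟨(k - 1).toNat, by omega⟩
      exact ⟨0, map_zero _, by rw [sub_zero]; exact key a m⟩

/-- Self-dual multiples of lower patterns can be subtracted so that finitely many given
coefficients come to lie in `q ℤ[q]`. -/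
theorem exists_subtraction (hl : 0 < l) (V : Finset (WeightSpace n)) (R : WeightSpace n → Pattern n)
    (hR : ∀ κ ∈ V, IsBounded l κ (R κ) ∧ R κ κ = 1) (P : Pattern n) :
    ∃ γ : WeightSpace n → LaurentPolynomial ℤ, (∀ κ, invert (γ κ) = γ κ) ∧
      ∀ κ ∈ V, IsPositive ((P - ∑ μ ∈ V, γ μ • R μ) κ) := by
  classical
  induction V using Finset.induction_on_max_value (height l) generalizing P with
  | empty => exact ⟨0, fun _ => map_zero _, by simp⟩
  | insert a s ha hmax ih =>
    -- The weight `a` has maximal height and is treated before the rest of the set; the patterns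
    -- subtracted afterwards have coefficient 0 at `a`, being bounded by other weights of no larger
    -- height.
    obtain ⟨c, hc1, hc2⟩ := exists_selfDual_part (P a)
    obtain ⟨γ, h1, h2⟩ := ih (fun κ hκ => hR κ (Finset.mem_insert_of_mem hκ)) (P - c • R a)
    have hne : ∀ μ ∈ s, μ ≠ a := fun μ hμ h => ha (h ▸ hμ)
    refine ⟨Function.update γ a c, fun κ => ?_, fun κ hκ => ?_⟩
    · by_cases h : κ = a
      · rw [h, Function.update_self, hc1]
      · rw [Function.update_of_ne h, h1]
    · have e : P - ∑ μ ∈ insert a s, Function.update γ a c μ • R μ =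
          P - c • R a - ∑ μ ∈ s, γ μ • R μ := by
        have hs : ∑ μ ∈ s, Function.update γ a c μ • R μ = ∑ μ ∈ s, γ μ • R μ :=
          Finset.sum_congr rfl fun μ hμ => by rw [Function.update_of_ne (hne μ hμ)]
        rw [Finset.sum_insert ha, Function.update_self, hs, sub_add_eq_sub_sub]
      rw [e]
      rcases Finset.mem_insert.mp hκ with rfl | hκ
      · have h0 : (∑ μ ∈ s, γ μ • R μ) κ = 0 := by
          rw [Finsupp.finsetSum_apply]
          refine Finset.sum_eq_zero fun μ hμ => ?_
          rw [Finsupp.smul_apply, smul_eq_mul]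
          by_contra hc
          have h3 := ((hR μ (Finset.mem_insert_of_mem hμ)).1 κ (right_ne_zero_of_mul hc)).2
          rcases h3.eq_or_height_lt hl with h4 | h4
          · exact hne μ hμ h4.symm
          · exact absurd (hmax μ hμ) (not_le.mpr h4)
        rw [Finsupp.sub_apply, h0, sub_zero, Finsupp.sub_apply, Finsupp.smul_apply,
          (hR κ (Finset.mem_insert_self _ _)).2, smul_eq_mul, mul_one]
        exact hc2
      · exact h2 κ hκ

end Subtraction

/-! ### Self-duality as an invariant of the procedure, and uniqueness. -/

section Uniqueness

variable {n l : ℕ}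

/-- The pattern `P` on the orbit of `x` is self-dual. -/
def OrbitSelfDual (hl : 0 < l) (x : WeightSpace n) (P : Pattern n) : Prop :=
  ∃ (y : WeightSpace n) (hy : y ∈ closedAlcove n l), x ∈ orbit l y ∧ SelfDual hl hy P

theorem OrbitSelfDual.selfDual {hl : 0 < l} {x y : WeightSpace n} {P : Pattern n}
    (h : OrbitSelfDual hl x P) (hy : y ∈ closedAlcove n l) (hx : x ∈ orbit l y) :
    SelfDual hl hy P := by
  obtain ⟨z, hz, h1, h2⟩ := h
  have : y = z := by
    refine eq_of_mem_closedAlcove hl hz hy ?_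
    rw [orbit, ← MulAction.orbit_eq_iff.mpr h1]
    exact MulAction.mem_orbit_symm.mp hx
  subst this
  exact h2

theorem IsIndecomposable.supported {lam y : WeightSpace n} {P : Pattern n}
    (h : IsIndecomposable l lam P) (hlam : lam ∈ realDominant n) (hy : lam ∈ orbit l y) :
    Supported l y P := by
  intro κ hκ
  by_cases hne : κ = lam
  · rw [hne]; exact ⟨hy, hlam⟩
  · obtain ⟨h1, h2, -⟩ := h.2 κ (Finsupp.mem_support_iff.mpr hκ) hne
    rw [orbit, MulAction.orbit_eq_iff.mpr hy] at h1
    exact ⟨h1, h2⟩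

theorem IsIndecomposable.isPositive {lam κ : WeightSpace n} {P : Pattern n}
    (h : IsIndecomposable l lam P) (hne : κ ≠ lam) : IsPositive (P κ) := by
  by_cases h0 : P κ = 0
  · rw [h0]; exact IsPositive.zero
  · exact (h.2 κ (Finsupp.mem_support_iff.mpr h0) hne).2.2.2

/-- An indecomposable self-dual pattern is determined by its highest weight. -/
theorem IsIndecomposable.unique (hl : 0 < l) {lam : WeightSpace n} (hlam : lam ∈ realDominant n)
    {P Q : Pattern n} (hP : IsIndecomposable l lam P) (hQ : IsIndecomposable l lam Q)
    (hdP : OrbitSelfDual hl lam P) (hdQ : OrbitSelfDual hl lam Q) : P = Q := by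
  obtain ⟨y, hy, h1, h2⟩ := hdP
  have h3 := hdQ.selfDual hy h1
  have h4 := hP.supported hlam h1
  have h5 := hQ.supported hlam h1
  refine sub_eq_zero.mp (eq_zero_of_selfDual_pattern hl hy (fun κ hκ => ?_) (h2.sub hl hy h3)
    fun κ => ?_)
  · by_cases h : P κ = 0
    · exact h5 κ fun h' => hκ (by rw [Finsupp.sub_apply, h, h', sub_zero])
    · exact h4 κ h
  · rw [Finsupp.sub_apply]
    by_cases hne : κ = lam
    · rw [hne, hP.1, hQ.1, sub_self]
      exact IsPositive.zero
    · exact (hP.isPositive hne).sub (hQ.isPositive hne)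

theorem mem_closedAlcove_of_fundamental (hl : 0 < l) {x : WeightSpace n}
    (h : x ∈ fundamentalAlcove l) : x ∈ closedAlcove n l := by
  intro H
  have h1 := h.1 H.1
  have h2 := h.2 H.1
  have hl' : (0 : ℝ) < l := by exact_mod_cast hl
  rw [Sep, not_lt]
  rcases le_or_gt H.2 0 with hk | hk
  · have hk' : (H.2 : ℝ) ≤ 0 := by exact_mod_cast hk
    refine mul_nonneg (val_basePt_pos hl hk).le ?_
    rw [val]
    nlinarith
  · have hk' : (1 : ℝ) ≤ H.2 := by exact_mod_cast hk
    refine mul_nonneg_of_nonpos_of_nonpos (val_basePt_neg hl hk).le ?_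
    rw [val]
    nlinarith

theorem isIndecomposable_single (lam : WeightSpace n) :
    IsIndecomposable l lam (Finsupp.single lam 1) := by
  classical
  refine ⟨Finsupp.single_eq_same, fun κ hκ hne => ?_⟩
  rw [Finsupp.mem_support_iff, Finsupp.single_eq_of_ne hne] at hκ
  exact absurd rfl hκ

/-- Self-duality is an invariant of every run, for all choices of intermediate weights and
subtracted terms. Together with indecomposability it pins down the result. -/
theorem Yields.spec (hl : 0 < l) {S : Set (WeightSpace n)} (hS : S ⊆ realDominant n)
    {q : List (WeightSpace n)} {Q : Pattern n} (h : Yields l S q Q) :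
    ∀ {lam p}, q = lam :: p →
      lam ∈ S ∧ IsIndecomposable l lam Q ∧ OrbitSelfDual hl lam Q := by
  induction h with
  | @start ν hν hfund =>
    rintro lam p hp
    obtain ⟨rfl, -⟩ := List.cons.inj hp
    have hy := mem_closedAlcove_of_fundamental hl hfund
    exact ⟨hν, isIndecomposable_single _, ν, hy, ⟨1, one_smul _ _⟩, selfDual_single hl hy (hS hν)⟩
  | @step ν lam τ p P hP hlam hstep htau m kap path R γ hR hkap hγ hQ ihP ihR =>
    rintro lam' p' hp
    obtain ⟨rfl, -⟩ := List.cons.inj hp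
    refine ⟨hlam, hQ, ?_⟩
    obtain ⟨hν, h1, h2⟩ := ihP rfl
    obtain ⟨g, y, z, t, hpos, rfl⟩ := htau.exists_position hl
    have hyν : ν ∈ orbit l y := ⟨g, hpos.smul_y⟩
    have hzlam : lam ∈ orbit l z := ⟨g, hpos.smul_z⟩
    refine ⟨z, hpos.z_mem, hzlam, ?_⟩
    have e : thetaLower l lam = thetaLower l z := by rw [← hpos.smul_z, thetaLower_smul]
    rw [e, thetaUpper_smul]
    refine SelfDual.sub_sum hl hpos.z_mem _ ?_ hγ fun i => ?_
    · exact SelfDual.translate hl hpos.y_mem hpos.t_mem hpos.z_mem hpos.imp_y hpos.imp_z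
        (h1.supported (hS hν) hyν) (h2.selfDual hpos.y_mem hyν)
    · refine (ihR i rfl).2.2.selfDual hpos.z_mem ?_
      have := (hkap i).1
      rwa [orbit, MulAction.orbit_eq_iff.mpr hzlam] at this

end Uniqueness

/-! ### The procedure can be carried out along every path. -/

section Existence

variable {n l : ℕ}

theorem IsPath.head_mem {S : Set (WeightSpace n)} {lam : WeightSpace n} {p : List (WeightSpace n)}
    (h : IsPath l S (lam :: p)) : lam ∈ S := by
  cases h with
  | start h _ => exact h
  | step _ h _ => exact h

/-- One step of the singular combinatorics, given patterns for all smaller weights. -/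
theorem exists_yields_step (hl : 0 < l) {S : Set (WeightSpace n)} (hS : S ⊆ realDominant n)
    {ν lam : WeightSpace n} {p : List (WeightSpace n)} {P : Pattern n}
    (hP : Yields l S (ν :: p) P) (hb : IsBounded l ν P) (hlam : lam ∈ S) (hstep : IsStep l ν lam)
    (hlow : ∀ κ, BruhatLE l κ lam → κ ∈ realDominant n → κ ≠ lam →
      ∃ p' Q, Yields l S (κ :: p') Q ∧ IsBounded l κ Q) :
    ∃ Q, Yields l S (lam :: ν :: p) Q ∧ IsBounded l lam Q := by
  classical
  obtain ⟨hν, hind, -⟩ := hP.spec hl hS rfl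
  obtain ⟨τ, hτ⟩ := hstep.exists_intermediate hl
  obtain ⟨g, y, z, t, hpos, hgt⟩ := hτ.exists_position hl
  set P' := thetaLower l lam (thetaUpper l τ P) with hP'
  have e : P' = thetaLower l z (thetaUpper l t P) := by
    rw [hP', ← hgt, ← hpos.smul_z, thetaLower_smul, thetaUpper_smul]
  have hbP' : IsBounded l lam P' := e ▸ hpos.isBounded hl hstep (hS hν) hb
  have htop : P' lam = 1 := e ▸ hpos.apply_top hl hstep (hS hν) (hS hlam) hb hind.1
  -- All dominant weights strictly below `lam` in the Bruhat order are treated at once; some of the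
  -- subtracted multiples may be 0.
  have hfin : {κ | BruhatLE l κ lam ∧ κ ∈ realDominant n ∧ κ ≠ lam}.Finite :=
    (bruhatLE_finite hl lam).subset fun κ h => h.1
  set V := hfin.toFinset with hV
  have hmem : ∀ κ, κ ∈ V ↔ BruhatLE l κ lam ∧ κ ∈ realDominant n ∧ κ ≠ lam := fun κ => by
    rw [hV, Set.Finite.mem_toFinset]; rfl
  choose! path R hY hBd using fun κ (h : κ ∈ V) =>
    hlow κ ((hmem κ).mp h).1 ((hmem κ).mp h).2.1 ((hmem κ).mp h).2.2
  obtain ⟨γ, hγ, hpos'⟩ := exists_subtraction hl V R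
    (fun κ hκ => ⟨hBd κ hκ, ((hY κ hκ).spec hl hS rfl).2.1.1⟩) P'
  have hbR : ∀ κ ∈ V, IsBounded l lam (γ κ • R κ) := fun κ hκ =>
    ((hBd κ hκ).smul _).mono ((hmem κ).mp hκ).1
  have hbQ : IsBounded l lam (P' - ∑ κ ∈ V, γ κ • R κ) := hbP'.sub (IsBounded.sum hbR)
  have hQ : IsIndecomposable l lam (P' - ∑ κ ∈ V, γ κ • R κ) := by
    refine ⟨?_, fun κ hκ hne => ?_⟩
    · rw [Finsupp.sub_apply, htop, Finsupp.finsetSum_apply, Finset.sum_eq_zero, sub_zero]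
      intro κ hκ
      rw [Finsupp.smul_apply, smul_eq_mul]
      by_contra hc
      exact ((hmem κ).mp hκ).2.2
        (((hmem κ).mp hκ).1.antisymm hl (hBd κ hκ lam (right_ne_zero_of_mul hc)).2)
    · obtain ⟨h1, h2⟩ := hbQ κ (Finsupp.mem_support_iff.mp hκ)
      exact ⟨h2.mem_orbit, h1, ⟨h2.weightLE hl (hS hlam), hne⟩,
        hpos' κ ((hmem κ).mpr ⟨h2, h1, hne⟩)⟩
  refine ⟨_, ?_, hbQ⟩
  have hsum : ∑ κ ∈ V, γ κ • R κ =
      ∑ i : Fin V.card, γ (V.equivFin.symm i) • R (V.equivFin.symm i) := by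
    rw [Equiv.sum_comp V.equivFin.symm fun κ : V => γ κ • R κ]
    exact (Finset.sum_coe_sort V fun κ => γ κ • R κ).symm
  rw [hsum] at hQ ⊢
  have hi : ∀ i, (V.equivFin.symm i : WeightSpace n) ∈ V := fun i => (V.equivFin.symm i).2
  exact Yields.step hP hlam hstep hτ (fun i => (V.equivFin.symm i : WeightSpace n))
    (fun i => path (V.equivFin.symm i)) (fun i => R (V.equivFin.symm i))
    (fun i => γ (V.equivFin.symm i)) (fun i => hY _ (hi i))
    (fun i => ⟨((hmem _).mp (hi i)).1.mem_orbit,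
      ((hmem _).mp (hi i)).1.weightLE hl (hS hlam), ((hmem _).mp (hi i)).2.2⟩)
    (fun i => hγ _) hQ

/-- Two nested inductions. The inner one follows the path, along which heights never decrease; the
outer one, on a bound for the height, supplies the patterns to be subtracted, whose weights have
strictly smaller height. `hreach` provides paths to them inside `S`. -/
theorem exists_yields (hl : 0 < l) {S : Set (WeightSpace n)} (hS : S ⊆ realDominant n)
    (hreach : ∀ lam p κ, IsPath l S (lam :: p) → κ ∈ orbit l lam → κ ∈ realDominant n →
      ∃ p', IsPath l S (κ :: p')) :
    ∀ (N : ℕ) {q : List (WeightSpace n)}, IsPath l S q → ∀ {lam p}, q = lam :: p →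
      height l lam < N → ∃ Q, Yields l S (lam :: p) Q ∧ IsBounded l lam Q := by
  intro N
  induction N with
  | zero => exact fun _ _ _ _ h => absurd h (Nat.not_lt_zero _)
  | succ N ih =>
    intro q hq
    induction hq with
    | @start ν hν hfund =>
      rintro lam p hp -
      obtain ⟨rfl, rfl⟩ := List.cons.inj hp
      refine ⟨_, Yields.start hν hfund, fun κ hκ => ?_⟩
      by_cases h : κ = ν
      · rw [h]; exact ⟨hS hν, Relation.ReflTransGen.refl⟩
      · exact absurd (Finsupp.single_eq_of_ne h) hκ
    | @step ν lam p hp hlam hstep ihp =>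
      rintro lam' p' hp' hlt
      obtain ⟨rfl, rfl⟩ := List.cons.inj hp'
      obtain ⟨P, hP, hb⟩ := ihp rfl ((hstep.height_le hl (hS hp.head_mem)).trans_lt hlt)
      refine exists_yields_step hl hS hP hb hlam hstep fun κ hκ hdom hne => ?_
      obtain ⟨p', hp'⟩ := hreach lam _ κ (hp.step hlam hstep) hκ.mem_orbit hdom
      have h1 := (hκ.eq_or_height_lt hl).resolve_left hne
      obtain ⟨Q, h2, h3⟩ := ih hp' rfl (by omega)
      exact ⟨p', Q, h2, h3⟩

end Existence

/-! ### Construction of real and integral paths. -/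

section Paths

variable {n l : ℕ}

theorem isStep_of_le (hl : 0 < l) {ν lam : WeightSpace n} (hle : ∀ α, level ν α ≤ level lam α)
    (hsep : ∀ H, ¬ Sep l ν lam H) : IsStep l ν lam := by
  obtain ⟨z, hz, h1, h2, -, -⟩ := exists_regular_of_not_sep hl hsep
  refine ⟨⟨z, fun H => by rw [on_iff]; exact hz H, mem_facetClosure_of_not_sep hz h1,
    mem_facetClosure_of_not_sep hz h2⟩, fun H => ?_⟩
  have h := hle H.1
  rw [on_iff, below_iff, on_iff, above_iff, not_lt, not_lt]
  simp only [val]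
  exact ⟨fun h0 => by linarith, fun h0 => by linarith⟩

theorem dominant_sep_iff (hl : 0 < l) {x : WeightSpace n} (hx : x ∈ realDominant n)
    (H : Hyperplane n) : Sep l (basePt n l) x H ↔ 0 < H.2 ∧ 0 < val l H x := by
  rw [Sep]
  rcases le_or_gt H.2 0 with hk | hk
  · have h1 := val_basePt_pos hl hk
    have h2 := hx H.1
    have h3 : (H.2 : ℝ) ≤ 0 := by exact_mod_cast hk
    have h4 : (H.2 : ℝ) * l ≤ 0 := mul_nonpos_of_nonpos_of_nonneg h3 (Nat.cast_nonneg l)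
    have h5 : 0 < val l H x := by rw [val]; linarith
    exact ⟨fun h => absurd h (not_lt.mpr (mul_pos h1 h5).le), fun h => absurd h.1 (not_lt.mpr hk)⟩
  · have h1 := val_basePt_neg hl hk
    exact ⟨fun h => ⟨hk, pos_of_mul_neg_right h h1.le⟩, fun h => mul_neg_of_neg_of_pos h1 h.2⟩

/-- The point of the ray from `-ρ` through `x` with parameter `T`. -/
noncomputable def rayPt (x : WeightSpace n) (T : ℝ) : WeightSpace n := T • (x + rho n) - rho n

theorem level_rayPt (x : WeightSpace n) (T : ℝ) (α : PosRoot n) :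
    level (rayPt x T) α = T * level x α := by
  simp only [level, rayPt, pairing, Submodule.coe_add, Submodule.coe_sub, Submodule.coe_smul,
    Pi.add_apply, Pi.sub_apply, Pi.smul_apply, smul_eq_mul]
  ring

/-- Every real dominant weight is the end point of a path of real dominant weights. -/
theorem exists_isPath_real (hl : 0 < l) (x : WeightSpace n) (hx : x ∈ realDominant n) :
    ∃ p, IsPath l (realDominant n) (x :: p) := by
  induction hk : height l x using Nat.strong_induction_on generalizing x with
  | _ k ih =>
    have hl' : (0 : ℝ) < l := by exact_mod_cast hl
    by_cases hf : x ∈ fundamentalAlcove l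
    · exact ⟨[], IsPath.start hx hf⟩
    have hne : ∃ α, (l : ℝ) < level x α := by
      by_contra! hc
      exact hf ⟨hx, hc⟩
    obtain ⟨α, hα⟩ := hne
    have hfin := sep_finite hl (basePt n l) x
    -- The ray from `-ρ` to `x` meets a hyperplane at the parameter `k l / level x α`. The chosen
    -- `H` is the last one met before `x`, so the segment from that point to `x` is an upward step,
    -- and `H` drops out of the height.
    obtain ⟨H, hH, hmax⟩ := Set.exists_max_image _ (fun H : Hyperplane n => H.2 * l / level x H.1)
      hfin ⟨(α, 1), (dominant_sep_iff hl hx _).mpr ⟨one_pos, by simpa [val] using hα⟩⟩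
    obtain ⟨hk1, hv⟩ := (dominant_sep_iff hl hx H).mp hH
    have hk1' : (0 : ℝ) < H.2 := by exact_mod_cast hk1
    rw [val, sub_pos] at hv
    set T : ℝ := H.2 * l / level x H.1 with hT
    have hT0 : 0 < T := div_pos (mul_pos hk1' hl') (hx H.1)
    have hT1 : T < 1 := (div_lt_one (hx H.1)).mpr hv
    have hlt : ∀ β, T * level x β < level x β := fun β => mul_lt_of_lt_one_left (hx β) hT1
    have hzdom : rayPt x T ∈ realDominant n := fun β => by
      rw [level_rayPt]; exact mul_pos hT0 (hx β)
    have hstep : IsStep l (rayPt x T) x := by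
      refine isStep_of_le hl (fun β => by rw [level_rayPt]; exact (hlt β).le) fun K hs => ?_
      have h1 := hlt K.1
      have h2 := hx K.1
      rw [Sep, val, val, level_rayPt] at hs
      rcases mul_neg_iff.mp hs with ⟨ha, hb⟩ | ⟨ha, hb⟩
      · linarith
      · have h3 : 0 < (K.2 : ℝ) * l := by linarith [mul_pos hT0 h2]
        have h4 : (0 : ℝ) < K.2 := pos_of_mul_pos_left h3 hl'.le
        have h5 := hmax K ((dominant_sep_iff hl hx K).mpr ⟨by exact_mod_cast h4, hb⟩)
        rw [div_le_iff₀ h2] at h5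
        linarith
    have hheight : height l (rayPt x T) < height l x := by
      refine Set.ncard_lt_ncard ?_ (sepSet_finite hl _ _ _)
      rw [Set.ssubset_iff_of_subset]
      · refine ⟨H, ⟨trivial, hH⟩, fun hc => ?_⟩
        have := ((dominant_sep_iff hl hzdom H).mp hc.2).2
        rw [val, level_rayPt, hT, div_mul_cancel₀ _ (hx H.1).ne', sub_self] at this
        exact lt_irrefl _ this
      · rintro K ⟨-, hK⟩
        rw [dominant_sep_iff hl hzdom, val, level_rayPt] at hK
        refine ⟨trivial, (dominant_sep_iff hl hx K).mpr ⟨hK.1, ?_⟩⟩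
        rw [val]
        linarith [hlt K.1]
    obtain ⟨p, hp⟩ := ih _ (hk ▸ hheight) _ hzdom rfl
    exact ⟨_, hp.step hx hstep⟩

theorem rho_apply (a : Fin (n + 1)) : (rho n).1 a = n / 2 - a := by
  have h1 : (rho n).1 a = 1 / 2 * ∑ α : PosRoot n, ((rootVec α).1 a) := by
    simp [rho, Finset.sum_apply]
  have h2 : ∑ α : PosRoot n, ((rootVec α).1 a) = ∑ i, ∑ j : Fin (n + 1),
      if i < j then ((if a = i then (1 : ℝ) else 0) - if a = j then 1 else 0) else 0 := by
    rw [← Fintype.sum_prod_type' fun i j : Fin (n + 1) =>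
      if i < j then ((if a = i then (1 : ℝ) else 0) - if a = j then 1 else 0) else 0,
      ← Finset.sum_filter, ← Finset.sum_subtype_eq_sum_filter]
    simp [rootVec, Pi.single_apply, Finset.subtype_univ]
  have h3 : ∀ i j : Fin (n + 1),
      (if i < j then ((if a = i then (1 : ℝ) else 0) - if a = j then 1 else 0) else 0) =
      (if a = i then if a < j then 1 else 0 else 0) -
        (if a = j then if i < a then 1 else 0 else 0) := by
    intro i j
    split_ifs <;> simp_all <;> omega
  have h4 : ∑ j : Fin (n + 1), (if a < j then (1 : ℝ) else 0) = n - a := by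
    rw [Finset.sum_boole]
    have : (Finset.univ.filter fun j => a < j) = Finset.Ioi a := by ext; simp
    rw [this, Fin.card_Ioi, Nat.add_sub_cancel, Nat.cast_sub (Nat.lt_succ_iff.mp a.2)]
  have h5 : ∑ i : Fin (n + 1), (if i < a then (1 : ℝ) else 0) = a := by
    rw [Finset.sum_boole]
    have : (Finset.univ.filter fun j => j < a) = Finset.Iio a := by ext; simp
    rw [this, Fin.card_Iio]
  have h6 : ∑ i : Fin (n + 1), ∑ j : Fin (n + 1),
      (if a = i then if a < j then (1 : ℝ) else 0 else 0) = n - a := by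
    rw [Finset.sum_comm]
    simp only [Finset.sum_ite_eq, Finset.mem_univ, if_true]
    exact h4
  have h7 : ∑ i : Fin (n + 1), ∑ j : Fin (n + 1),
      (if a = j then if i < a then (1 : ℝ) else 0 else 0) = a := by
    simp only [Finset.sum_ite_eq, Finset.mem_univ, if_true]
    exact h5
  rw [h1, h2]
  simp only [h3, Finset.sum_sub_distrib]
  rw [h6, h7]
  ring

theorem level_eq_pairing (x : WeightSpace n) (α : PosRoot n) :
    level x α = pairing x α + ((α.1.2 : ℕ) - (α.1.1 : ℕ)) := by
  simp only [level, pairing, Submodule.coe_add, Pi.add_apply, rho_apply]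
  ring

theorem one_le_index_sub (α : PosRoot n) : (1 : ℝ) ≤ (α.1.2 : ℕ) - (α.1.1 : ℕ) := by
  have h : (α.1.1 : ℕ) + 1 ≤ (α.1.2 : ℕ) := α.2
  have : ((α.1.1 : ℕ) : ℝ) + 1 ≤ (α.1.2 : ℕ) := by exact_mod_cast h
  linarith

theorem PPlus_subset_realDominant : PPlus n ⊆ realDominant n := by
  intro x hx α
  obtain ⟨k, hk⟩ := hx α
  have := one_le_index_sub α
  have h2 : (0 : ℝ) ≤ k := Nat.cast_nonneg k
  rw [level_eq_pairing, hk]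
  linarith

theorem antitone_of_mem_PPlus {x : WeightSpace n} (hx : x ∈ PPlus n) : Antitone x.1 := by
  intro i j hij
  rcases hij.eq_or_lt with rfl | hlt
  · exact le_rfl
  · obtain ⟨k, hk⟩ := hx ⟨(i, j), hlt⟩
    have h2 : (0 : ℝ) ≤ k := Nat.cast_nonneg k
    rw [pairing] at hk
    linarith

/-- The real dominant weights in the orbit of an element of `P^+` belong to `P^+`. -/
theorem mem_PPlus_of_orbit {x y : WeightSpace n} (hx : x ∈ PPlus n) (hy : y ∈ orbit l x)
    (hd : y ∈ realDominant n) : y ∈ PPlus n := by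
  have hdiff : ∀ i j, ∃ k : ℤ, x.1 i - x.1 j = k := by
    intro i j
    rcases lt_trichotomy i j with h | rfl | h
    · obtain ⟨k, hk⟩ := hx ⟨(i, j), h⟩
      exact ⟨k, by rw [pairing] at hk; rw [hk]; simp⟩
    · exact ⟨0, by simp⟩
    · obtain ⟨k, hk⟩ := hx ⟨(j, i), h⟩
      refine ⟨-k, ?_⟩
      rw [pairing] at hk
      push_cast
      linarith
  have hint : ∀ α, ∃ k : ℤ, pairing y α = k := by
    obtain ⟨g, rfl⟩ := hy
    obtain ⟨σ, m, h⟩ := exists_coord_smul g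
    intro α
    obtain ⟨k, hk⟩ := hdiff (σ α.1.1) (σ α.1.2)
    have h1 := h x α.1.1
    have h2 := h x α.1.2
    simp only [coord, Submodule.coe_add, Pi.add_apply, rho_apply] at h1 h2
    refine ⟨k - (σ α.1.1 : ℕ) + (σ α.1.2 : ℕ) + l * m α.1.1 - l * m α.1.2 + (α.1.1 : ℕ)
      - (α.1.2 : ℕ), ?_⟩
    push_cast
    change (g • x).1 α.1.1 - (g • x).1 α.1.2 = _
    linarith
  have hanti : Antitone y.1 := by
    rw [Fin.antitone_iff_succ_le]
    intro m
    obtain ⟨k, hk⟩ := hint (simpleRoot m)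
    have h1 := hd (simpleRoot m)
    -- At a simple root the level is the pairing plus 1, so positivity makes the integral pairing
    -- nonnegative.
    rw [level_eq_pairing, hk] at h1
    simp only [simpleRoot, Fin.val_succ, Fin.val_castSucc] at h1
    push_cast at h1
    have h2 : (-1 : ℝ) < k := by linarith
    have h3 : (-1 : ℤ) < k := by exact_mod_cast h2
    have h4 : (0 : ℝ) ≤ k := by exact_mod_cast (by omega : 0 ≤ k)
    simp only [pairing, simpleRoot] at hk
    linarith
  intro α
  obtain ⟨k, hk⟩ := hint α
  have h1 := hanti α.2.le
  have h2 : (0 : ℝ) ≤ k := by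
    rw [← hk, pairing]
    linarith
  have h3 : 0 ≤ k := by exact_mod_cast h2
  refine ⟨k.toNat, ?_⟩
  rw [hk]
  exact_mod_cast (Int.toNat_of_nonneg h3).symm

/-- A path in `P^+` exists only if the fundamental alcove contains an element of `P^+`. -/
theorem IsPath.le_of_PPlus {q : List (WeightSpace n)} (h : IsPath l (PPlus n) q) : n ≤ l := by
  induction h with
  | @start ν hν hfund =>
    rcases Nat.eq_zero_or_pos n with rfl | hn
    · exact Nat.zero_le _
    · have hlt : (0 : Fin (n + 1)) < Fin.last n := hn
      have h1 := hfund.2 ⟨(0, Fin.last n), hlt⟩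
      obtain ⟨k, hk⟩ := hν ⟨(0, Fin.last n), hlt⟩
      have h2 : (0 : ℝ) ≤ k := Nat.cast_nonneg k
      rw [level_eq_pairing, hk] at h1
      simp only [Fin.val_last, Fin.val_zero, Nat.cast_zero, sub_zero] at h1
      have h3 : (n : ℝ) ≤ l := by linarith
      exact_mod_cast h3
  | step _ _ _ ih => exact ih

/-- The fundamental weight that is largest on the coordinates in `J`. -/
noncomputable def indicatorWeight (J : Finset (Fin (n + 1))) : WeightSpace n :=
  ⟨fun i => (if i ∈ J then 1 else 0) - (J.card : ℝ) / (n + 1), by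
    change ∑ i, ((if i ∈ J then (1 : ℝ) else 0) - (J.card : ℝ) / (n + 1)) = 0
    have : (n : ℝ) + 1 ≠ 0 := by positivity
    rw [Finset.sum_sub_distrib, Finset.sum_boole, Finset.sum_const]
    simp
    field_simp
    ring⟩

/-- Induction on the pairing with the highest coroot. Subtracting the fundamental weight of the set
of coordinates larger than the last lowers each integral level by 0 or 1, so no multiple of `l` is
strictly crossed. The descent ends at 0, which lies in the fundamental alcove because `n ≤ l`. -/
theorem exists_isPath_PPlus (hl : 0 < l) (hn : n ≤ l) (N : ℕ) : ∀ x ∈ PPlus n,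
    x.1 0 - x.1 (Fin.last n) = N → ∃ p, IsPath l (PPlus n) (x :: p) := by
  induction N with
  | zero =>
    intro x hx h0
    have hx0 : x = 0 := by
      have hanti := antitone_of_mem_PPlus hx
      have hconst : ∀ i, x.1 i = x.1 0 := fun i => by
        have h1 := hanti (Fin.zero_le i)
        have h2 := hanti (Fin.le_last i)
        push_cast at h0
        linarith
      have hs : ∑ i, x.1 i = 0 := x.2
      rw [Finset.sum_congr rfl fun i _ => hconst i, Finset.sum_const, Finset.card_univ,
        Fintype.card_fin, nsmul_eq_mul, mul_eq_zero] at hs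
      have hz : x.1 0 = 0 := hs.resolve_left (by positivity)
      exact Subtype.ext (funext fun i => by rw [hconst, hz]; rfl)
    subst hx0
    refine ⟨[], IsPath.start hx ⟨PPlus_subset_realDominant hx, fun α => ?_⟩⟩
    have hp : pairing (0 : WeightSpace n) α = 0 := sub_self _
    rw [level_eq_pairing, hp]
    have h1 : ((α.1.2 : ℕ) : ℝ) ≤ n := by exact_mod_cast Nat.lt_succ_iff.mp α.1.2.2
    have h2 : (n : ℝ) ≤ l := by exact_mod_cast hn
    have h3 : (0 : ℝ) ≤ (α.1.1 : ℕ) := Nat.cast_nonneg _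
    linarith
  | succ N ih =>
    intro x hx hN
    have hanti := antitone_of_mem_PPlus hx
    set J := Finset.univ.filter fun i => x.1 (Fin.last n) < x.1 i with hJ
    have hmem : ∀ i, i ∈ J ↔ x.1 (Fin.last n) < x.1 i := fun i => by simp [hJ]
    have hpair : ∀ α, pairing (x - indicatorWeight J) α =
        pairing x α - ((if α.1.1 ∈ J then 1 else 0) - if α.1.2 ∈ J then 1 else 0) := by
      intro α
      simp only [pairing, indicatorWeight, Submodule.coe_sub, Pi.sub_apply]
      ring
    have hcases : ∀ α : PosRoot n, ∃ a b : ℕ, pairing x α = b ∧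
        pairing (x - indicatorWeight J) α = a ∧ (b = a ∨ b = a + 1) := by
      intro α
      obtain ⟨k, hk⟩ := hx α
      have h1 := hanti α.2.le
      rw [hpair, hk]
      by_cases h2 : α.1.2 ∈ J
      · have h3 : α.1.1 ∈ J := by rw [hmem] at h2 ⊢; exact h2.trans_le h1
        exact ⟨k, k, rfl, by rw [if_pos h3, if_pos h2]; ring, Or.inl rfl⟩
      · by_cases h3 : α.1.1 ∈ J
        · have h4 : 0 < k := by
            rw [hmem] at h2 h3
            have h5 : (0 : ℝ) < k := by rw [← hk, pairing]; linarith
            exact_mod_cast h5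
          refine ⟨k - 1, k, rfl, ?_, Or.inr (by omega)⟩
          rw [if_pos h3, if_neg h2, Nat.cast_sub h4]
          push_cast
          ring
        · exact ⟨k, k, rfl, by rw [if_neg h3, if_neg h2]; ring, Or.inl rfl⟩
    have hmem' : x - indicatorWeight J ∈ PPlus n := fun α => by
      obtain ⟨a, -, -, h, -⟩ := hcases α
      exact ⟨a, h⟩
    have hstep : IsStep l (x - indicatorWeight J) x := by
      refine isStep_of_le hl (fun α => ?_) fun H hs => ?_
      · obtain ⟨a, b, h1, h2, h3⟩ := hcases α
        rw [level_eq_pairing, level_eq_pairing, h1, h2]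
        have : (a : ℝ) ≤ b := by exact_mod_cast (by omega : a ≤ b)
        linarith
      · obtain ⟨a, b, h1, h2, h3⟩ := hcases H.1
        have e : ∀ c : ℕ, (c : ℝ) + ((H.1.1.2 : ℕ) - (H.1.1.1 : ℕ)) - H.2 * l =
            ((c + ((H.1.1.2 : ℕ) - (H.1.1.1 : ℕ)) - H.2 * l : ℤ) : ℝ) := fun c => by push_cast; ring
        rw [Sep, val, val, level_eq_pairing, level_eq_pairing, h1, h2, e, e] at hs
        norm_cast at hs
        rcases h3 with rfl | rfl
        · exact absurd hs (not_lt.mpr (mul_self_nonneg _))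
        · rcases mul_neg_iff.mp hs with ⟨ha, hb⟩ | ⟨ha, hb⟩ <;> push_cast at ha hb <;> omega
    have hlast : Fin.last n ∉ J := by rw [hmem]; exact lt_irrefl _
    have hfirst : (0 : Fin (n + 1)) ∈ J := by
      rw [hmem]
      have : (0 : ℝ) < (N + 1 : ℕ) := by positivity
      linarith
    obtain ⟨p, hp⟩ := ih _ hmem' (by
      simp only [indicatorWeight, Submodule.coe_sub, Pi.sub_apply]
      rw [if_pos hfirst, if_neg hlast]
      push_cast at hN
      linarith)
    exact ⟨_, hp.step hx hstep⟩

theorem exists_isPath_of_orbit (hl : 0 < l) {lam κ : WeightSpace n} {p : List (WeightSpace n)}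
    (h : IsPath l (PPlus n) (lam :: p)) (hκ : κ ∈ orbit l lam) (hd : κ ∈ realDominant n) :
    ∃ p', IsPath l (PPlus n) (κ :: p') := by
  have hmem := mem_PPlus_of_orbit h.head_mem hκ hd
  have hN : ∃ N : ℕ, κ.1 0 - κ.1 (Fin.last n) = N := by
    rcases (Fin.zero_le (Fin.last n)).eq_or_lt with h0 | hlt
    · exact ⟨0, by rw [← h0]; simp⟩
    · exact hmem ⟨(0, Fin.last n), hlt⟩
  obtain ⟨N, hN⟩ := hN
  exact exists_isPath_PPlus hl h.le_of_PPlus N κ hmem hN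

end Paths

/-! ### Independence of the path. -/

section Independence

variable {n l : ℕ}

open Classical in
/-- The indecomposable self-dual pattern with highest weight `lam`. -/
noncomputable def tiltingPattern (hl : 0 < l) (lam : WeightSpace n) : Pattern n :=
  -- The default value 0 never occurs at end points of paths in the two sets of weights considered.
  if h : ∃ Q, IsIndecomposable l lam Q ∧ OrbitSelfDual hl lam Q then h.choose else 0

/-- Uniqueness identifies every result with a pattern whose definition does not mention `S` or the
path; existence of at least one result gives the converse. Hence the real and the integral
procedures share their patterns. -/
theorem yields_iff (hl : 0 < l) {S : Set (WeightSpace n)} (hS : S ⊆ realDominant n)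
    (hreach : ∀ lam p κ, IsPath l S (lam :: p) → κ ∈ orbit l lam → κ ∈ realDominant n →
      ∃ p', IsPath l S (κ :: p')) {lam : WeightSpace n} {p : List (WeightSpace n)}
    (hp : IsPath l S (lam :: p)) (Q : Pattern n) :
    Yields l S (lam :: p) Q ↔ Q = tiltingPattern hl lam := by
  have hlam := hS hp.head_mem
  have key : ∀ R, Yields l S (lam :: p) R → R = tiltingPattern hl lam := by
    intro R hR
    obtain ⟨-, h1, h2⟩ := hR.spec hl hS rfl
    have h : ∃ Q, IsIndecomposable l lam Q ∧ OrbitSelfDual hl lam Q := ⟨R, h1, h2⟩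
    rw [tiltingPattern, dif_pos h]
    exact h1.unique hl hlam h.choose_spec.1 h2 h.choose_spec.2
  refine ⟨key Q, ?_⟩
  rintro rfl
  obtain ⟨R, hR, -⟩ := exists_yields hl hS hreach _ hp rfl (Nat.lt_succ_self _)
  rwa [← key R hR]

end Independence

end SingularTilting

theorem mainTheorem5 (n l : ℕ) (hl : 0 < l) :
    ∃ Pat : SingularTilting.WeightSpace n → SingularTilting.Pattern n,
      (∀ lam ∈ SingularTilting.realDominant n,
        ∃ p, SingularTilting.IsPath l (SingularTilting.realDominant n) (lam :: p)) ∧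
      (∀ lam p, SingularTilting.IsPath l (SingularTilting.realDominant n) (lam :: p) →
        ∀ Q, SingularTilting.Yields l (SingularTilting.realDominant n) (lam :: p) Q ↔
          Q = Pat lam) ∧
      (∀ lam p, SingularTilting.IsPath l (SingularTilting.PPlus n) (lam :: p) →
        ∀ Q, SingularTilting.Yields l (SingularTilting.PPlus n) (lam :: p) Q ↔
          Q = Pat lam) :=
  ⟨SingularTilting.tiltingPattern hl, SingularTilting.exists_isPath_real hl,
    fun _ _ hp Q => SingularTilting.yields_iff hl subset_rfl
      (fun _ _ κ _ _ hκ => SingularTilting.exists_isPath_real hl κ hκ) hp Q,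
    fun _ _ hp Q => SingularTilting.yields_iff hl SingularTilting.PPlus_subset_realDominant
      (fun _ _ _ h hκ hd => SingularTilting.exists_isPath_of_orbit hl h hκ hd) hp Q⟩
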